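/- All logarithms are to base $2$. Consider the uni-directional line with nodes $0,\dots,n-1$, in which every link $v\to v+1$ carries at most $c$ packets per time step and every node has a buffer that stores at most $B$ packets between consecutive time steps ($B,c$ integers). A request $r=(a,b,t)$ ($a\le b$) asks to deliver a packet that is input to node $a$ at time $t\in\mathbb N$ to node $b$; there are no deadlines. In each time step a packet in the network is forwarded over the outgoing link or stored in the buffer; it leaves the network on reaching its destination. In the space-time graph, routing is the packing of paths from $(a,t)$ to a copy $(b,t')$ of $b$, with edges $(v,t)\to(v+1,t+1)$ (vertical, capacity $c$) and $(v,t)\to(v,t+1)$ (horizontal, capacity $B$). For a finite sequence $\sigma$ of requests, $|\mathrm{opt}(\sigma)|$ is the largest number of requests that can be delivered simultaneously. **Algorithm ALG.** A lightest-path oracle is given (see step 1). *Tiling.* If $Bc<\log n$, put $\tau=2\lceil(\log n)/c\rceil$ and $Q=2\lceil(\log n)/B\rceil$; otherwise $\tau=2B$, $Q=2c$. Draw phase shifts $\phi_\tau\in\{0,\dots,\tau-1\}$ and $\phi_Q\in\{0,\dots,Q-1\}$ uniformly, and a fair coin. Vertex $(v,t)$ has untilted coordinates $(v,t-v)$; the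 untilted grid is tiled by rectangles of height $Q$ (first coordinate, north) and length $\tau$ (second coordinate, east), one of which has its lower left corner at $(\phi_Q,\phi_\tau)$. Each tile is divided into the quadrants SW, SE, NW, NE of size $\frac Q2\times\frac\tau2$. A request is *near* if the tile of $(a,t)$ contains a copy of $b$, and *far* otherwise; $\mathrm{Far}^+$ is the set of far requests with $(a,t)$ in the SW-quadrant of its tile. According to the fair coin, ALG handles only the near requests or only the requests in $\mathrm{Far}^+$; all others are rejected. Requests input in the same time step are handled one by one in the order of their indices in $\sigma$. *Near.* A near request is routed along the vertical path from $(a,t)$ to a copy of $b$ if no edge of that path is already used by $c$ accepted requests; otherwise it is rejected. *$\mathrm{Far}^+$.* The sketch graph has the tiles as nodes, with an edge from each tile to its northern and to its eastern neighbour, all of capacity $c^S=\min(\tau c,QB)$. Let $p_{\max}=4n$, $k=\lceil\log(1+3p_{\max})\rceil$, $\lambda=1/(200k)$. At every space-time vertex only the $B+c$ requests of $\mathrm{Far}^+$ with the closest destinations are considered (ties by index), the others being rejected; the $i$-th of them ($i=0,1,\dots$) belongs to plane $i$. A considered request goes through the following steps. 1. *Path packing.* Every sketch edge has a weight $x_e$,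 initially $0$. The oracle returns a lightest sketch path $\hat p$ among those with at most $p_{\max}$ edges that lead from the tile of $(a,t)$ to a tile with a copy of $b$ and end in the first such tile. If its weight is at least $1$, reject. Otherwise replace $x_e$ by $x_e2^{1/c^S}+\frac1{p_{\max}}(2^{1/c^S}-1)$ for all $e\in\hat p$; this update stays in force even if a later step rejects the request. 2. *Sparsification.* With probability $1-\lambda$, independently, reject. 3. *Load test.* If adding $\hat p$ to the sketch paths that have passed this test would make at least $c^S/4$ of them use some sketch edge, reject. 4. *$I$-routing.* The request is to leave the SW-quadrant on a straight path, horizontal if $i<B$ and vertical if $i\ge B$. If an injected packet of the same plane and SW-quadrant started in the same row (for $i<B$), respectively column (for $i\ge B$), or if the number of packets routed out of this SW-quadrant would exceed $c^S/4$, reject. Otherwise inject the packet. *Detailed routing.* An injected packet has at each vertex a goal direction: north in a tile that contains a copy of its destination; otherwise straight on in the SW-quadrant, north in the SE-quadrant and east in the NW-quadrant ($T$-routing), and in the NE-quadrant the direction in which $\hat p$ leaves the tile ($X$-routing). At every vertex, the north edge ($c$ places) is given to packets with goal north and the east edge ($B$ places) to packets with goal east, packets that go straight preceding packets that turn, and then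 by index. A packet that gets no place in its goal direction continues straight. **Theorem.** There is a constant $C>0$ such that for all $n>16$, all integers $B,c\in[1,\log n]$ and every lightest-path oracle: (i) for every input sequence and all random choices, ALG is a legal non-preemptive routing: every request is rejected or injected in the time step in which it is input, no injected packet is deleted, every injected packet reaches its destination, and all link and buffer capacities are respected; (ii) ALG is online: for fixed random choices, its behaviour before time $T$ depends only on the requests that are input before time $T$; (iii) ALG is $O(\log n)$-competitive against an oblivious adversary: for every finite sequence $\sigma$ of requests, chosen independently of the random choices, $$\mathbb E\bigl[|\mathrm{ALG}(\sigma)|\bigr]\ \ge\ \frac1{C\log n}\,|\mathrm{opt}(\sigma)|,$$ where $\mathrm{ALG}(\sigma)$ is the set of requests that ALG delivers. In particular this covers $B=1$ and $c=1$. -/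

import Mathlib

namespace PacketRouting

/-! ### The network, requests, routes, optimal throughput -/

/-- A uni-directional line with nodes `0, …, n - 1`, links `v → v + 1` of capacity `c`, and a buffer
of size `B` in every node. -/
structure LineNetwork where
  n : ℕ
  B : ℕ
  c : ℕ

/-- A packet request (without deadline): source, destination, and the time step in which the packet
is input to its source. -/
structure Request (n : ℕ) where
  src : Fin n
  dst : Fin n
  time : ℕ
  src_le_dst : src ≤ dst

/-- What happens to a packet in one time step: it is sent along the outgoing link of the node in
which it is, or it is stored in the buffer of that node. These are also the two directions of the
untilted space-time grid: `forward` is north (vertical) and `hold` is east (horizontal). -/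
inductive Move where
  | forward
  | hold
  deriving DecidableEq

/-- The capacity of the vertical, resp. horizontal, edges of the space-time graph. -/
def LineNetwork.cap (N : LineNetwork) : Move → ℕ
  | .forward => N.c
  | .hold => N.B

/-- The node in which the packet of request `q` is after the moves `l`. -/
def Request.nodeAfter {n : ℕ} (q : Request n) (l : List Move) : ℕ :=
  q.src + l.count .forward

/-- The packet of request `q`, which starts at `(q.src, q.time)` and makes the moves `l`, uses the
space-time edge that leaves `(v, t)` in direction `m`. -/
def Request.Crosses {n : ℕ} (q : Request n) (l : List Move) (m : Move) (v t : ℕ) : Prop :=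
  ∃ j, l[j]? = some m ∧ q.nodeAfter (l.take j) = v ∧ q.time + j = t

/-- `p i` is the sequence of moves of the `i`-th packet (`none`: not in the network). In every time
step every link carries at most `c` packets and every buffer stores at most `B` packets. -/
def RespectsCapacities (N : LineNetwork) (σ : List (Request N.n)) (p : ℕ → Option (List Move)) :
    Prop :=
  ∀ (m : Move) (v t : ℕ),
    {i : ℕ | ∃ q l, σ[i]? = some q ∧ p i = some l ∧ q.Crosses l m v t}.ncard ≤ N.cap m

/-- A feasible routing of the requests `i` with `p i ≠ none`: each of them gets a path from
`(src, time)` to a copy of its destination in the space-time graph. -/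
def IsPacking (N : LineNetwork) (σ : List (Request N.n)) (p : ℕ → Option (List Move)) : Prop :=
  (∀ i l, p i = some l → ∃ q, σ[i]? = some q ∧ q.nodeAfter l = q.dst) ∧ RespectsCapacities N σ p

/-- The optimal (offline) throughput `|opt(σ)|`. -/
noncomputable def opt (N : LineNetwork) (σ : List (Request N.n)) : ℕ :=
  sSup {k | ∃ p, IsPacking N σ p ∧ {i : ℕ | (p i).isSome}.ncard = k}

/-- One time step of a packet that has made the moves `l` so far: once it is at its destination it
has been removed from the network; otherwise it is forwarded or stored. -/
def Request.Advances {n : ℕ} (q : Request n) (l l' : List Move) : Prop :=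
  if q.nodeAfter l = q.dst then l' = l else ∃ m, l' = l ++ [m]

/-- `p T i` is the sequence of moves that packet `i` has made in the time steps before `T`
(`none`: it has not been input yet, or it was rejected). This is a legal non-preemptive operation of
the network: a packet is rejected or injected in the time step of its input, a rejection is final,
an injected packet is never deleted, and all capacities are respected. -/
structure IsNonpreemptiveExecution (N : LineNetwork) (σ : List (Request N.n))
    (p : ℕ → ℕ → Option (List Move)) : Prop where
  absent : ∀ i T, (∀ q, σ[i]? = some q → T ≤ q.time) → p T i = none
  admission : ∀ i q, σ[i]? = some q →
    p (q.time + 1) i = none ∨ ∃ l, p (q.time + 1) i = some l ∧ q.Advances [] l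
  rejected : ∀ i q T, σ[i]? = some q → q.time < T → p T i = none → p (T + 1) i = none
  injected : ∀ i q T l, σ[i]? = some q → p T i = some l →
    ∃ l', p (T + 1) i = some l' ∧ q.Advances l l'
  capacities : ∀ T, RespectsCapacities N σ (p T)

/-- The requests that are delivered to their destination. -/
def deliveredSet {n : ℕ} (σ : List (Request n)) (p : ℕ → ℕ → Option (List Move)) : Set ℕ :=
  {i | ∃ q T l, σ[i]? = some q ∧ p T i = some l ∧ q.nodeAfter l = q.dst}

/-! ### Parameters of the algorithm -/

open Classical in
/-- Length `τ` (horizontal, time) of a tile. -/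
noncomputable def LineNetwork.tau (N : LineNetwork) : ℕ :=
  if ((N.B * N.c : ℕ) : ℝ) < Real.logb 2 N.n then 2 * ⌈Real.logb 2 N.n / N.c⌉₊ else 2 * N.B

open Classical in
/-- Height `Q` (vertical, space) of a tile. -/
noncomputable def LineNetwork.Q (N : LineNetwork) : ℕ :=
  if ((N.B * N.c : ℕ) : ℝ) < Real.logb 2 N.n then 2 * ⌈Real.logb 2 N.n / N.B⌉₊ else 2 * N.c

/-- The common capacity `c^S` of all edges between tiles: the vertical edges have `τ·c`, the
horizontal ones `Q·B`, and the larger value is reduced to the smaller. -/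
noncomputable def LineNetwork.cS (N : LineNetwork) : ℕ := min (N.tau * N.c) (N.Q * N.B)

/-- The maximum length of a sketch path. -/
def LineNetwork.pmax (N : LineNetwork) : ℕ := 4 * N.n

noncomputable def LineNetwork.k (N : LineNetwork) : ℕ := ⌈Real.logb 2 (1 + 3 * N.pmax)⌉₊

/-- The probability with which the sparsification keeps a request. -/
noncomputable def LineNetwork.lam (N : LineNetwork) : ℝ := 1 / (200 * N.k)

/-- The random choices: the two phase shifts of the tiling, the choice between `Far⁺` (`true`) and
`Near` (`false`), and the biased coin of every request. -/
structure Coins where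
  phaseTime : ℤ
  phaseSpace : ℤ
  far : Bool
  keep : ℕ → Bool

/-- Expectation over the random choices for a sequence of `m` requests: the phase shifts are
uniform in `{0, …, τ-1}` and `{0, …, Q-1}`, the choice of the class is a fair coin, the coins of the
requests are `true` with probability `λ`, and all are independent. -/
noncomputable def expectation (N : LineNetwork) (m : ℕ) (f : Coins → ℝ) : ℝ :=
  ∑ a : Fin N.tau, ∑ b : Fin N.Q, ∑ far : Bool, ∑ X : Fin m → Bool,
    (1 / N.tau) * (1 / N.Q) * (1 / 2) * (∏ i, if X i then N.lam else 1 - N.lam) *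
      f { phaseTime := (a : ℕ), phaseSpace := (b : ℕ), far := far,
          keep := fun i => if h : i < m then X ⟨i, h⟩ else false }

/-! ### Tiles and quadrants of the untilted space-time graph

The space-time vertex `(v, t)` has the untilted coordinates `(v, t - v)`. -/

/-- A tile: its row (space) and its column (time). -/
abbrev Tile := ℤ × ℤ

noncomputable def tileRow (N : LineNetwork) (ω : Coins) (v : ℤ) : ℤ := (v - ω.phaseSpace) / N.Q

noncomputable def tileCol (N : LineNetwork) (ω : Coins) (v t : ℤ) : ℤ :=
  (t - v - ω.phaseTime) / N.tau

noncomputable def tileOf (N : LineNetwork) (ω : Coins) (v t : ℤ) : Tile :=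
  (tileRow N ω v, tileCol N ω v t)

/-- `(v, t)` is in the lower half of its tile. -/
def InSouth (N : LineNetwork) (ω : Coins) (v : ℤ) : Prop := 2 * ((v - ω.phaseSpace) % N.Q) < N.Q

/-- `(v, t)` is in the left half of its tile. -/
def InWest (N : LineNetwork) (ω : Coins) (v t : ℤ) : Prop :=
  2 * ((t - v - ω.phaseTime) % N.tau) < N.tau

/-- The tile that contains the source vertex. -/
noncomputable def sourceTile (N : LineNetwork) (ω : Coins) (q : Request N.n) : Tile :=
  tileOf N ω (q.src : ℕ) q.time

/-- The tile of the source vertex contains a copy of the destination. -/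
def IsNear (N : LineNetwork) (ω : Coins) (q : Request N.n) : Prop :=
  tileRow N ω (q.src : ℕ) = tileRow N ω (q.dst : ℕ)

/-- Far requests whose source vertex is in the SW-quadrant of its tile. -/
def IsFarPlus (N : LineNetwork) (ω : Coins) (q : Request N.n) : Prop :=
  ¬ IsNear N ω q ∧ InSouth N ω (q.src : ℕ) ∧ InWest N ω (q.src : ℕ) q.time

/-! ### The sketch graph -/

/-- An edge of the sketch graph between two tiles: the edge that leaves the given tile towards its
northern (`forward`) or eastern (`hold`) neighbour. -/
abbrev SketchEdge := Tile × Move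

def nextTile (s : Tile) : Move → Tile
  | .forward => (s.1 + 1, s.2)
  | .hold => (s.1, s.2 + 1)

/-- The edges of the sketch path that starts in tile `s` and makes the steps `w`. -/
def sketchEdges : Tile → List Move → List SketchEdge
  | _, [] => []
  | s, m :: w => (s, m) :: sketchEdges (nextTile s m) w

/-- The sketch paths that may serve a far request from tile `s` to a node in row `R` of tiles: at
most `pmax` edges, ending in the first tile on the way that contains a copy of the destination. So
the path ends in row `R` and its last edge is vertical. (The edge from the last tile to
the sink of the destination has infinite capacity and weight zero, and is left out.) -/
def IsLegalSketchPath (N : LineNetwork) (s : Tile) (R : ℤ) (w : List Move) : Prop :=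
  s.1 + (w.count .forward : ℤ) = R ∧ w.getLast? = some .forward ∧ w.length ≤ N.pmax

def pathWeight (x : SketchEdge → ℝ) (s : Tile) (w : List Move) : ℝ := ((sketchEdges s w).map x).sum

/-- Given edge weights, a source tile and a row of tiles, an oracle returns a sketch path. -/
abbrev Oracle := (SketchEdge → ℝ) → Tile → ℤ → List Move

/-- The oracle returns a lightest legal path whenever there is a legal path. -/
def IsLightestPathOracle (N : LineNetwork) (oracle : Oracle) : Prop :=
  ∀ (x : SketchEdge → ℝ) (s : Tile) (R : ℤ), (∃ w, IsLegalSketchPath N s R w) →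
    IsLegalSketchPath N s R (oracle x s R) ∧
      ∀ w, IsLegalSketchPath N s R w → pathWeight x s (oracle x s R) ≤ pathWeight x s w

/-! ### State of the algorithm -/

/-- An injected packet: the index of its request, its request, its sketch path, the plane of the
SW-quadrant to which it belongs, the direction in which it leaves its source, and the moves it has
made so far. (Sketch path and plane are not used for near requests.) -/
structure Packet (n : ℕ) where
  id : ℕ
  req : Request n
  sketch : List Move
  plane : ℕ
  start : Move
  moves : List Move

def Packet.node {n : ℕ} (p : Packet n) : ℕ := p.req.nodeAfter p.moves

def Packet.now {n : ℕ} (p : Packet n) : ℕ := p.req.time + p.moves.length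

def Packet.Arrived {n : ℕ} (p : Packet n) : Prop := p.node = p.req.dst

/-- The direction in which the packet is travelling. -/
def Packet.heading {n : ℕ} (p : Packet n) : Move := p.moves.getLast?.getD p.start

/-- All packets injected so far, the edge weights of the online path packing algorithm, and for every
sketch edge the number of sketch paths that passed the load test and use it. -/
structure State (n : ℕ) where
  packets : List (Packet n)
  weight : SketchEdge → ℝ
  load : SketchEdge → ℕ

def State.init (n : ℕ) : State n := ⟨[], fun _ => 0, fun _ => 0⟩

/-! ### Admission

A request comes with its index in the input sequence; `batch` holds the requests that are input in
the same time step. -/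

open Classical in
/-- The number of `Far⁺` requests of the batch at the same node that precede `q` in the order by
destination (closest first), ties being broken by the index. -/
noncomputable def rank (N : LineNetwork) (ω : Coins) (batch : List (Request N.n × ℕ))
    (q : Request N.n × ℕ) : ℕ :=
  (batch.filter fun q' => q'.1.src = q.1.src ∧ IsFarPlus N ω q'.1 ∧
    (q'.1.dst < q.1.dst ∨ q'.1.dst = q.1.dst ∧ q'.2 < q.2)).length

/-- The weights after a request has been routed along a path with the edges `es`. -/
noncomputable def updateWeight (N : LineNetwork) (x : SketchEdge → ℝ) (es : List SketchEdge) :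
    SketchEdge → ℝ := fun e =>
  if e ∈ es then
    x e * (2 : ℝ) ^ (1 / (N.cS : ℝ)) + 1 / N.pmax * ((2 : ℝ) ^ (1 / (N.cS : ℝ)) - 1)
  else x e

/-- The direction of `I`-routing in a plane: horizontal in the first `B` planes, vertical in the
others. -/
def planeDir (N : LineNetwork) (i : ℕ) : Move := if i < N.B then .hold else .forward

open Classical in
/-- `I`-routing of `q` in plane `i` of the SW-quadrant of its tile fails if the row (for a
horizontal plane) or the column (for a vertical plane) of its source is occupied, or if the number
of packets routed out of this SW-quadrant would exceed `c^S / 4`. -/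
def IRoutingFails (N : LineNetwork) (ω : Coins) (S : State N.n) (q : Request N.n) (i : ℕ) : Prop :=
  (∃ p ∈ S.packets, sourceTile N ω p.req = sourceTile N ω q ∧ p.plane = i ∧
    match planeDir N i with
    | .hold => p.req.src = q.src
    | .forward => (p.req.time : ℤ) - (p.req.src : ℕ) = (q.time : ℤ) - (q.src : ℕ)) ∨
  N.cS < 4 * ((S.packets.filter fun p => sourceTile N ω p.req = sourceTile N ω q).length + 1)

open Classical in
/-- The treatment of a request that arrives, when the class `Far⁺` is selected. -/
noncomputable def handleFar (N : LineNetwork) (oracle : Oracle) (ω : Coins)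
    (batch : List (Request N.n × ℕ)) (S : State N.n) (q : Request N.n × ℕ) : State N.n :=
  let s := sourceTile N ω q.1
  let i := rank N ω batch q
  let w := oracle S.weight s (tileRow N ω (q.1.dst : ℕ))
  let es := sketchEdges s w
  let S₁ : State N.n := { S with weight := updateWeight N S.weight es }
  let S₂ : State N.n := { S₁ with load := fun e => if e ∈ es then S.load e + 1 else S.load e }
  -- only the `B + c` closest far requests from the SW-quadrants are considered at each node
  if ¬ IsFarPlus N ω q.1 ∨ N.B + N.c ≤ i then S
  -- online integral path packing
  else if 1 ≤ pathWeight S.weight s w then S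
  -- random sparsification
  else if ω.keep q.2 = false then S₁
  -- load test
  else if ∃ e ∈ es, N.cS ≤ 4 * (S.load e + 1) then S₁
  else if IRoutingFails N ω S q.1 i then S₂
  else { S₂ with
    packets := S.packets ++ [⟨q.2, q.1, w, i, planeDir N i, []⟩] }

open Classical in
/-- The treatment of a request that arrives, when the class `Near` is selected: greedy vertical
routing. The request is injected iff no edge of its vertical path is saturated. -/
noncomputable def handleNear (N : LineNetwork) (ω : Coins) (S : State N.n) (q : Request N.n × ℕ) :
    State N.n :=
  if IsNear N ω q.1 ∧ ∀ v : Fin N.n, q.1.src ≤ v → v < q.1.dst →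
      (S.packets.filter fun p =>
        (p.req.time : ℤ) - (p.req.src : ℕ) = (q.1.time : ℤ) - (q.1.src : ℕ) ∧
          p.req.src ≤ v ∧ v < p.req.dst).length < N.c
  then { S with packets := S.packets ++ [⟨q.2, q.1, [], 0, .forward, []⟩] }
  else S

noncomputable def handleRequest (N : LineNetwork) (oracle : Oracle) (ω : Coins)
    (batch : List (Request N.n × ℕ)) (S : State N.n) (q : Request N.n × ℕ) : State N.n :=
  if ω.far then handleFar N oracle ω batch S q else handleNear N ω S q

/-! ### Detailed routing -/

open Classical in
/-- The direction a packet should take: north in a tile that contains a copy of its destination;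
straight on in the SW-quadrant (`I`-routing); north in the SE-quadrant and east in the NW-quadrant
(`T`-routing); in the NE-quadrant the direction in which its sketch path leaves the tile
(`X`-routing). -/
noncomputable def goal (N : LineNetwork) (ω : Coins) (p : Packet N.n) : Move :=
  let s := tileOf N ω p.node p.now
  let s₀ := sourceTile N ω p.req
  if s.1 = tileRow N ω (p.req.dst : ℕ) then .forward
  else if InSouth N ω p.node then
    if InWest N ω p.node p.now then p.heading else .forward
  else
    if InWest N ω p.node p.now then .hold
    else p.sketch.getD ((s.1 - s₀.1) + (s.2 - s₀.2)).toNat .forward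

/-- `p'` has precedence over `p`: packets that go straight precede packets that turn; otherwise the
smaller index precedes. -/
def Precedes (N : LineNetwork) (ω : Coins) (p' p : Packet N.n) : Prop :=
  (goal N ω p' = p'.heading ∧ goal N ω p ≠ p.heading) ∨
  ((goal N ω p' = p'.heading ↔ goal N ω p = p.heading) ∧ p'.id < p.id)

open Classical in
/-- The move of a packet that has not arrived yet: it takes the edge in its goal direction unless
this edge is saturated by packets with the same goal direction that have precedence; in that case it
travels straight on. -/
noncomputable def decideMove (N : LineNetwork) (ω : Coins) (ps : List (Packet N.n))
    (p : Packet N.n) : Move :=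
  if (ps.filter fun p' => ¬ p'.Arrived ∧ p'.node = p.node ∧ goal N ω p' = goal N ω p ∧
      Precedes N ω p' p).length < N.cap (goal N ω p)
  then goal N ω p else p.heading

open Classical in
noncomputable def movePackets (N : LineNetwork) (ω : Coins) (ps : List (Packet N.n)) :
    List (Packet N.n) :=
  ps.map fun p => if p.Arrived then p else { p with moves := p.moves ++ [decideMove N ω ps p] }

/-! ### The algorithm -/

/-- The requests that are input in time step `t`, with their indices. -/
def arrivals {n : ℕ} (σ : List (Request n)) (t : ℕ) : List (Request n × ℕ) :=
  σ.zipIdx.filter fun q => q.1.time = t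

/-- One time step: the requests that are input are rejected or injected one by one, then all packets
in the network are forwarded or stored. -/
noncomputable def step (N : LineNetwork) (oracle : Oracle) (ω : Coins)
    (batch : List (Request N.n × ℕ)) (S : State N.n) : State N.n :=
  let S' := batch.foldl (handleRequest N oracle ω batch) S
  { S' with packets := movePackets N ω S'.packets }

/-- The state after the time steps `0, …, T - 1`. -/
noncomputable def run (N : LineNetwork) (oracle : Oracle) (ω : Coins) (σ : List (Request N.n)) :
    ℕ → State N.n
  | 0 => State.init N.n
  | T + 1 => step N oracle ω (arrivals σ T) (run N oracle ω σ T)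

/-- The operation of the network under the algorithm: the moves of packet `i` before time `T`. -/
noncomputable def alg (N : LineNetwork) (oracle : Oracle) (ω : Coins) (σ : List (Request N.n))
    (T i : ℕ) : Option (List Move) :=
  ((run N oracle ω σ T).packets.find? fun p => p.id = i).map Packet.moves

end PacketRouting

open PacketRouting

/-! Legality in the class `Far⁺` is a counting argument in a single quadrant. The side edges along a
straight line through a quadrant have total capacity at least `c^S / 2` (`cS_le_half`), whereas the
admission tests keep every sketch edge below load `c^S / 4` and let at most `c^S / 4` packets start
in a SW-quadrant. A packet that has crossed its quadrant without managing to turn was refused at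
every vertex of such a line, so all the side edges were full. The packets on them are distinct,
since moving sideways takes a packet off the line for good. Each of them is charged to one of only
two budgets: a sketch edge into the tile together with either the packets that start in the tile or
a sketch edge out of it. Hence there are fewer than `c^S / 2` of them, a contradiction
(`not_exit_straight`). So every packet turns in time, leaves each tile as its sketch path
prescribes, and arrives (`routingInvariant`, `far_delivered`). No packet has to be dropped: packets
that go straight always get a place, and a packet that is refused its turn goes straight past a full
edge, so that enough room is left for it (`card_moves_le`). In the SW-quadrants the planes separate
the packets. Near packets only move north, and greedy admission bounds the load of every link.

The throughput for near requests is compared segment by segment, a segment being the part of a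
column that lies in one row of tiles. A rejected near request has a saturated link in its segment,
hence `c` packets are delivered there, while the optimum routes at most `Q (B + c) = O(c log n)`
near requests from that segment (`near_competitive`).

For `Far⁺`, online path packing with exponential weights is compared with the optimum by a
primal-dual argument. An accepted path increases the total weight by at most `2 / c^S`, and
rejection means that all legal paths have weight at least `1`. To exploit this, the optimal paths
are made comparable with the sketch paths: requests are exchanged for those with the closest
destinations at the same vertex (`exists_exchange`), long waiting is replaced by detours at the
price of doubling the load (`Packs.exists_short`), and the grid paths are coarsened to sketch paths
(`exists_legal_prefix`, `card_sketch_users_le`). The packing therefore accepts at least a ninth of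
what the optimum routes in `Far⁺` (`packing_competitive`).

The set of accepted requests does not depend on the sparsification coins, since the weights are
updated whatever happens later. Conditionally on its own coin being `true`, an accepted request can
fail only if too many others with a sketch edge in common, a competitor for its row or column, or
too many others in its quadrant are kept. With `λ` of order `1 / log n` these events together have
probability less than `2 / 3` (`le_probability_delivered`). Finally, for random phases a request is
near or in `Far⁺` with probability at least `1 / 4`, and averaging over the phases and the fair coin
gives the theorem (`alg_competitive`). -/

namespace PacketRouting

/-! ### Ranks in a finite set -/

section Rank

variable {ι α : Type*} [LinearOrder α] (S : Finset ι) (f : ι → α)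

/-- The number of elements of `S` whose key is smaller than the key of `x`. -/
def keyRank (x : ι) : ℕ := (S.filter fun y => f y < f x).card

variable {S f}

theorem keyRank_lt_keyRank {x y : ι} (hx : x ∈ S) (h : f x < f y) :
    keyRank S f x < keyRank S f y := by
  apply Finset.card_lt_card
  rw [Finset.ssubset_iff_of_subset]
  · exact ⟨x, by simp [hx, h], by simp⟩
  · intro z hz
    simp only [Finset.mem_filter] at hz ⊢
    exact ⟨hz.1, hz.2.trans h⟩

theorem keyRank_injOn (hf : Set.InjOn f S) : Set.InjOn (keyRank S f) S := by
  intro x hx y hy h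
  rcases lt_trichotomy (f x) (f y) with h' | h' | h'
  · exact absurd h (keyRank_lt_keyRank hx h').ne
  · exact hf hx hy h'
  · exact absurd h (keyRank_lt_keyRank hy h').ne'

/-- With distinct keys the ranks that occur form an initial segment: the element with the largest
key below that of `x` has rank exactly one less. This serves both to fill all places of an edge that
refuses a packet and to exchange requests for closer ones. -/
theorem exists_keyRank_eq (hf : Set.InjOn f S) {x : ι} (hx : x ∈ S) {k : ℕ}
    (hk : k ≤ keyRank S f x) : ∃ y ∈ S, keyRank S f y = k ∧ f y ≤ f x := by
  classical
  induction hr : keyRank S f x using Nat.strong_induction_on generalizing x with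
  | _ r ih =>
    rcases hk.eq_or_lt with h | h
    · exact ⟨x, hx, h.symm, le_rfl⟩
    have hne : (S.filter fun y => f y < f x).Nonempty := by
      rw [← Finset.card_pos]; exact lt_of_le_of_lt (Nat.zero_le _) h
    obtain ⟨y, hy, hmax⟩ := Finset.exists_max_image _ f hne
    simp only [Finset.mem_filter] at hy hmax
    have hS : (S.filter fun z => f z < f x) = insert y (S.filter fun z => f z < f y) := by
      ext z
      simp only [Finset.mem_filter, Finset.mem_insert]
      constructor
      · rintro ⟨hz, hzx⟩
        rcases (hmax z ⟨hz, hzx⟩).eq_or_lt with h' | h'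
        · exact Or.inl (hf hz hy.1 h')
        · exact Or.inr ⟨hz, h'⟩
      · rintro (rfl | ⟨hz, hzy⟩)
        · exact hy
        · exact ⟨hz, hzy.trans hy.2⟩
    have hcard : keyRank S f x = keyRank S f y + 1 := by
      unfold keyRank
      rw [hS, Finset.card_insert_of_notMem (by simp)]
    obtain ⟨z, hz, hzk, hzy⟩ := ih (keyRank S f y) (by omega) hy.1 (by omega) rfl
    exact ⟨z, hz, hzk, hzy.trans hy.2.le⟩

theorem card_filter_keyRank_lt_le (hf : Set.InjOn f S) (m : ℕ) :
    (S.filter fun x => keyRank S f x < m).card ≤ m := by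
  calc _ ≤ (Finset.range m).card :=
        Finset.card_le_card_of_injOn (keyRank S f) (by intro x; simp)
          ((keyRank_injOn hf).mono (by intro x; simp +contextual))
    _ = m := Finset.card_range m

theorem le_card_filter_keyRank_lt (hf : Set.InjOn f S) {m : ℕ} {x : ι} (hx : x ∈ S)
    (hm : m ≤ keyRank S f x) : m ≤ (S.filter fun x => keyRank S f x < m).card := by
  have h : Finset.range m ⊆ (S.filter fun x => keyRank S f x < m).image (keyRank S f) := by
    intro k hk
    rw [Finset.mem_range] at hk
    obtain ⟨y, hy, hyk, -⟩ := exists_keyRank_eq hf hx (hk.le.trans hm)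
    exact Finset.mem_image.2 ⟨y, by simp [hy, hyk, hk], hyk⟩
  calc m = (Finset.range m).card := (Finset.card_range m).symm
    _ ≤ _ := (Finset.card_le_card h).trans Finset.card_image_le

end Rank

/-! ### The conflict resolution at a single vertex -/

section Vertex

variable {ι : Type*} (V : Finset ι) (g h : ι → Move) (key : ι → ℕ) (cap : Move → ℕ)

/-- The priority of a packet with goal direction `g x`, heading `h x` and index `key x`: packets that
go straight first, then by index. -/
def priority (x : ι) : ℕ ×ₗ ℕ := toLex (if g x = h x then 0 else 1, key x)

theorem priority_lt_iff {x y : ι} : priority g h key y < priority g h key x ↔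
    (g y = h y ∧ g x ≠ h x) ∨ ((g y = h y ↔ g x = h x) ∧ key y < key x) := by
  unfold priority
  rw [Prod.Lex.toLex_lt_toLex]
  by_cases h1 : g y = h y <;> by_cases h2 : g x = h x <;> simp [h1, h2]

/-- The packet `x` gets a place on the edge in its goal direction. -/
def Granted (x : ι) : Prop :=
  keyRank (V.filter fun y => g y = g x) (priority g h key) x < cap (g x)

variable {V g h key cap}

theorem priority_injOn (hkey : Set.InjOn key V) : Set.InjOn (priority g h key) V := by
  intro x hx y hy hxy
  have := congrArg (fun z => (ofLex z).2) hxy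
  exact hkey hx hy this

/-- Only packets that go straight in the same direction can precede a packet that goes straight, and
together with it they number at most the capacity. -/
theorem granted_of_straight (hcap : ∀ m, (V.filter fun x => h x = m).card ≤ cap m) {x : ι}
    (hx : x ∈ V) (hgx : g x = h x) : Granted V g h key cap x := by
  refine lt_of_lt_of_le ?_ (hcap (g x))
  apply Finset.card_lt_card
  rw [Finset.ssubset_iff_of_subset]
  · exact ⟨x, by simp [hx, hgx], by simp⟩
  · intro y hy
    simp only [Finset.mem_filter, priority_lt_iff] at hy ⊢
    refine ⟨hy.1.1, ?_⟩
    rcases hy.2 with h1 | h1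
    · exact absurd hgx h1.2
    · rw [← h1.1.2 hgx, hy.1.2]

open Classical in
theorem card_granted_le (hkey : Set.InjOn key V) (m : Move) :
    (V.filter fun x => g x = m ∧ Granted V g h key cap x).card ≤ cap m := by
  refine le_trans (Finset.card_le_card ?_) (card_filter_keyRank_lt_le
    (S := V.filter fun y => g y = m) (f := priority g h key)
    ((priority_injOn hkey).mono (by intro x; simp +contextual)) (cap m))
  intro x hx
  rw [Finset.mem_filter] at hx ⊢
  obtain ⟨h1, rfl, h2⟩ := hx
  exact ⟨by simp [h1], h2⟩

open Classical in
-- A refused packet has rank at least the capacity, so all smaller ranks are taken by packets that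
-- are granted the edge.
theorem cap_le_card_granted (hkey : Set.InjOn key V) {x : ι} (hx : x ∈ V)
    (hgr : ¬ Granted V g h key cap x) :
    cap (g x) ≤ (V.filter fun y => g y = g x ∧ Granted V g h key cap y).card := by
  refine (le_card_filter_keyRank_lt (S := V.filter fun y => g y = g x) (f := priority g h key)
    ((priority_injOn hkey).mono (by intro x; simp +contextual))
    (by simp [hx]) (not_lt.1 hgr)).trans (Finset.card_le_card ?_)
  intro y hy
  rw [Finset.mem_filter, Finset.mem_filter] at hy
  rw [Finset.mem_filter]
  obtain ⟨⟨h1, h2⟩, h3⟩ := hy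
  refine ⟨h1, h2, ?_⟩
  unfold Granted
  rw [h2]; exact h3

/-- The other direction. -/
def Move.other : Move → Move
  | .forward => .hold
  | .hold => .forward

theorem Move.eq_other_iff {a b : Move} : a = b.other ↔ a ≠ b := by
  cases a <;> cases b <;> simp [Move.other]

open Classical in
/-- If every incoming direction brings at most as many packets as the corresponding outgoing edge
may carry, then the conflict resolution respects the capacities of the outgoing edges. -/
theorem card_moves_le (hkey : Set.InjOn key V)
    (hcap : ∀ m, (V.filter fun x => h x = m).card ≤ cap m) (m : Move) :
    (V.filter fun x => (if Granted V g h key cap x then g x else h x) = m).card ≤ cap m := by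
  -- If some refused packet goes straight in direction `m`, then the other edge is full. At most
  -- `cap m + cap m.other` packets are present, so at most `cap m` remain for `m`. If there is no
  -- such packet, all users of `m` were granted it.
  by_cases hex : ∃ x ∈ V, ¬ Granted V g h key cap x ∧ h x = m
  · obtain ⟨x, hx, hgr, rfl⟩ := hex
    have hne : g x = (h x).other := by
      rw [Move.eq_other_iff]; intro h'; exact hgr (granted_of_straight hcap hx h')
    have h1 := cap_le_card_granted hkey hx hgr
    have h2 : (V.filter fun y => g y = g x ∧ Granted V g h key cap y).card ≤
        (V.filter fun y => ¬ (if Granted V g h key cap y then g y else h y) = h x).card := by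
      apply Finset.card_le_card
      intro y hy
      simp only [Finset.mem_filter] at hy ⊢
      refine ⟨hy.1, ?_⟩
      rw [if_pos hy.2.2, hy.2.1, hne, ← ne_eq, ← Move.eq_other_iff]
    have h3 := V.card_filter_add_card_filter_not
      (fun y => (if Granted V g h key cap y then g y else h y) = h x)
    have h4 := V.card_filter_add_card_filter_not (fun y => h y = h x)
    have h5 : (V.filter fun y => ¬ h y = h x).card ≤ cap (g x) := by
      refine le_trans (Finset.card_le_card ?_) (hcap (g x))
      intro y hy
      simp only [Finset.mem_filter] at hy ⊢
      exact ⟨hy.1, by rw [hne, Move.eq_other_iff]; exact hy.2⟩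
    have := hcap (h x)
    omega
  · push Not at hex
    refine le_trans (Finset.card_le_card ?_) (card_granted_le (g := g) (h := h) (cap := cap) hkey m)
    intro x hx
    simp only [Finset.mem_filter] at hx ⊢
    by_cases hgr : Granted V g h key cap x
    · rw [if_pos hgr] at hx; exact ⟨hx.1, hx.2, hgr⟩
    · rw [if_neg hgr] at hx; exact absurd hx.2 (hex x hx.1 hgr)

end Vertex

/-! ### The parameters of the algorithm -/

/-- The standing assumptions on the network. -/
structure LineNetwork.Valid (N : LineNetwork) : Prop where
  n_gt : 16 < N.n
  B_pos : 1 ≤ N.B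
  B_le : (N.B : ℝ) ≤ Real.logb 2 N.n
  c_pos : 1 ≤ N.c
  c_le : (N.c : ℝ) ≤ Real.logb 2 N.n

namespace LineNetwork

variable {N : LineNetwork}

/-- The logarithm of the number of nodes. -/
noncomputable abbrev log (N : LineNetwork) : ℝ := Real.logb 2 N.n

/-- The length of a quadrant. -/
noncomputable def halfTau (N : LineNetwork) : ℕ := N.tau / 2

/-- The height of a quadrant. -/
noncomputable def halfQ (N : LineNetwork) : ℕ := N.Q / 2

theorem tau_eq (N : LineNetwork) : N.tau = 2 * N.halfTau := by
  unfold halfTau tau; split_ifs <;> omega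

theorem Q_eq (N : LineNetwork) : N.Q = 2 * N.halfQ := by
  unfold halfQ Q; split_ifs <;> omega

theorem Valid.four_lt_log (hN : N.Valid) : 4 < N.log := by
  rw [log, Real.lt_logb_iff_rpow_lt (by norm_num) (by have := hN.n_gt; positivity)]
  norm_num; exact hN.n_gt

theorem Valid.rpow_log (hN : N.Valid) : (2 : ℝ) ^ N.log = N.n :=
  Real.rpow_logb (by norm_num) (by norm_num) (by have := hN.n_gt; positivity)

theorem ceil_bounds {x : ℝ} (hx : 1 ≤ x) : x ≤ (⌈x⌉₊ : ℝ) ∧ (⌈x⌉₊ : ℝ) ≤ 2 * x := by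
  refine ⟨Nat.le_ceil x, ?_⟩
  have := (Nat.ceil_lt_add_one (by linarith : (0 : ℝ) ≤ x)).le
  linarith

/-- The two cases of the definition of the tile size. -/
theorem Valid.cases (hN : N.Valid) :
    ((N.log ≤ N.halfTau * N.c ∧ N.halfTau * N.c ≤ 2 * N.log) ∧
      (N.log ≤ N.halfQ * N.B ∧ N.halfQ * N.B ≤ 2 * N.log)) ∨
    (N.log ≤ (N.B : ℝ) * N.c ∧ N.halfTau = N.B ∧ N.halfQ = N.c) := by
  have hB := hN.B_le
  have hc := hN.c_le
  have hB0 : (1 : ℝ) ≤ N.B := by exact_mod_cast hN.B_pos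
  have hc0 : (1 : ℝ) ≤ N.c := by exact_mod_cast hN.c_pos
  unfold halfTau halfQ tau Q
  split_ifs with h
  · left
    simp only [Nat.mul_div_cancel_left _ (show 0 < 2 by norm_num)]
    have h1 : 1 ≤ Real.logb 2 N.n / N.c := by rw [le_div_iff₀ (by linarith)]; linarith
    have h2 : 1 ≤ Real.logb 2 N.n / N.B := by rw [le_div_iff₀ (by linarith)]; linarith
    obtain ⟨h3, h4⟩ := ceil_bounds h1
    obtain ⟨h5, h6⟩ := ceil_bounds h2
    rw [div_le_iff₀ (by linarith)] at h3 h5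
    rw [← mul_div_assoc, le_div_iff₀ (by linarith)] at h4 h6
    exact ⟨⟨h3, h4⟩, ⟨h5, h6⟩⟩
  · right
    simp only [Nat.mul_div_cancel_left _ (show 0 < 2 by norm_num)]
    push_cast at h
    exact ⟨not_lt.1 h, trivial, trivial⟩

theorem Valid.halfTau_pos (hN : N.Valid) : 0 < N.halfTau := by
  have hB := hN.B_pos
  have h4 := hN.four_lt_log
  rcases hN.cases with h | h
  · by_contra h0
    have : N.halfTau = 0 := by omega
    have h1 := h.1.1
    rw [this] at h1; simp at h1; linarith
  · omega

theorem Valid.halfQ_pos (hN : N.Valid) : 0 < N.halfQ := by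
  have hB := hN.c_pos
  have h4 := hN.four_lt_log
  rcases hN.cases with h | h
  · by_contra h0
    have : N.halfQ = 0 := by omega
    have h1 := h.2.1
    rw [this] at h1; simp at h1; linarith
  · omega

theorem Valid.tau_pos (hN : N.Valid) : 0 < N.tau := by
  have := hN.halfTau_pos; rw [tau_eq]; omega

theorem Valid.Q_pos (hN : N.Valid) : 0 < N.Q := by
  have := hN.halfQ_pos; rw [Q_eq]; omega

theorem cS_le_tau (N : LineNetwork) : N.cS ≤ 2 * (N.halfTau * N.c) := by
  rw [← mul_assoc, ← tau_eq]; exact min_le_left _ _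

theorem cS_le_Q (N : LineNetwork) : N.cS ≤ 2 * (N.halfQ * N.B) := by
  rw [← mul_assoc, ← Q_eq]; exact min_le_right _ _

theorem cS_eq (N : LineNetwork) : N.cS = 2 * min (N.halfTau * N.c) (N.halfQ * N.B) := by
  rw [cS, tau_eq, Q_eq, mul_assoc, mul_assoc]; omega

theorem Valid.two_log_le_cS (hN : N.Valid) : 2 * N.log ≤ N.cS := by
  rw [cS_eq]
  push_cast
  have : N.log ≤ min ((N.halfTau : ℝ) * N.c) (N.halfQ * N.B) := by
    rcases hN.cases with h | ⟨h, h1, h2⟩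
    · exact le_min h.1.1 h.2.1
    · rw [h1, h2]; exact le_min h (by linarith)
  linarith

theorem Valid.nine_le_cS (hN : N.Valid) : 9 ≤ N.cS := by
  have h1 := hN.two_log_le_cS
  have h2 := hN.four_lt_log
  have : (8 : ℝ) < N.cS := by linarith
  exact_mod_cast this

/-- Reducing both sketch capacities to the smaller one costs at most a factor of two, because the
rounding in the tile size at most doubles. -/
theorem Valid.max_le_cS (hN : N.Valid) : N.tau * N.c ≤ 2 * N.cS ∧ N.Q * N.B ≤ 2 * N.cS := by
  have key : (N.halfTau * N.c : ℕ) ≤ N.cS ∧ (N.halfQ * N.B : ℕ) ≤ N.cS := by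
    rcases hN.cases with h | ⟨h, h1, h2⟩
    · have h3 := hN.two_log_le_cS
      constructor
      · have : ((N.halfTau * N.c : ℕ) : ℝ) ≤ N.cS := by push_cast; linarith [h.1.2]
        exact_mod_cast this
      · have : ((N.halfQ * N.B : ℕ) : ℝ) ≤ N.cS := by push_cast; linarith [h.2.2]
        exact_mod_cast this
    · rw [cS_eq, h1, h2, Nat.mul_comm N.c N.B, min_self]; omega
  rw [tau_eq, Q_eq, mul_assoc, mul_assoc]; omega

theorem Valid.halfTau_le (hN : N.Valid) : (N.halfTau : ℝ) ≤ 2 * N.log := by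
  have hc0 : (1 : ℝ) ≤ N.c := by exact_mod_cast hN.c_pos
  have h4 := hN.four_lt_log
  rcases hN.cases with h | ⟨h, h1, h2⟩
  · have := h.1.2
    nlinarith [Nat.cast_nonneg (α := ℝ) N.halfTau]
  · rw [h1]; linarith [hN.B_le]

theorem Valid.halfQ_le (hN : N.Valid) : (N.halfQ : ℝ) ≤ 2 * N.log := by
  have hc0 : (1 : ℝ) ≤ N.B := by exact_mod_cast hN.B_pos
  have h4 := hN.four_lt_log
  rcases hN.cases with h | ⟨h, h1, h2⟩
  · have := h.2.2
    nlinarith [Nat.cast_nonneg (α := ℝ) N.halfQ]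
  · rw [h2]; linarith [hN.c_le]

/-- The left side bounds what the optimum can route from the `Q` vertices of one column of a tile,
at most `B + c` from each. A saturated link in that column guarantees `c` deliveries. -/
theorem Valid.segment_le (hN : N.Valid) : (N.Q : ℝ) * (N.B + N.c) ≤ 8 * N.log * N.c := by
  have hc0 : (1 : ℝ) ≤ N.c := by exact_mod_cast hN.c_pos
  have hB0 : (1 : ℝ) ≤ N.B := by exact_mod_cast hN.B_pos
  have h4 := hN.four_lt_log
  rw [Q_eq]; push_cast
  rcases hN.cases with h | ⟨h, h1, h2⟩
  · have h1 := h.2.2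
    have h2 := hN.halfQ_le
    nlinarith [mul_le_mul_of_nonneg_right h2 (by linarith : (0 : ℝ) ≤ N.c)]
  · rw [h2]
    nlinarith [hN.c_le, hN.B_le]

/-- The left side counts the places for considered requests in one SW-quadrant: its vertices times
the planes. -/
theorem Valid.quadrant_le (hN : N.Valid) :
    (N.halfQ : ℝ) * N.halfTau * (N.B + N.c) ≤ 4 * N.log * N.cS := by
  have hc0 : (1 : ℝ) ≤ N.c := by exact_mod_cast hN.c_pos
  have hB0 : (1 : ℝ) ≤ N.B := by exact_mod_cast hN.B_pos
  have h4 := hN.four_lt_log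
  have h5 := hN.two_log_le_cS
  rcases hN.cases with h | ⟨h, h1, h2⟩
  · have a1 : (N.halfQ : ℝ) * N.B * N.halfTau ≤ (2 * N.log) * (2 * N.log) :=
      mul_le_mul h.2.2 hN.halfTau_le (by positivity) (by linarith)
    have a2 : (N.halfTau : ℝ) * N.c * N.halfQ ≤ (2 * N.log) * (2 * N.log) :=
      mul_le_mul h.1.2 hN.halfQ_le (by positivity) (by linarith)
    nlinarith
  · have : (N.cS : ℝ) = 2 * (N.B * N.c) := by
      rw [cS_eq, h1, h2, Nat.mul_comm N.c N.B, min_self]; push_cast; ring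
    rw [this, h1, h2]
    have h6 : (0 : ℝ) ≤ N.B * N.c := by positivity
    nlinarith [hN.c_le, hN.B_le]

/-- The length (in columns) of the windows in which the optimal routing is followed. -/
def window (N : LineNetwork) : ℕ := N.n * N.B / N.c + 1

/-- A path that waits for at most two windows advances by at most `n + 1` columns of tiles, which
keeps its sketch path within `p_max = 4n` edges. -/
theorem Valid.window_le (hN : N.Valid) : 2 * N.window ≤ N.tau * (N.n + 1) := by
  have hc0 : (1 : ℝ) ≤ N.c := by exact_mod_cast hN.c_pos
  have hτ := hN.halfTau_pos
  have key : N.n * N.B / N.c ≤ N.halfTau * N.n := by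
    apply Nat.div_le_of_le_mul
    rcases hN.cases with h | ⟨h, h1, h2⟩
    · have : (N.B : ℝ) ≤ N.halfTau * N.c := hN.B_le.trans h.1.1
      have : N.B ≤ N.halfTau * N.c := by exact_mod_cast this
      calc N.n * N.B ≤ N.n * (N.halfTau * N.c) := Nat.mul_le_mul_left _ this
        _ = _ := by ring
    · rw [h1]
      calc N.n * N.B = 1 * (N.B * N.n) := by ring
        _ ≤ _ := Nat.mul_le_mul_right _ hN.c_pos
  unfold window
  rw [tau_eq]
  nlinarith

theorem Valid.log_le_k (hN : N.Valid) : N.log ≤ N.k := by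
  refine le_trans ?_ (Nat.le_ceil _)
  have : (0 : ℝ) < N.n := by have := hN.n_gt; positivity
  apply Real.logb_le_logb_of_le (by norm_num) this
  unfold pmax; push_cast; linarith

theorem Valid.k_le (hN : N.Valid) : (N.k : ℝ) ≤ 3 * N.log := by
  have h4 := hN.four_lt_log
  have hn : (16 : ℝ) < N.n := by exact_mod_cast hN.n_gt
  have h0 : 0 ≤ Real.logb 2 (1 + 3 * N.pmax) :=
    Real.logb_nonneg (by norm_num) (by have : (0 : ℝ) ≤ N.pmax := by positivity
                                       linarith)
  have h1 := (Nat.ceil_lt_add_one h0).le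
  have h2 : Real.logb 2 (1 + 3 * N.pmax) ≤ Real.logb 2 (16 * N.n) := by
    apply Real.logb_le_logb_of_le (by norm_num) (by positivity)
    unfold pmax; push_cast; linarith
  have h3 : Real.logb 2 (16 * N.n) = 4 + N.log := by
    rw [Real.logb_mul (by norm_num) (by linarith)]
    congr 1
    rw [show (16 : ℝ) = 2 ^ (4 : ℝ) by norm_num, Real.logb_rpow (by norm_num) (by norm_num)]
  unfold k
  linarith

theorem Valid.k_pos (hN : N.Valid) : (0 : ℝ) < N.k := by
  linarith [hN.log_le_k, hN.four_lt_log]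

theorem Valid.lam_pos (hN : N.Valid) : 0 < N.lam := by
  have := hN.k_pos; unfold lam; positivity

theorem Valid.lam_le_one (hN : N.Valid) : N.lam ≤ 1 := by
  have h1 := hN.log_le_k
  have h2 := hN.four_lt_log
  unfold lam
  rw [div_le_one (by linarith)]; linarith

end LineNetwork

/-! ### The structure of a run -/

theorem foldl_prefix_induction {α β : Type*} (P : List α → β → Prop) (f : β → α → β) (b : β)
    (l : List α) (h0 : P [] b)
    (hs : ∀ pre q post b', l = pre ++ q :: post → P pre b' → P (pre ++ [q]) (f b' q)) :
    P l (l.foldl f b) := by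
  suffices h : ∀ pre post, l = pre ++ post → P pre (pre.foldl f b) from h l [] (by simp)
  intro pre
  induction pre using List.reverseRecOn with
  | nil => intro _ _; exact h0
  | append_singleton pre q ih =>
    intro post hl
    rw [List.foldl_append]
    exact hs pre q post _ (by simpa using hl) (ih (q :: post) (by simpa using hl))

section Arrivals

variable {n : ℕ} (σ : List (Request n))

theorem mem_arrivals {t : ℕ} {q : Request n × ℕ} :
    q ∈ arrivals σ t ↔ σ[q.2]? = some q.1 ∧ q.1.time = t := by
  unfold arrivals
  rw [List.mem_filter, List.mem_zipIdx_iff_getElem?]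
  simp

theorem pairwise_arrivals (t : ℕ) : (arrivals σ t).Pairwise fun a b => a.2 < b.2 := by
  unfold arrivals
  refine List.Pairwise.sublist List.filter_sublist ?_
  rw [← List.pairwise_map (f := Prod.snd) (R := fun a b : ℕ => a < b), List.zipIdx_map_snd]
  exact List.pairwise_lt_range'

theorem nodup_arrivals (t : ℕ) : (arrivals σ t).Nodup :=
  (pairwise_arrivals σ t).imp fun h h' => by rw [h'] at h; exact lt_irrefl _ h

/-- Both lists are sorted by index, so they are determined by their members. -/
theorem arrivals_congr {σ σ' : List (Request n)} {T t : ℕ} (ht : t < T)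
    (h : ∀ (i : ℕ) (q : Request n), q.time < T → (σ[i]? = some q ↔ σ'[i]? = some q)) :
    arrivals σ t = arrivals σ' t := by
  have hp : (arrivals σ t).Perm (arrivals σ' t) := by
    rw [List.perm_ext_iff_of_nodup (nodup_arrivals σ t) (nodup_arrivals σ' t)]
    rintro ⟨q, i⟩
    rw [mem_arrivals, mem_arrivals]
    constructor
    · rintro ⟨h1, rfl⟩; exact ⟨(h i q ht).1 h1, rfl⟩
    · rintro ⟨h1, rfl⟩; exact ⟨(h i q ht).2 h1, rfl⟩
  refine hp.eq_of_pairwise ?_ (pairwise_arrivals σ t) (pairwise_arrivals σ' t)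
  intro a b _ _ h1 h2
  exact absurd (h1.trans h2) (lt_irrefl _)

/-- The requests that are input before time `T`, in the order in which they are handled. -/
def handled (T : ℕ) : List (Request n × ℕ) := (List.range T).flatMap (arrivals σ)

theorem handled_succ (T : ℕ) : handled σ (T + 1) = handled σ T ++ arrivals σ T := by
  unfold handled
  rw [List.range_succ, List.flatMap_append]
  simp

theorem mem_handled {T : ℕ} {q : Request n × ℕ} :
    q ∈ handled σ T ↔ σ[q.2]? = some q.1 ∧ q.1.time < T := by
  unfold handled
  simp only [List.mem_flatMap, List.mem_range, mem_arrivals]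
  constructor
  · rintro ⟨t, ht, h1, rfl⟩; exact ⟨h1, ht⟩
  · rintro ⟨h1, h2⟩; exact ⟨_, h2, h1, rfl⟩

theorem nodup_handled (T : ℕ) : (handled σ T).Nodup := by
  induction T with
  | zero => exact List.nodup_nil
  | succ T ih =>
    rw [handled_succ]
    refine ih.append (nodup_arrivals σ T) ?_
    intro q h1 h2
    rw [mem_handled] at h1
    rw [mem_arrivals] at h2
    omega

end Arrivals

/-! ### Packets in a run: identity, clock and history -/

section Run

variable (N : LineNetwork) (lightest : Oracle) (ω : Coins) (σ : List (Request N.n))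

/-- The state in time step `T` after the admission of requests, before the packets move. -/
noncomputable def mid (T : ℕ) : State N.n :=
  (arrivals σ T).foldl (handleRequest N lightest ω (arrivals σ T)) (run N lightest ω σ T)

theorem run_succ (T : ℕ) : run N lightest ω σ (T + 1) =
    { mid N lightest ω σ T with packets := movePackets N ω (mid N lightest ω σ T).packets } := rfl

/-- The behaviour before time `T` depends only on the requests that are input before time `T`. -/
theorem run_congr {σ σ' : List (Request N.n)} {T : ℕ}
    (h : ∀ (i : ℕ) (q : Request N.n), q.time < T → (σ[i]? = some q ↔ σ'[i]? = some q)) :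
    ∀ T' ≤ T, run N lightest ω σ T' = run N lightest ω σ' T' := by
  intro T'
  induction T' with
  | zero => intro _; rfl
  | succ T' ih =>
    intro hT
    rw [run, run, ih (by omega), arrivals_congr (by omega : T' < T) h]

variable {N lightest ω σ}

/-- An induction principle for the states of a run: `pre` lists the requests handled so far. -/
theorem mid_induction (P : List (Request N.n × ℕ) → State N.n → Prop) (init : P [] (State.init N.n))
    (handle : ∀ T pre q S, (∃ post, handled σ (T + 1) = pre ++ q :: post) → q ∈ arrivals σ T →
      P pre S → P (pre ++ [q]) (handleRequest N lightest ω (arrivals σ T) S q))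
    (move : ∀ pre S, P pre S → P pre { S with packets := movePackets N ω S.packets }) (T : ℕ) :
    P (handled σ T) (run N lightest ω σ T) ∧ P (handled σ (T + 1)) (mid N lightest ω σ T) := by
  have hmid : ∀ T, P (handled σ T) (run N lightest ω σ T) →
      P (handled σ (T + 1)) (mid N lightest ω σ T) := by
    intro T h
    rw [handled_succ]
    refine foldl_prefix_induction (fun pre S => P (handled σ T ++ pre) S) _ _ _
      (by simpa using h) ?_
    intro pre q post S hl hS
    rw [← List.append_assoc]
    refine handle T _ q S ⟨post, ?_⟩ (by rw [hl]; simp) hS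
    rw [handled_succ, hl]; simp
  induction T with
  | zero => exact ⟨init, hmid 0 init⟩
  | succ T ih =>
    have : P (handled σ (T + 1)) (run N lightest ω σ (T + 1)) := by
      rw [run_succ]; exact move _ _ ih.2
    exact ⟨this, hmid _ this⟩

/-- The immutable part of a packet. -/
def Packet.static {n : ℕ} (p : Packet n) : Packet n := { p with moves := [] }

theorem handleRequest_packets (batch : List (Request N.n × ℕ)) (S : State N.n)
    (q : Request N.n × ℕ) :
    (handleRequest N lightest ω batch S q).packets = S.packets ∨
      ∃ p : Packet N.n, p.id = q.2 ∧ p.req = q.1 ∧ p.moves = [] ∧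
        (handleRequest N lightest ω batch S q).packets = S.packets ++ [p] := by
  unfold handleRequest
  split
  · unfold handleFar
    dsimp only
    split_ifs
    · exact Or.inl rfl
    · exact Or.inl rfl
    · exact Or.inl rfl
    · exact Or.inl rfl
    · exact Or.inl rfl
    · exact Or.inr ⟨_, rfl, rfl, rfl, rfl⟩
  · unfold handleNear
    split_ifs
    · exact Or.inr ⟨_, rfl, rfl, rfl, rfl⟩
    · exact Or.inl rfl

/-- The effect of a time step on a packet. -/
noncomputable def advance (N : LineNetwork) (ω : Coins) (ps : List (Packet N.n)) (p : Packet N.n) :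
    Packet N.n :=
  open Classical in
  if p.Arrived then p else { p with moves := p.moves ++ [decideMove N ω ps p] }

theorem movePackets_eq (ps : List (Packet N.n)) :
    movePackets N ω ps = ps.map (advance N ω ps) := rfl

theorem advance_static (ps : List (Packet N.n)) (p : Packet N.n) :
    (advance N ω ps p).static = p.static := by
  unfold advance; split_ifs <;> rfl

theorem static_id {n : ℕ} {p p' : Packet n} (h : p.static = p'.static) : p.id = p'.id :=
  (congrArg Packet.id h : p.static.id = p'.static.id)

theorem static_req {n : ℕ} {p p' : Packet n} (h : p.static = p'.static) : p.req = p'.req :=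
  (congrArg Packet.req h : p.static.req = p'.static.req)

theorem static_sketch {n : ℕ} {p p' : Packet n} (h : p.static = p'.static) : p.sketch = p'.sketch :=
  (congrArg Packet.sketch h : p.static.sketch = p'.static.sketch)

theorem static_plane {n : ℕ} {p p' : Packet n} (h : p.static = p'.static) : p.plane = p'.plane :=
  (congrArg Packet.plane h : p.static.plane = p'.static.plane)

theorem static_start {n : ℕ} {p p' : Packet n} (h : p.static = p'.static) : p.start = p'.start :=
  (congrArg Packet.start h : p.static.start = p'.static.start)

theorem advance_of_arrived {ps : List (Packet N.n)} {p : Packet N.n} (h : p.Arrived) :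
    advance N ω ps p = p := by
  unfold advance; rw [if_pos h]

theorem advance_of_not_arrived {ps : List (Packet N.n)} {p : Packet N.n} (h : ¬ p.Arrived) :
    advance N ω ps p = { p with moves := p.moves ++ [decideMove N ω ps p] } := by
  unfold advance; rw [if_neg h]

theorem map_static_movePackets (ps : List (Packet N.n)) :
    (movePackets N ω ps).map Packet.static = ps.map Packet.static := by
  rw [movePackets_eq, List.map_map]
  apply List.map_congr_left
  intro p _
  exact advance_static ps p

/-- The packets that are in the list in a run stem from different handled requests. -/
structure FromRequests {n : ℕ} (pre : List (Request n × ℕ)) (ps : List (Packet n)) : Prop where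
  mem : ∀ p ∈ ps, (p.req, p.id) ∈ pre
  nodup : (ps.map Packet.id).Nodup

theorem fromRequests (T : ℕ) :
    FromRequests (handled σ T) (run N lightest ω σ T).packets ∧
      FromRequests (handled σ (T + 1)) (mid N lightest ω σ T).packets := by
  refine mid_induction (fun pre S => FromRequests pre S.packets) ?_ ?_ ?_ T
  · exact ⟨by simp [State.init], by simp [State.init]⟩
  · rintro T pre q S ⟨post, hpost⟩ hq hS
    rcases handleRequest_packets (lightest := lightest) (ω := ω) (arrivals σ T) S q with
      h | ⟨p, hid, hreq, -, h⟩
    · rw [h]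
      exact ⟨fun p hp => List.mem_append_left _ (hS.mem p hp), hS.nodup⟩
    · rw [h]
      constructor
      · intro p' hp'
        rcases List.mem_append.1 hp' with hp' | hp'
        · exact List.mem_append_left _ (hS.mem p' hp')
        · rw [List.mem_singleton.1 hp', hid, hreq]; simp
      · rw [List.map_append, List.map_singleton, List.nodup_append]
        refine ⟨hS.nodup, by simp, ?_⟩
        intro a ha b hb hab
        rw [List.mem_singleton] at hb
        obtain ⟨p', hp', rfl⟩ := List.mem_map.1 ha
        have h1 := hS.mem p' hp'
        have h2 : (p'.req, p'.id) ∈ handled σ (T + 1) := by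
          rw [hpost]; exact List.mem_append_left _ h1
        rw [mem_handled] at h2
        rw [mem_arrivals] at hq
        -- An old packet with the same index would stem from the same request, which is handled only
        -- once.
        have h3 : (p'.req, p'.id) = q := by
          have : p'.id = q.2 := by rw [hab, hb, hid]
          refine Prod.ext ?_ this
          have h4 := h2.1
          simp only [this, hq.1, Option.some.injEq] at h4
          exact h4.symm
        rw [h3] at h1
        have := nodup_handled σ (T + 1)
        rw [hpost, List.nodup_append] at this
        exact this.2.2 q h1 q (by simp) rfl
  · intro pre S hS
    constructor
    · intro p hp
      obtain ⟨p', hp', rfl⟩ := List.mem_map.1 hp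
      have := advance_static (ω := ω) S.packets p'
      have h2 := hS.mem p' hp'
      rw [← static_req this, ← static_id this] at h2
      exact h2
    · have := congrArg (List.map Packet.id) (map_static_movePackets (N := N) (ω := ω) S.packets)
      rw [List.map_map, List.map_map] at this
      change ((movePackets N ω S.packets).map Packet.id).Nodup
      change ((movePackets N ω S.packets).map Packet.id) = S.packets.map Packet.id at this
      rw [this]; exact hS.nodup

theorem mid_packets (T : ℕ) : ∃ new, (mid N lightest ω σ T).packets =
    (run N lightest ω σ T).packets ++ new ∧ ∀ p ∈ new, p.moves = [] ∧ p.req.time = T := by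
  unfold mid
  refine foldl_prefix_induction (fun _ (S : State N.n) => ∃ new, S.packets =
    (run N lightest ω σ T).packets ++ new ∧ ∀ p ∈ new, p.moves = [] ∧ p.req.time = T) _ _ _
    ⟨[], by simp⟩ ?_
  rintro pre q post S hl ⟨new, h1, h2⟩
  have hq : q ∈ arrivals σ T := by rw [hl]; simp
  rw [mem_arrivals] at hq
  rcases handleRequest_packets (lightest := lightest) (ω := ω) (arrivals σ T) S q with
      h | ⟨p, hid, hreq, hm, h⟩
  · exact ⟨new, by rw [h, h1], h2⟩
  · refine ⟨new ++ [p], by rw [h, h1, List.append_assoc], ?_⟩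
    intro p' hp'
    rcases List.mem_append.1 hp' with hp' | hp'
    · exact h2 p' hp'
    · rw [List.mem_singleton.1 hp']; exact ⟨hm, by rw [hreq]; exact hq.2⟩

theorem mem_run_succ {T : ℕ} {p : Packet N.n} : p ∈ (run N lightest ω σ (T + 1)).packets ↔
    ∃ p' ∈ (mid N lightest ω σ T).packets,
      advance N ω (mid N lightest ω σ T).packets p' = p := by
  rw [run_succ]; exact List.mem_map

theorem mem_mid_of_mem_run {T : ℕ} {p : Packet N.n} (h : p ∈ (run N lightest ω σ T).packets) :
    p ∈ (mid N lightest ω σ T).packets := by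
  obtain ⟨new, h1, -⟩ := mid_packets (N := N) (lightest := lightest) (ω := ω) (σ := σ) T
  rw [h1]; exact List.mem_append_left _ h

theorem mem_mid {T : ℕ} {p : Packet N.n} (h : p ∈ (mid N lightest ω σ T).packets) :
    p ∈ (run N lightest ω σ T).packets ∨ p.moves = [] ∧ p.req.time = T := by
  obtain ⟨new, h1, h2⟩ := mid_packets (N := N) (lightest := lightest) (ω := ω) (σ := σ) T
  rw [h1] at h
  exact (List.mem_append.1 h).imp_right (h2 p)

theorem mid_id_inj {T : ℕ} {p p' : Packet N.n} (h : p ∈ (mid N lightest ω σ T).packets)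
    (h' : p' ∈ (mid N lightest ω σ T).packets) (hid : p.id = p'.id) : p = p' :=
  List.inj_on_of_nodup_map (fromRequests T).2.nodup h h' hid

theorem run_id_inj {T : ℕ} {p p' : Packet N.n} (h : p ∈ (run N lightest ω σ T).packets)
    (h' : p' ∈ (run N lightest ω σ T).packets) (hid : p.id = p'.id) : p = p' :=
  mid_id_inj (mem_mid_of_mem_run h) (mem_mid_of_mem_run h') hid

theorem mem_run_time {T : ℕ} {p : Packet N.n} (h : p ∈ (run N lightest ω σ T).packets) :
    σ[p.id]? = some p.req ∧ p.req.time < T :=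
  (mem_handled σ).1 ((fromRequests T).1.mem p h)

theorem mem_mid_time {T : ℕ} {p : Packet N.n} (h : p ∈ (mid N lightest ω σ T).packets) :
    σ[p.id]? = some p.req ∧ p.req.time ≤ T := by
  have := (mem_handled σ).1 ((fromRequests T).2.mem p h)
  exact ⟨this.1, Nat.lt_succ_iff.1 this.2⟩

theorem alg_eq_some {T i : ℕ} {l : List Move} : alg N lightest ω σ T i = some l ↔
    ∃ p ∈ (run N lightest ω σ T).packets, p.id = i ∧ p.moves = l := by
  unfold alg
  rw [Option.map_eq_some_iff]
  constructor
  · rintro ⟨p, h1, h2⟩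
    exact ⟨p, List.mem_of_find?_eq_some h1, by simpa using List.find?_some h1, h2⟩
  · rintro ⟨p, hp, h1, h2⟩
    refine ⟨p, ?_, h2⟩
    cases hf : (run N lightest ω σ T).packets.find? fun p => decide (p.id = i) with
    | none =>
      rw [List.find?_eq_none] at hf
      exact absurd h1 (by simpa using hf p hp)
    | some p' =>
      have h3 := List.find?_some hf
      rw [run_id_inj hp (List.mem_of_find?_eq_some hf) (by
          rw [h1]; exact (by simpa using h3 : p'.id = i).symm)]

theorem alg_eq_none {T i : ℕ} : alg N lightest ω σ T i = none ↔
    ∀ p ∈ (run N lightest ω σ T).packets, p.id ≠ i := by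
  constructor
  · intro h p hp hid
    have := alg_eq_some.2 ⟨p, hp, hid, rfl⟩
    rw [h] at this; cases this
  · intro h
    cases h' : alg N lightest ω σ T i with
    | none => rfl
    | some l =>
      obtain ⟨p, hp, hid, -⟩ := alg_eq_some.1 h'
      exact absurd hid (h p hp)

theorem advances_advance (ps : List (Packet N.n)) (p : Packet N.n) :
    p.req.Advances p.moves (advance N ω ps p).moves := by
  unfold Request.Advances
  by_cases h : p.Arrived
  · rw [advance_of_arrived h]; exact (if_pos h).mpr rfl
  · rw [advance_of_not_arrived h]; exact (if_neg h).mpr ⟨_, rfl⟩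

/-- The clock of a packet that is in the network shows the current time. -/
theorem now_eq {T : ℕ} {p : Packet N.n} (h : p ∈ (mid N lightest ω σ T).packets)
    (ha : ¬ p.Arrived) :
    p.now = T := by
  induction T generalizing p with
  | zero =>
    rcases mem_mid h with h | ⟨h1, h2⟩
    · simp [run, State.init] at h
    · unfold Packet.now; rw [h1, h2]; rfl
  | succ T ih =>
    rcases mem_mid h with h | ⟨h1, h2⟩
    · obtain ⟨p', hp', rfl⟩ := mem_run_succ.1 h
      by_cases ha' : p'.Arrived
      · rw [advance_of_arrived ha'] at ha
        exact absurd ha' ha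
      · rw [advance_of_not_arrived ha']
        have := ih hp' ha'
        unfold Packet.now at this ⊢
        simp; omega
    · unfold Packet.now; rw [h1, h2]; rfl

/-- The packets of a later time step stem from those of the earlier ones. -/
theorem history {T : ℕ} {p : Packet N.n} (hp : p ∈ (run N lightest ω σ T).packets)
    {j : ℕ} {m : Move}
    (hj : p.moves[j]? = some m) :
    ∃ p' ∈ (mid N lightest ω σ (p.req.time + j)).packets, p'.static = p.static ∧
      p'.moves = p.moves.take j ∧ ¬ p'.Arrived ∧
      decideMove N ω (mid N lightest ω σ (p.req.time + j)).packets p' = m := by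
  induction T generalizing p j m with
  | zero => simp [run, State.init] at hp
  | succ T ih =>
    obtain ⟨p', hp', rfl⟩ := mem_run_succ.1 hp
    by_cases ha : p'.Arrived
    · rw [advance_of_arrived ha] at hj ⊢
      rcases mem_mid hp' with h | h
      · exact ih h hj
      · rw [h.1] at hj; simp at hj
    · have hnow := now_eq hp' ha
      rw [advance_of_not_arrived ha] at hj ⊢
      rcases lt_trichotomy j p'.moves.length with hlt | heq | hgt
      · dsimp only at hj
        rw [List.getElem?_append_left hlt] at hj
        rcases mem_mid hp' with h | h
        · obtain ⟨p'', h1, h2, h3, h4⟩ := ih h hj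
          exact ⟨p'', h1, h2, by dsimp only; rw [h3, List.take_append_of_le_length hlt.le], h4⟩
        · rw [h.1] at hlt; simp at hlt
      · subst heq
        simp only [List.getElem?_concat_length, Option.some.injEq] at hj
        have : p'.req.time + p'.moves.length = T := hnow
        dsimp only
        rw [this]
        refine ⟨p', hp', rfl, by simp, ha, hj⟩
      · have : (p'.moves ++ [decideMove N ω (mid N lightest ω σ T).packets p'])[j]? = none := by
          rw [List.getElem?_eq_none]; simp; omega
        rw [this] at hj; cases hj

open Classical in
/-- The packets that leave node `v` in direction `m` in time step `t`. -/
noncomputable def movers (N : LineNetwork) (ω : Coins) (ps : List (Packet N.n)) (v : ℕ) (m : Move) :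
    Finset (Packet N.n) :=
  ps.toFinset.filter fun p => ¬ p.Arrived ∧ p.node = v ∧ decideMove N ω ps p = m

/-- The operation of the network is legal if in no time step too many packets use an edge. -/
theorem isNonpreemptiveExecution
    (hcap : ∀ T v m, (movers N ω (mid N lightest ω σ T).packets v m).card ≤ N.cap m) :
    IsNonpreemptiveExecution N σ (alg N lightest ω σ) where
  absent i T h := by
    rw [alg_eq_none]
    rintro p hp rfl
    have := mem_run_time hp
    have := h _ this.1
    omega
  admission i q hq := by
    cases h : alg N lightest ω σ (q.time + 1) i with
    | none => exact Or.inl rfl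
    | some l =>
      right
      obtain ⟨p, hp, hid, rfl⟩ := alg_eq_some.1 h
      obtain ⟨p', hp', rfl⟩ := mem_run_succ.1 hp
      have hs := advance_static (ω := ω) (mid N lightest ω σ q.time).packets p'
      have hq' : p'.req = q := by
        have := (mem_mid_time hp').1
        rw [← static_id hs, hid, hq] at this
        exact (Option.some.inj this).symm
      have hm : p'.moves = [] := by
        rcases mem_mid hp' with h | h
        · have := (mem_run_time h).2
          rw [hq'] at this; omega
        · exact h.1
      refine ⟨_, rfl, ?_⟩
      have := advances_advance (ω := ω) (mid N lightest ω σ q.time).packets p'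
      rwa [hm, hq'] at this
  rejected i q T hq hT h := by
    rw [alg_eq_none] at h ⊢
    intro p hp hid
    obtain ⟨p', hp', rfl⟩ := mem_run_succ.1 hp
    have hs := advance_static (ω := ω) (mid N lightest ω σ T).packets p'
    rcases mem_mid hp' with h' | h'
    · exact h p' h' (by rw [← hid, static_id hs])
    · have := (mem_mid_time hp').1
      rw [← static_id hs, hid, hq] at this
      have := Option.some.inj this
      rw [← this] at h'
      omega
  injected i q T l hq h := by
    obtain ⟨p, hp, hid, rfl⟩ := alg_eq_some.1 h
    have hs := advance_static (ω := ω) (mid N lightest ω σ T).packets p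
    refine ⟨(advance N ω (mid N lightest ω σ T).packets p).moves, alg_eq_some.2
      ⟨_, mem_run_succ.2 ⟨p, mem_mid_of_mem_run hp, rfl⟩, by rw [static_id hs, hid], rfl⟩, ?_⟩
    have := (mem_run_time hp).1
    rw [hid, hq] at this
    rw [Option.some.inj this]
    exact advances_advance _ p
  capacities T m v t := by
    classical
    refine le_trans ?_ (hcap t v m)
    -- A packet crosses an edge leaving `(v, t)` in time step `t`, whatever the time `T` at which
    -- its moves are inspected. So it suffices to count the movers of that single step.
    have hsub : {i : ℕ | ∃ q l, σ[i]? = some q ∧ alg N lightest ω σ T i = some l ∧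
        q.Crosses l m v t} ⊆
        ((movers N ω (mid N lightest ω σ t).packets v m).image Packet.id : Finset ℕ) := by
      rintro i ⟨q, l, hq, hl, j, hj, hv, ht⟩
      obtain ⟨p, hp, rfl, rfl⟩ := alg_eq_some.1 hl
      have := (mem_run_time hp).1
      rw [hq] at this
      obtain rfl := Option.some.inj this
      obtain ⟨p', h1, h2, h3, h4, h5⟩ := history hp hj
      rw [ht] at h1 h5
      rw [Finset.coe_image]
      refine ⟨p', ?_, static_id h2⟩
      unfold movers
      simp only [Finset.coe_filter, List.mem_toFinset, Set.mem_ofPred_eq]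
      refine ⟨h1, h4, ?_, h5⟩
      unfold Packet.node
      rw [static_req h2, h3, hv]
    refine (Set.ncard_le_ncard hsub (Finset.finite_toSet _)).trans ?_
    rw [Set.ncard_coe_finset]
    exact Finset.card_image_le

/-- A packet of the mid-step state can be followed into the future. -/
theorem exists_later {T T' : ℕ} (hT : T ≤ T') {p : Packet N.n}
    (hp : p ∈ (mid N lightest ω σ T).packets) :
    ∃ p' ∈ (mid N lightest ω σ T').packets, p'.static = p.static ∧ p.moves <+: p'.moves ∧
      (T < T' → (advance N ω (mid N lightest ω σ T).packets p).moves <+: p'.moves) := by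
  induction T', hT using Nat.le_induction with
  | base => exact ⟨p, hp, rfl, List.prefix_rfl, fun h => absurd h (lt_irrefl _)⟩
  | succ T' hT ih =>
    obtain ⟨p', h1, h2, h3, h4⟩ := ih
    refine ⟨advance N ω (mid N lightest ω σ T').packets p', mem_mid_of_mem_run
      (mem_run_succ.2 ⟨p', h1, rfl⟩), (advance_static _ p').trans h2, ?_⟩
    have hpre : ∀ p' : Packet N.n,
        p'.moves <+: (advance N ω (mid N lightest ω σ T').packets p').moves := by
      intro p'
      by_cases ha : p'.Arrived
      · rw [advance_of_arrived ha]
      · rw [advance_of_not_arrived ha]; exact List.prefix_append _ _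
    refine ⟨h3.trans (hpre p'), fun _ => ?_⟩
    rcases hT.eq_or_lt with rfl | h
    · rw [mid_id_inj h1 hp (static_id h2)]
    · exact (h4 h).trans (hpre p')

end Run

/-! ### Sketch paths -/

/-- The tile that a sketch path from `s` with the steps `w` leads to. -/
def walk (s : Tile) (w : List Move) : Tile :=
  (s.1 + (w.count .forward : ℤ), s.2 + (w.count .hold : ℤ))

@[simp]
theorem walk_nil (s : Tile) : walk s [] = s := by simp [walk]

theorem walk_cons (s : Tile) (m : Move) (w : List Move) :
    walk s (m :: w) = walk (nextTile s m) w := by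
  cases m <;> simp [walk, nextTile] <;> ring

theorem walk_append_singleton (s : Tile) (w : List Move) (m : Move) :
    walk s (w ++ [m]) = nextTile (walk s w) m := by
  cases m <;> simp [walk, nextTile] <;> ring

theorem mem_sketchEdges {s : Tile} {w : List Move} {e : SketchEdge} :
    e ∈ sketchEdges s w ↔ ∃ j m, w[j]? = some m ∧ e = (walk s (w.take j), m) := by
  induction w generalizing s with
  | nil => simp [sketchEdges]
  | cons m w ih =>
    rw [sketchEdges, List.mem_cons, ih]
    constructor
    · rintro (rfl | ⟨j, m', h1, rfl⟩)
      · exact ⟨0, m, by simp, by simp⟩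
      · exact ⟨j + 1, m', by simpa using h1, by rw [List.take_succ_cons, walk_cons]⟩
    · rintro ⟨j, m', h1, rfl⟩
      cases j with
      | zero => left; simp at h1; simp [h1]
      | succ j =>
        right
        exact ⟨j, m', by simpa using h1, by rw [List.take_succ_cons, walk_cons]⟩

@[simp]
theorem length_sketchEdges (s : Tile) (w : List Move) : (sketchEdges s w).length = w.length := by
  induction w generalizing s with
  | nil => rfl
  | cons m w ih => simp [sketchEdges, ih]

theorem count_forward_add_count_hold (w : List Move) :
    w.count .forward + w.count .hold = w.length := by
  induction w with
  | nil => rfl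
  | cons m w ih => cases m <;> simp <;> omega

/-- Sketch paths are monotone and never return to a tile. Hence weights along a path may be summed
over a finite set. -/
theorem nodup_sketchEdges (s : Tile) (w : List Move) : (sketchEdges s w).Nodup := by
  induction w generalizing s with
  | nil => exact List.nodup_nil
  | cons m w ih =>
    rw [sketchEdges, List.nodup_cons]
    refine ⟨?_, ih _⟩
    rw [mem_sketchEdges]
    rintro ⟨j, m', -, h⟩
    have h1 := congrArg (fun e : SketchEdge => e.1.1) h
    have h2 := congrArg (fun e : SketchEdge => e.1.2) h
    cases m <;> simp [walk, nextTile] at h1 h2 <;> omega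

theorem pathWeight_eq_sum (x : SketchEdge → ℝ) (s : Tile) (w : List Move) :
    pathWeight x s w = ∑ e ∈ (sketchEdges s w).toFinset, x e := by
  rw [pathWeight, List.sum_toFinset _ (nodup_sketchEdges s w)]

namespace IsLegalSketchPath

variable {N : LineNetwork} {s : Tile} {R : ℤ} {w : List Move}

theorem exists_eq_append (h : IsLegalSketchPath N s R w) : ∃ u, w = u ++ [.forward] := by
  obtain ⟨u, hu⟩ := List.getLast?_eq_some_iff.1 h.2.1
  exact ⟨u, hu⟩

theorem length_pos (h : IsLegalSketchPath N s R w) : 0 < w.length := by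
  obtain ⟨u, rfl⟩ := h.exists_eq_append
  simp

/-- A legal sketch path reaches its last row with its last edge only. -/
theorem row_lt (h : IsLegalSketchPath N s R w) {j : ℕ} (hj : j < w.length) :
    (walk s (w.take j)).1 < R := by
  obtain ⟨u, rfl⟩ := h.exists_eq_append
  have h1 := h.1
  rw [List.length_append, List.length_singleton] at hj
  have h2 := (List.take_sublist j u).count_le .forward
  rw [List.take_append_of_le_length (by omega)]
  simp [walk] at h1 ⊢
  omega

theorem row_eq (h : IsLegalSketchPath N s R w) : (walk s (w.take w.length)).1 = R := by
  rw [List.take_length]; exact h.1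

theorem last_eq (h : IsLegalSketchPath N s R w) : w[w.length - 1]? = some .forward := by
  rw [← List.getLast?_eq_getElem?]; exact h.2.1

end IsLegalSketchPath

/-! ### Guarantees of the admission control for `Far⁺` -/

section FarRequests

variable {N : LineNetwork} {ω : Coins} {lightest : Oracle}

theorem tileRow_mono (N : LineNetwork) (ω : Coins) {v v' : ℤ} (h : v ≤ v') :
    tileRow N ω v ≤ tileRow N ω v' := by
  unfold tileRow
  rcases Nat.eq_zero_or_pos N.Q with h0 | h0
  · simp [h0]
  · exact Int.ediv_le_ediv (by exact_mod_cast h0) (by omega)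

theorem tileRow_sub_le (hN : N.Valid) {v v' : ℤ} (h : v ≤ v') :
    tileRow N ω v' - tileRow N ω v ≤ v' - v := by
  unfold tileRow
  have hQ : (0 : ℤ) < N.Q := by exact_mod_cast hN.Q_pos
  have h1 : (v' - ω.phaseSpace) / N.Q ≤ (v - ω.phaseSpace + N.Q * (v' - v)) / N.Q :=
    Int.ediv_le_ediv hQ (by nlinarith)
  rw [Int.add_mul_ediv_left _ _ hQ.ne'] at h1
  linarith

theorem sourceTile_row_lt {q : Request N.n} (h : ¬ IsNear N ω q) :
    (sourceTile N ω q).1 < tileRow N ω (q.dst : ℕ) := by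
  have h1 : tileRow N ω (q.src : ℕ) ≤ tileRow N ω (q.dst : ℕ) :=
    tileRow_mono N ω (by exact_mod_cast q.src_le_dst)
  exact lt_of_le_of_ne h1 h

/-- The path straight north is legal. The promise of the oracle is conditional on the existence of a
legal path, and this makes it available for every far request. -/
theorem exists_legalSketchPath (hN : N.Valid) {q : Request N.n} (h : ¬ IsNear N ω q) :
    ∃ w, IsLegalSketchPath N (sourceTile N ω q) (tileRow N ω (q.dst : ℕ)) w := by
  have h1 := sourceTile_row_lt h
  have h2 := tileRow_sub_le (ω := ω) hN (v := (q.src : ℕ)) (v' := (q.dst : ℕ))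
    (by exact_mod_cast q.src_le_dst)
  have h3 : (sourceTile N ω q).1 = tileRow N ω (q.src : ℕ) := rfl
  have h4 := q.dst.2
  obtain ⟨k, hk⟩ : ∃ k : ℕ, tileRow N ω (q.dst : ℕ) - (sourceTile N ω q).1 = k + 1 :=
    ⟨(tileRow N ω (q.dst : ℕ) - (sourceTile N ω q).1 - 1).toNat, by omega⟩
  refine ⟨List.replicate (k + 1) .forward, ?_, ?_, ?_⟩
  · rw [List.count_replicate_self]; push_cast; linarith
  · rw [List.getLast?_replicate]; simp
  · rw [List.length_replicate]; unfold LineNetwork.pmax; omega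

/-- Two packets may not be injected into the same plane of the same SW-quadrant, if they start in
the same row or column. -/
def Conflict (N : LineNetwork) (ω : Coins) (p p' : Packet N.n) : Prop :=
  sourceTile N ω p.req = sourceTile N ω p'.req ∧ p.plane = p'.plane ∧
    match planeDir N p'.plane with
    | .hold => p.req.src = p'.req.src
    | .forward => (p.req.time : ℤ) - (p.req.src : ℕ) = (p'.req.time : ℤ) - (p'.req.src : ℕ)

open Classical in
/-- The properties that the admission control guarantees for the packets of the class `Far⁺`. -/
structure FarAdmitted (N : LineNetwork) (ω : Coins) (S : State N.n) : Prop where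
  load : ∀ e, (S.packets.filter fun p => e ∈ sketchEdges (sourceTile N ω p.req) p.sketch).length ≤
    S.load e
  load_lt : ∀ e, 4 * S.load e < N.cS
  quadrant : ∀ s, 4 * (S.packets.filter fun p => sourceTile N ω p.req = s).length ≤ N.cS
  packet : ∀ p ∈ S.packets, IsFarPlus N ω p.req ∧ p.start = planeDir N p.plane ∧
    p.plane < N.B + N.c ∧
    IsLegalSketchPath N (sourceTile N ω p.req) (tileRow N ω (p.req.dst : ℕ)) p.sketch
  conflict : S.packets.Pairwise fun p p' => ¬ Conflict N ω p p'

theorem filter_movePackets {ps : List (Packet N.n)} (P : Packet N.n → Bool)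
    (hP : ∀ p, P p.static = P p) :
    ((movePackets N ω ps).filter P).length = (ps.filter P).length := by
  rw [← List.countP_eq_length_filter, ← List.countP_eq_length_filter, movePackets_eq,
    List.countP_map]
  apply List.countP_congr
  intro p _
  rw [Function.comp_apply, ← hP (advance N ω ps p), advance_static, hP]

theorem FarAdmitted.move {S : State N.n} (h : FarAdmitted N ω S) :
    FarAdmitted N ω { S with packets := movePackets N ω S.packets } where
  load e := by
    rw [filter_movePackets _ (fun p => rfl)]; exact h.load e
  load_lt := h.load_lt
  quadrant s := by
    rw [filter_movePackets _ (fun p => rfl)]; exact h.quadrant s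
  packet p hp := by
    obtain ⟨p', hp', rfl⟩ := List.mem_map.1 hp
    have hs := advance_static (ω := ω) S.packets p'
    have := h.packet p' hp'
    rw [← static_req hs, ← static_start hs, ← static_plane hs, ← static_sketch hs] at this
    exact this
  conflict := by
    have h1 : ((movePackets N ω S.packets).map Packet.static).Pairwise
        fun p p' => ¬ Conflict N ω p p' := by
      rw [map_static_movePackets, List.pairwise_map]; exact h.conflict
    rw [List.pairwise_map] at h1; exact h1

theorem FarAdmitted.init (hN : N.Valid) : FarAdmitted N ω (State.init N.n) where
  load e := by simp [State.init]
  load_lt e := by have := hN.nine_le_cS; simp [State.init]; omega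
  quadrant s := by simp [State.init]
  packet p hp := by simp [State.init] at hp
  conflict := by simp [State.init]

/-- Each test of the algorithm protects one of the invariants. The counter `S.load` also includes
requests that pass the load test and then fail in `I`-routing, so it is only an upper bound for the
number of packets on an edge. -/
theorem FarAdmitted.handleFar (hN : N.Valid) (horacle : IsLightestPathOracle N lightest)
    {S : State N.n} (h : FarAdmitted N ω S) (batch : List (Request N.n × ℕ)) (q : Request N.n × ℕ) :
    FarAdmitted N ω (handleFar N lightest ω batch S q) := by
  classical
  unfold PacketRouting.handleFar
  dsimp only
  split_ifs with h1 h2 h3 h4 h5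
  · exact h
  · exact h
  · exact ⟨h.load, h.load_lt, h.quadrant, h.packet, h.conflict⟩
  · exact ⟨h.load, h.load_lt, h.quadrant, h.packet, h.conflict⟩
  · push Not at h4
    refine ⟨?_, ?_, h.quadrant, h.packet, h.conflict⟩
    · intro e
      dsimp only
      have := h.load e
      split_ifs <;> omega
    · intro e
      dsimp only
      have := h.load_lt e
      split_ifs with he
      · exact h4 e he
      · exact this
  · push Not at h4
    rw [not_or, not_not, not_le] at h1
    rw [IRoutingFails, not_or, not_lt] at h5
    refine ⟨?_, ?_, ?_, ?_, ?_⟩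
    · intro e
      dsimp only
      rw [List.filter_append, List.length_append]
      have := h.load e
      by_cases he : e ∈ sketchEdges (sourceTile N ω q.1)
          (lightest S.weight (sourceTile N ω q.1) (tileRow N ω (q.1.dst : ℕ)))
      · rw [if_pos he, List.filter_singleton]
        simp only [he, decide_true, cond_true, List.length_singleton]
        omega
      · rw [if_neg he, List.filter_singleton]
        simp only [he, decide_false, cond_false, List.length_nil]
        omega
    · intro e
      dsimp only
      have := h.load_lt e
      split_ifs with he
      · exact h4 e he
      · exact this
    · intro s
      dsimp only
      rw [List.filter_append, List.length_append, List.filter_singleton]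
      by_cases hs : sourceTile N ω q.1 = s
      · subst hs
        simp only [decide_true, cond_true, List.length_singleton]
        exact h5.2
      · simp only [hs, decide_false, cond_false, List.length_nil]
        exact h.quadrant s
    · intro p hp
      rcases List.mem_append.1 hp with hp | hp
      · exact h.packet p hp
      · rw [List.mem_singleton.1 hp]
        exact ⟨h1.1, rfl, h1.2, (horacle _ _ _ (exists_legalSketchPath hN h1.1.1)).1⟩
    · rw [List.pairwise_append]
      refine ⟨h.conflict, List.pairwise_singleton _ _, ?_⟩
      intro p hp p' hp' hc
      rw [List.mem_singleton] at hp'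
      subst hp'
      exact h5.1 ⟨p, hp, hc⟩

theorem farAdmitted_mid (hN : N.Valid) (horacle : IsLightestPathOracle N lightest)
    (hfar : ω.far = true) (σ : List (Request N.n)) (T : ℕ) :
    FarAdmitted N ω (mid N lightest ω σ T) := by
  refine (mid_induction (N := N) (ω := ω) (lightest := lightest) (σ := σ)
    (fun _ S => FarAdmitted N ω S) (FarAdmitted.init hN) ?_ (fun _ _ h => h.move) T).2
  intro T pre q S _ _ h
  unfold handleRequest
  rw [if_pos hfar]
  exact h.handleFar hN horacle _ q

end FarRequests

/-! ### Coordinates of a packet -/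

section Coordinates

theorem ediv_emod_add_one {a b : ℤ} (hb : 0 < b) :
    (a % b + 1 < b ∧ (a + 1) / b = a / b ∧ (a + 1) % b = a % b + 1) ∨
      (a % b + 1 = b ∧ (a + 1) / b = a / b + 1 ∧ (a + 1) % b = 0) := by
  have h1 := Int.emod_lt_of_pos a hb
  have h2 := Int.emod_nonneg a hb.ne'
  have h3 := Int.mul_ediv_add_emod a b
  rcases (show a % b + 1 ≤ b by omega).lt_or_eq with h | h
  · left
    have e : a + 1 = (a % b + 1) + b * (a / b) := by linarith
    refine ⟨h, ?_, ?_⟩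
    · rw [e, Int.add_mul_ediv_left _ _ hb.ne', Int.ediv_eq_zero_of_lt (by omega) h, zero_add]
    · rw [e, Int.add_mul_emod_self_left, Int.emod_eq_of_lt (by omega) h]
  · right
    have e : a + 1 = b * (a / b + 1) := by linarith
    refine ⟨h, ?_, ?_⟩
    · rw [e, Int.mul_ediv_cancel_left _ hb.ne']
    · rw [e, Int.mul_emod_right]

variable (N : LineNetwork) (ω : Coins)

/-- The untilted coordinates of a packet, relative to the tiling. -/
def coord (p : Packet N.n) : Move → ℤ
  | .forward => (p.node : ℤ) - ω.phaseSpace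
  | .hold => (p.now : ℤ) - (p.node : ℤ) - ω.phaseTime

/-- The size of a tile. -/
noncomputable def side : Move → ℕ
  | .forward => N.Q
  | .hold => N.tau

/-- The size of a quadrant. -/
noncomputable def half : Move → ℕ
  | .forward => N.halfQ
  | .hold => N.halfTau

/-- The coordinates of a packet in its tile. -/
noncomputable def offset (p : Packet N.n) (m : Move) : ℤ := coord N ω p m % side N m

/-- The coordinates of the tile of a packet. -/
noncomputable def index (p : Packet N.n) (m : Move) : ℤ := coord N ω p m / side N m

/-- The packet is in the second half of its tile (northern, respectively eastern half). -/
def Late (p : Packet N.n) (m : Move) : Prop := (half N m : ℤ) ≤ offset N ω p m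

/-- The tile of a packet. -/
noncomputable def tile (p : Packet N.n) : Tile := tileOf N ω p.node p.now

variable {N ω}

theorem side_eq (m : Move) : side N m = 2 * half N m := by
  cases m
  · exact N.Q_eq
  · exact N.tau_eq

theorem half_pos (hN : N.Valid) (m : Move) : 0 < half N m := by
  cases m
  · exact hN.halfQ_pos
  · exact hN.halfTau_pos

theorem tile_eq (p : Packet N.n) : tile N ω p = (index N ω p .forward, index N ω p .hold) := rfl

theorem inSouth_iff (p : Packet N.n) : InSouth N ω p.node ↔ ¬ Late N ω p .forward := by
  unfold InSouth Late offset
  have := side_eq (N := N) .forward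
  change 2 * (coord N ω p .forward % (side N .forward : ℤ)) < (side N .forward : ℤ) ↔ _
  omega

theorem inWest_iff (p : Packet N.n) : InWest N ω p.node p.now ↔ ¬ Late N ω p .hold := by
  unfold InWest Late offset
  have := side_eq (N := N) .hold
  change 2 * (coord N ω p .hold % (side N .hold : ℤ)) < (side N .hold : ℤ) ↔ _
  omega

theorem coord_eq (p : Packet N.n) (m : Move) :
    coord N ω p m = coord N ω p.static m + p.moves.count m := by
  have := count_forward_add_count_hold p.moves
  cases m <;> simp [coord, Packet.node, Packet.now, Packet.static, Request.nodeAfter] <;> omega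

theorem tile_static (p : Packet N.n) : tile N ω p.static = sourceTile N ω p.req := by
  simp [tile, sourceTile, Packet.node, Packet.now, Packet.static, Request.nodeAfter]

/-- The packet after a move. -/
def Packet.extend {n : ℕ} (p : Packet n) (m : Move) : Packet n := { p with moves := p.moves ++ [m] }

theorem advance_eq_extend {ps : List (Packet N.n)} {p : Packet N.n} (h : ¬ p.Arrived) :
    advance N ω ps p = p.extend (decideMove N ω ps p) := advance_of_not_arrived h

@[simp]
theorem heading_extend (p : Packet N.n) (m : Move) : (p.extend m).heading = m := by
  simp [Packet.heading, Packet.extend]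

theorem node_extend (p : Packet N.n) (m : Move) :
    (p.extend m).node = p.node + if m = .forward then 1 else 0 := by
  cases m <;> simp [Packet.node, Packet.extend, Request.nodeAfter, add_assoc]

theorem coord_extend (p : Packet N.n) (m m' : Move) :
    coord N ω (p.extend m) m' = coord N ω p m' + if m' = m then 1 else 0 := by
  rw [coord_eq, coord_eq p]
  have h : (p.extend m).static = p.static := rfl
  rw [h]
  simp only [Packet.extend, List.count_append, List.count_singleton]
  cases m <;> cases m' <;> simp <;> ring

theorem coord_extend_self (p : Packet N.n) (m : Move) :
    coord N ω (p.extend m) m = coord N ω p m + 1 := by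
  rw [coord_extend, if_pos rfl]

theorem coord_extend_other (p : Packet N.n) {m m' : Move} (h : m' ≠ m) :
    coord N ω (p.extend m) m' = coord N ω p m' := by
  rw [coord_extend, if_neg h, add_zero]

theorem offset_extend_other (p : Packet N.n) {m m' : Move} (h : m' ≠ m) :
    offset N ω (p.extend m) m' = offset N ω p m' := by
  rw [offset, coord_extend_other p h]; rfl

theorem index_extend_other (p : Packet N.n) {m m' : Move} (h : m' ≠ m) :
    index N ω (p.extend m) m' = index N ω p m' := by
  rw [index, coord_extend_other p h]; rfl

/-- A move either stays in the tile or leads to the next one. -/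
theorem extend_cases (hN : N.Valid) (p : Packet N.n) (m : Move) :
    (offset N ω p m + 1 < side N m ∧ tile N ω (p.extend m) = tile N ω p ∧
      offset N ω (p.extend m) m = offset N ω p m + 1) ∨
    (offset N ω p m + 1 = side N m ∧ tile N ω (p.extend m) = nextTile (tile N ω p) m ∧
      offset N ω (p.extend m) m = 0) := by
  have hs : (0 : ℤ) < side N m := by
    have := half_pos hN m
    rw [side_eq]; omega
  have h := ediv_emod_add_one (a := coord N ω p m) hs
  rw [← coord_extend_self] at h
  rcases h with ⟨h1, h2, h3⟩ | ⟨h1, h2, h3⟩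
  · refine Or.inl ⟨h1, ?_, h3⟩
    change index N ω (p.extend m) m = index N ω p m at h2
    rw [tile_eq, tile_eq]
    cases m
    · rw [h2, index_extend_other p (by simp)]
    · rw [h2, index_extend_other p (by simp)]
  · refine Or.inr ⟨h1, ?_, h3⟩
    change index N ω (p.extend m) m = index N ω p m + 1 at h2
    rw [tile_eq, tile_eq]
    cases m
    · rw [h2, index_extend_other p (by simp)]; rfl
    · rw [h2, index_extend_other p (by simp)]; rfl

/-- The destination of the packet has a copy in its tile. -/
def InLastRow (N : LineNetwork) (ω : Coins) (p : Packet N.n) : Prop :=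
  (tile N ω p).1 = tileRow N ω (p.req.dst : ℕ)

/-- The number of steps on its sketch path that the packet has made. -/
noncomputable def progress (N : LineNetwork) (ω : Coins) (p : Packet N.n) : ℕ :=
  (((tile N ω p).1 - (sourceTile N ω p.req).1) + ((tile N ω p).2 - (sourceTile N ω p.req).2)).toNat

theorem goal_lastRow {p : Packet N.n} (h : InLastRow N ω p) : goal N ω p = .forward := by
  unfold goal; exact if_pos h

theorem goal_southWest {p : Packet N.n} (h : ¬ InLastRow N ω p) (h1 : ¬ Late N ω p .forward)
    (h2 : ¬ Late N ω p .hold) : goal N ω p = p.heading := by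
  unfold InLastRow at h
  unfold goal
  dsimp only
  change ¬ (tileOf N ω p.node p.now).1 = _ at h
  rw [if_neg h, if_pos ((inSouth_iff p).2 h1), if_pos ((inWest_iff p).2 h2)]

theorem goal_mixed {p : Packet N.n} (h : ¬ InLastRow N ω p) {m : Move} (h1 : ¬ Late N ω p m)
    (h2 : Late N ω p m.other) : goal N ω p = m := by
  unfold InLastRow at h
  unfold goal
  dsimp only
  change ¬ (tileOf N ω p.node p.now).1 = _ at h
  cases m
  · rw [if_neg h, if_pos ((inSouth_iff p).2 h1), if_neg (by rw [inWest_iff, not_not]; exact h2)]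
  · rw [if_neg h, if_neg (by rw [inSouth_iff, not_not]; exact h2), if_pos ((inWest_iff p).2 h1)]

theorem goal_northEast {p : Packet N.n} (h : ¬ InLastRow N ω p) (h1 : Late N ω p .forward)
    (h2 : Late N ω p .hold) : goal N ω p = p.sketch.getD (progress N ω p) .forward := by
  unfold InLastRow at h
  unfold goal
  dsimp only
  change ¬ (tileOf N ω p.node p.now).1 = _ at h
  rw [if_neg h, if_neg (by rw [inSouth_iff, not_not]; exact h1),
    if_neg (by rw [inWest_iff, not_not]; exact h2)]
  rfl

/-- Outside the SW-quadrants, the goal direction depends on the quadrant only. -/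
theorem goal_congr {p p' : Packet N.n} (hs : p'.static = p.static) (ht : tile N ω p' = tile N ω p)
    (hl : ∀ m, Late N ω p' m ↔ Late N ω p m) {m : Move} (hm : Late N ω p m) :
    goal N ω p' = goal N ω p := by
  have hlast : InLastRow N ω p' ↔ InLastRow N ω p := by
    unfold InLastRow; rw [ht, static_req hs]
  by_cases h : InLastRow N ω p
  · rw [goal_lastRow h, goal_lastRow (hlast.2 h)]
  have h' := mt hlast.1 h
  by_cases h1 : Late N ω p m.other
  · have hall : ∀ m', Late N ω p m' := by
      intro m'; by_cases e : m' = m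
      · rwa [e]
      · rwa [show m' = m.other from Move.eq_other_iff.2 e]
    rw [goal_northEast h (hall _) (hall _), goal_northEast h' ((hl _).2 (hall _))
      ((hl _).2 (hall _)),
      static_sketch hs]
    unfold progress
    rw [ht, static_req hs]
  · have : m = m.other.other := by cases m <;> rfl
    rw [goal_mixed h h1 (this ▸ hm), goal_mixed h' (mt (hl _).1 h1) ((hl _).2 (this ▸ hm))]

end Coordinates

/-! ### Invariants of the detailed routing -/

section Detailed

variable (N : LineNetwork) (lightest : Oracle) (ω : Coins) (σ : List (Request N.n))

/-- The position of a packet relative to its sketch path. -/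
structure OnSketch (p : Packet N.n) : Prop where
  le_length : progress N ω p ≤ p.sketch.length
  tile_eq : tile N ω p = walk (sourceTile N ω p.req) (p.sketch.take (progress N ω p))
  southWest : ¬ Late N ω p .forward → ¬ Late N ω p .hold →
    progress N ω p = 0 ∧ ∀ m ∈ p.moves, m = p.start
  mixed : ∀ m : Move, ¬ Late N ω p m → Late N ω p m.other →
    progress N ω p = 0 ∨ p.sketch[progress N ω p - 1]? = some m
  lastRow : InLastRow N ω p → p.heading = .forward ∧ Late N ω p .hold
  node_le : p.node ≤ p.req.dst

open Classical in
/-- The packets that take the edge in their goal direction `g` at node `v` in time step `T`. -/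
noncomputable def grantedAt (T v : ℕ) (g : Move) : Finset (Packet N.n) :=
  (mid N lightest ω σ T).packets.toFinset.filter fun p =>
    ¬ p.Arrived ∧ p.node = v ∧ goal N ω p = g ∧
      decideMove N ω (mid N lightest ω σ T).packets p = g

/-- A packet that has not yet managed to turn has met a saturated edge at every vertex since it
entered its quadrant. -/
def Blocked (T : ℕ) (p : Packet N.n) : Prop :=
  goal N ω p ≠ p.heading → ∀ d : ℕ, 1 ≤ d → (half N p.heading : ℤ) + d ≤ offset N ω p p.heading →
    d ≤ T ∧ (p.heading = .forward → d ≤ p.node) ∧ N.cap (goal N ω p) ≤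
      (grantedAt N lightest ω σ (T - d) (p.node - if p.heading = .forward then d else 0)
        (goal N ω p)).card

open Classical in
/-- The packets in the network that are at node `v` in time step `T`. -/
noncomputable def present (T v : ℕ) : Finset (Packet N.n) :=
  (mid N lightest ω σ T).packets.toFinset.filter fun p => ¬ p.Arrived ∧ p.node = v

open Classical in
/-- The invariant of the detailed routing. -/
structure RoutingInvariant (T : ℕ) : Prop where
  onSketch : ∀ p ∈ (mid N lightest ω σ T).packets, ¬ p.Arrived → OnSketch N ω p
  blocked : ∀ p ∈ (mid N lightest ω σ T).packets, ¬ p.Arrived → Blocked N lightest ω σ T p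
  heading : ∀ v m, ((present N lightest ω σ T v).filter fun p => p.heading = m).card ≤ N.cap m

variable {N lightest ω σ}

theorem id_injOn_present (T v : ℕ) :
    Set.InjOn Packet.id (present N lightest ω σ T v : Set (Packet N.n)) := by
  intro p hp p' hp' h
  simp only [present, Finset.coe_filter, List.mem_toFinset, Set.mem_ofPred_eq] at hp hp'
  exact mid_id_inj hp.1 hp'.1 h

open Classical in
/-- `decideMove` is the abstract conflict resolution. -/
theorem decideMove_eq {T : ℕ} {p : Packet N.n} :
    decideMove N ω (mid N lightest ω σ T).packets p =
      if Granted (present N lightest ω σ T p.node) (goal N ω) Packet.heading Packet.id N.cap p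
      then goal N ω p else p.heading := by
  unfold decideMove
  have hnd : (mid N lightest ω σ T).packets.Nodup := List.Nodup.of_map _ (fromRequests T).2.nodup
  refine if_congr ?_ rfl rfl
  unfold Granted keyRank
  rw [← List.toFinset_card_of_nodup (hnd.filter _), List.toFinset_filter]
  have : ((mid N lightest ω σ T).packets.toFinset.filter fun p' => decide (¬ p'.Arrived ∧
      p'.node = p.node ∧ goal N ω p' = goal N ω p ∧ Precedes N ω p' p) = true) =
      ((present N lightest ω σ T p.node).filter fun y => goal N ω y = goal N ω p).filter
        fun y => priority (goal N ω) Packet.heading Packet.id y <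
          priority (goal N ω) Packet.heading Packet.id p := by
    ext y
    simp only [present, Finset.mem_filter, decide_eq_true_eq, priority_lt_iff]
    unfold Precedes
    tauto
  rw [this]

theorem decideMove_of_straight {ps : List (Packet N.n)} {p : Packet N.n}
    (h : goal N ω p = p.heading) : decideMove N ω ps p = p.heading := by
  unfold decideMove; rw [h, ite_self]

theorem decideMove_cases (ps : List (Packet N.n)) (p : Packet N.n) :
    decideMove N ω ps p = goal N ω p ∨ decideMove N ω ps p = p.heading := by
  unfold decideMove; split_ifs
  · exact Or.inl rfl
  · exact Or.inr rfl

theorem RoutingInvariant.movers_le {T : ℕ} (hJ : RoutingInvariant N lightest ω σ T)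
    (v : ℕ) (m : Move) :
    (movers N ω (mid N lightest ω σ T).packets v m).card ≤ N.cap m := by
  classical
  refine le_trans (Finset.card_le_card ?_) (card_moves_le (g := goal N ω) (id_injOn_present T v)
      (hJ.heading v) m)
  intro p hp
  simp only [movers, Finset.mem_filter] at hp
  obtain ⟨h1, h2, rfl, h4⟩ := hp
  rw [Finset.mem_filter]
  refine ⟨by simp only [present, Finset.mem_filter]; exact ⟨h1, h2, trivial⟩, ?_⟩
  rw [← decideMove_eq]; exact h4

theorem cap_le_card_grantedAt {T : ℕ} {p : Packet N.n}
    (hp : p ∈ (mid N lightest ω σ T).packets) (ha : ¬ p.Arrived)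
    (hne : decideMove N ω (mid N lightest ω σ T).packets p ≠ goal N ω p) :
    N.cap (goal N ω p) ≤ (grantedAt N lightest ω σ T p.node (goal N ω p)).card := by
  classical
  rw [decideMove_eq] at hne
  have hgr : ¬ Granted (present N lightest ω σ T p.node) (goal N ω) Packet.heading Packet.id
      N.cap p := by
    intro h; rw [if_pos h] at hne; exact hne rfl
  refine (cap_le_card_granted (id_injOn_present T p.node)
    (by simp only [present, Finset.mem_filter, List.mem_toFinset]; exact ⟨hp, ha, trivial⟩)
        hgr).trans
    (Finset.card_le_card ?_)
  intro y hy
  rw [Finset.mem_filter] at hy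
  obtain ⟨h1, h2, h3⟩ := hy
  simp only [present, Finset.mem_filter] at h1
  simp only [grantedAt, Finset.mem_filter]
  refine ⟨h1.1, h1.2.1, h1.2.2, h2, ?_⟩
  rw [decideMove_eq, h1.2.2, if_pos h3, h2]

/-- The edges of the sketch path next to the tile of the packet. -/
theorem OnSketch.mem_sketchEdges_pred {p : Packet N.n} (h : OnSketch N ω p) {m : Move}
    (hpos : progress N ω p ≠ 0) (hm : p.sketch[progress N ω p - 1]? = some m) {s : Tile}
    (hs : nextTile s m = tile N ω p) : (s, m) ∈ sketchEdges (sourceTile N ω p.req) p.sketch := by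
  rw [mem_sketchEdges]
  refine ⟨progress N ω p - 1, m, hm, ?_⟩
  rw [h.tile_eq] at hs
  have h1 : p.sketch.take (progress N ω p) = p.sketch.take (progress N ω p - 1) ++ [m] := by
    obtain ⟨j, hj⟩ := Nat.exists_eq_succ_of_ne_zero hpos
    rw [hj] at hm ⊢
    rw [Nat.succ_sub_one] at hm ⊢
    rw [List.take_add_one, hm]; rfl
  rw [h1, walk_append_singleton] at hs
  have h2 : s = walk (sourceTile N ω p.req) (p.sketch.take (progress N ω p - 1)) := by
    cases m <;> simp only [nextTile, Prod.mk.injEq, add_left_inj] at hs <;>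
      exact Prod.ext hs.1 hs.2
  rw [h2]

theorem OnSketch.mem_sketchEdges_succ {p : Packet N.n} (h : OnSketch N ω p) {m : Move}
    (hm : p.sketch[progress N ω p]? = some m) :
    (tile N ω p, m) ∈ sketchEdges (sourceTile N ω p.req) p.sketch := by
  rw [mem_sketchEdges]
  exact ⟨_, m, hm, by rw [h.tile_eq]⟩

/-- The predecessor of a tile. -/
def prevTile (s : Tile) : Move → Tile
  | .forward => (s.1 - 1, s.2)
  | .hold => (s.1, s.2 - 1)

theorem nextTile_prevTile (s : Tile) (m : Move) : nextTile (prevTile s m) m = s := by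
  cases m <;> simp [nextTile, prevTile]

variable (hN : N.Valid) (horacle : IsLightestPathOracle N lightest) (hfar : ω.far = true)

include hN horacle hfar in
theorem legal_of_mem_mid {T : ℕ} {p : Packet N.n} (hp : p ∈ (mid N lightest ω σ T).packets) :
    IsFarPlus N ω p.req ∧ p.start = planeDir N p.plane ∧ p.plane < N.B + N.c ∧
    IsLegalSketchPath N (sourceTile N ω p.req) (tileRow N ω (p.req.dst : ℕ)) p.sketch :=
  (farAdmitted_mid hN horacle hfar σ T).packet p hp

theorem OnSketch.lastRow_iff {p : Packet N.n} (h : OnSketch N ω p)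
    (hl : IsLegalSketchPath N (sourceTile N ω p.req) (tileRow N ω (p.req.dst : ℕ)) p.sketch) :
    InLastRow N ω p ↔ progress N ω p = p.sketch.length := by
  constructor
  · intro h1
    by_contra h2
    have h3 := hl.row_lt (lt_of_le_of_ne h.le_length h2)
    rw [← h.tile_eq] at h3
    exact absurd h1 h3.ne
  · intro h1
    have := hl.row_eq
    rw [← h1, ← h.tile_eq] at this
    exact this

/-- Where the packets that have goal direction `g` come from, or go to. -/
theorem OnSketch.origin {p : Packet N.n} (h : OnSketch N ω p)
    (hl : IsLegalSketchPath N (sourceTile N ω p.req) (tileRow N ω (p.req.dst : ℕ)) p.sketch)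
    (hlate : Late N ω p (goal N ω p).other) :
    (¬ Late N ω p (goal N ω p) ∧ (sourceTile N ω p.req = tile N ω p ∨
        (prevTile (tile N ω p) (goal N ω p), goal N ω p) ∈
          sketchEdges (sourceTile N ω p.req) p.sketch)) ∨
    (Late N ω p (goal N ω p) ∧ ((tile N ω p, goal N ω p) ∈
          sketchEdges (sourceTile N ω p.req) p.sketch ∨
        (prevTile (tile N ω p) (goal N ω p), goal N ω p) ∈
          sketchEdges (sourceTile N ω p.req) p.sketch)) := by
  -- Late in both directions means the NE-quadrant. There the goal is the next step of the sketch
  -- path, unless the tile is in the last row, which was entered by the final northward edge. If the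
  -- packet is early in its goal direction, it is in the SE- or NW-quadrant; then it has not left
  -- its source tile or has entered this one in the goal direction.
  by_cases hg : Late N ω p (goal N ω p)
  · refine Or.inr ⟨hg, ?_⟩
    by_cases hlast : InLastRow N ω p
    · right
      have h1 := (h.lastRow_iff hl).1 hlast
      have h2 := hl.length_pos
      rw [goal_lastRow hlast]
      refine h.mem_sketchEdges_pred (by omega) ?_ (nextTile_prevTile _ _)
      rw [h1]; exact hl.last_eq
    · left
      have hlt : progress N ω p < p.sketch.length :=
        lt_of_le_of_ne h.le_length (mt (h.lastRow_iff hl).2 hlast)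
      apply h.mem_sketchEdges_succ
      have hall : ∀ m, Late N ω p m := by
        intro m
        by_cases e : m = goal N ω p
        · rwa [e]
        · rwa [Move.eq_other_iff.2 e]
      rw [goal_northEast hlast (hall _) (hall _), List.getD_eq_getElem?_getD,
        List.getElem?_eq_getElem hlt]
      rfl
  · refine Or.inl ⟨hg, ?_⟩
    rcases h.mixed _ hg hlate with h1 | h1
    · left
      rw [h.tile_eq, h1]; simp
    · by_cases h0 : progress N ω p = 0
      · left
        rw [h.tile_eq, h0]; simp
      · exact Or.inr (h.mem_sketchEdges_pred h0 h1 (nextTile_prevTile _ _))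

end Detailed

/-! ### The detailed routing preserves its invariants -/

section Detailed

variable {N : LineNetwork} {lightest : Oracle} {ω : Coins} {σ : List (Request N.n)}
variable (hN : N.Valid) (horacle : IsLightestPathOracle N lightest) (hfar : ω.far = true)

theorem cS_le_half (m : Move) : N.cS ≤ 2 * (half N m * N.cap m.other) := by
  cases m
  · exact N.cS_le_Q
  · exact N.cS_le_tau

@[simp]
theorem other_other (m : Move) : m.other.other = m := by cases m <;> rfl

theorem other_ne (m : Move) : m.other ≠ m := by cases m <;> simp [Move.other]

theorem mem_grantedAt {T v : ℕ} {g : Move} {p : Packet N.n} :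
    p ∈ grantedAt N lightest ω σ T v g ↔ p ∈ (mid N lightest ω σ T).packets ∧ ¬ p.Arrived ∧
      p.node = v ∧ goal N ω p = g ∧ decideMove N ω (mid N lightest ω σ T).packets p = g := by
  simp [grantedAt]

theorem mem_present {T v : ℕ} {p : Packet N.n} :
    p ∈ present N lightest ω σ T v ↔ p ∈ (mid N lightest ω σ T).packets ∧ ¬ p.Arrived ∧
      p.node = v := by
  simp [present]

theorem ediv_emod_sub {a b d : ℤ} (hd : 0 ≤ d) (h : d ≤ a % b) (hb : 0 < b) :
    (a - d) / b = a / b ∧ (a - d) % b = a % b - d := by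
  have h1 := Int.emod_lt_of_pos a hb
  have h3 := Int.mul_ediv_add_emod a b
  have e : a - d = (a % b - d) + b * (a / b) := by linarith
  constructor
  · rw [e, Int.add_mul_ediv_left _ _ hb.ne', Int.ediv_eq_zero_of_lt (by omega) (by omega), zero_add]
  · rw [e, Int.add_mul_emod_self_left, Int.emod_eq_of_lt (by omega) (by omega)]

/-- The position of a packet in terms of the position of another one. -/
theorem coord_of_back {p p' : Packet N.n} {d : ℕ} {h : Move} (hnow : p'.now + d = p.now)
    (hnode : p'.node + (if h = .forward then d else 0) = p.node) :
    coord N ω p' h = coord N ω p h - d ∧ coord N ω p' h.other = coord N ω p h.other := by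
  cases h <;> simp [coord, Move.other] at hnode ⊢ <;> omega

/-- The count of packets that have to pass an edge between tiles, or out of a SW-quadrant. -/
theorem four_mul_card_lt {S : State N.n} (hS : FarAdmitted N ω S) {U : Finset ℕ} {s : Tile}
    {g : Move} (e : SketchEdge)
    (hU : (∀ i ∈ U, ∃ p ∈ S.packets, p.id = i ∧ (sourceTile N ω p.req = s ∨
        (prevTile s g, g) ∈ sketchEdges (sourceTile N ω p.req) p.sketch)) ∨
      (∀ i ∈ U, ∃ p ∈ S.packets, p.id = i ∧ (e ∈ sketchEdges (sourceTile N ω p.req) p.sketch ∨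
        (prevTile s g, g) ∈ sketchEdges (sourceTile N ω p.req) p.sketch))) :
    4 * U.card < 2 * N.cS := by
  classical
  have hedge : ∀ e, 4 * ((S.packets.filter fun p =>
      e ∈ sketchEdges (sourceTile N ω p.req) p.sketch).length) < N.cS := by
    intro e
    have h1 := hS.load e
    have h2 := hS.load_lt e
    omega
  have key : ∀ (P P' : Packet N.n → Prop) [DecidablePred P] [DecidablePred P'],
      (∀ i ∈ U, ∃ p ∈ S.packets, p.id = i ∧ (P p ∨ P' p)) →
      U.card ≤ (S.packets.filter fun p => P p).length + (S.packets.filter fun p => P' p).length := by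
    intro P P' _ _ h
    calc U.card ≤ ((S.packets.filter fun p => P p) ++
          (S.packets.filter fun p => P' p)).toFinset.card := by
          refine (Finset.card_le_card (t := (((S.packets.filter fun p => P p) ++
            (S.packets.filter fun p => P' p)).toFinset.image Packet.id)) ?_).trans
            Finset.card_image_le
          intro i hi
          obtain ⟨p, hp, rfl, h'⟩ := h i hi
          refine Finset.mem_image.2 ⟨p, ?_, rfl⟩
          simp only [List.mem_toFinset, List.mem_append, List.mem_filter, decide_eq_true_eq]
          tauto
      _ ≤ _ := (List.toFinset_card_le _).trans (by rw [List.length_append])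
  have h1 := hedge (prevTile s g, g)
  rcases hU with hU | hU
  · have h2 := key _ _ hU
    have h3 := hS.quadrant s
    omega
  · have h2 := key _ _ hU
    have h3 := hedge e
    omega

include hN horacle hfar in
/-- A packet turns before it leaves its quadrant. -/
theorem not_exit_straight {T : ℕ} (hJ : ∀ T' ≤ T, RoutingInvariant N lightest ω σ T')
    {p : Packet N.n} (hp : p ∈ (mid N lightest ω σ T).packets) (ha : ¬ p.Arrived)
    (hne : decideMove N ω (mid N lightest ω σ T).packets p ≠ goal N ω p) :
    offset N ω p p.heading + 1 ≠ side N p.heading := by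
  classical
  intro hoff
  set h := p.heading with hh
  set g := goal N ω p with hg
  have hgh : g ≠ h := by
    intro e
    exact hne ((decideMove_of_straight e).trans e.symm)
  have hgo : g = h.other := Move.eq_other_iff.2 hgh
  have hhalf := half_pos hN h
  have hside : (side N h : ℤ) = 2 * half N h := by exact_mod_cast side_eq h
  have hsidepos : (0 : ℤ) < side N h := by omega
  have hnow := now_eq hp ha
  -- `G d` consists of the packets on the side edge that refused `p` when it was `d` steps further
  -- back. The case `d = 0` is the present refusal, the others come from `Blocked`.
  let G : ℕ → Finset (Packet N.n) := fun d =>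
    grantedAt N lightest ω σ (T - d) (p.node - if h = .forward then d else 0) g
  have hG : ∀ d < half N h, d ≤ T ∧ (h = .forward → d ≤ p.node) ∧ N.cap g ≤ (G d).card := by
    intro d hd
    rcases Nat.eq_zero_or_pos d with rfl | hd0
    · refine ⟨Nat.zero_le _, fun _ => Nat.zero_le _, ?_⟩
      simpa [G] using cap_le_card_grantedAt hp ha hne
    · exact (hJ T le_rfl).blocked p hp ha hgh d hd0 (by rw [← hh]; omega)
  have hback : ∀ d < half N h, ∀ p' ∈ G d, p'.now = T - d ∧ coord N ω p' h = coord N ω p h - d ∧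
      coord N ω p' g = coord N ω p g := by
    intro d hd p' hp'
    obtain ⟨h1, h2, h3, -, -⟩ := mem_grantedAt.1 hp'
    have hn := now_eq h1 h2
    obtain ⟨hd1, hd2, -⟩ := hG d hd
    refine ⟨hn, ?_⟩
    rw [hgo]
    refine coord_of_back (by omega) ?_
    rw [h3]
    split_ifs with h4
    · have := hd2 h4; omega
    · rfl
  -- As `p` is at the far side of its quadrant, going back fewer than `half N h` steps does not
  -- leave the quadrant.
  have hsame : ∀ d < half N h, ∀ p' ∈ G d, tile N ω p' = tile N ω p ∧
      (Late N ω p' g ↔ Late N ω p g) ∧ Late N ω p' h := by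
    intro d hd p' hp'
    obtain ⟨-, h1, h2⟩ := hback d hd p' hp'
    have h3 := ediv_emod_sub (a := coord N ω p h) (b := side N h) (d := d) (by omega)
      (by change (d : ℤ) ≤ offset N ω p h; omega) hsidepos
    rw [← h1] at h3
    have h4 : index N ω p' h = index N ω p h := h3.1
    have h5 : offset N ω p' h = offset N ω p h - d := h3.2
    have h6 : index N ω p' g = index N ω p g := by rw [index, h2]; rfl
    have h7 : offset N ω p' g = offset N ω p g := by rw [offset, h2]; rfl
    refine ⟨?_, ?_, ?_⟩
    · rw [tile_eq, tile_eq]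
      revert h4 h6
      rw [hgo]
      cases h <;> intro h4 h6 <;> exact Prod.ext (by assumption) (by assumption)
    · unfold Late; rw [h7]
    · unfold Late; rw [h5]; omega
  let U : Finset ℕ := (Finset.range (half N h)).biUnion fun d => (G d).image Packet.id
  have hUcard : half N h * N.cap g ≤ U.card := by
    -- A packet granted its turn at the earlier vertex `d2` has increased its `g`-coordinate, which
    -- is constant along the line of `p`. It cannot be on that line again at `d1`.
    have hdisj : ∀ d1 < half N h, ∀ d2 < half N h, d1 < d2 → ∀ p1 ∈ G d1, ∀ p2 ∈ G d2,
        p1.id ≠ p2.id := by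
      intro d1 hd1 d2 hd2 hlt p1 hp1 p2 hp2 hid
      obtain ⟨-, -, e1⟩ := hback d1 hd1 p1 hp1
      obtain ⟨-, -, e2⟩ := hback d2 hd2 p2 hp2
      obtain ⟨a1, -, -, -, -⟩ := mem_grantedAt.1 hp1
      obtain ⟨b1, b2, -, -, b5⟩ := mem_grantedAt.1 hp2
      have hT := (hG d2 hd2).1
      obtain ⟨p2', c1, c2, -, c4⟩ := exists_later (T := T - d2) (T' := T - d1) (by omega) b1
      have hp12 : p2' = p1 := mid_id_inj c1 a1 ((static_id c2).trans hid.symm)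
      subst hp12
      have c5 := (c4 (by omega)).sublist.count_le g
      rw [advance_eq_extend b2, b5] at c5
      simp only [Packet.extend, List.count_append, List.count_singleton_self] at c5
      rw [coord_eq, c2] at e1
      rw [coord_eq] at e2
      omega
    rw [Finset.card_biUnion]
    · calc half N h * N.cap g = ∑ _d ∈ Finset.range (half N h), N.cap g := by simp
        _ ≤ _ := by
          apply Finset.sum_le_sum
          intro d hd
          rw [Finset.mem_range] at hd
          rw [Finset.card_image_of_injOn]
          · exact (hG d hd).2.2
          · intro p1 hp1 p2 hp2 hid
            exact mid_id_inj (mem_grantedAt.1 hp1).1 (mem_grantedAt.1 hp2).1 hid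
    · intro d1 hd1 d2 hd2 hne'
      rw [Finset.coe_range, Set.mem_Iio] at hd1 hd2
      change Disjoint ((G d1).image Packet.id) ((G d2).image Packet.id)
      rw [Finset.disjoint_left]
      intro i hi1 hi2
      obtain ⟨p1, hp1, rfl⟩ := Finset.mem_image.1 hi1
      obtain ⟨p2, hp2, hid⟩ := Finset.mem_image.1 hi2
      rcases lt_or_gt_of_ne hne' with hlt | hlt
      · exact hdisj d1 hd1 d2 hd2 hlt p1 hp1 p2 hp2 hid.symm
      · exact hdisj d2 hd2 d1 hd1 hlt p2 hp2 p1 hp1 hid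
  have hUmem : ∀ i ∈ U, ∃ p'' ∈ (mid N lightest ω σ T).packets, p''.id = i ∧
      ((¬ Late N ω p g ∧ (sourceTile N ω p''.req = tile N ω p ∨ (prevTile (tile N ω p) g, g) ∈
          sketchEdges (sourceTile N ω p''.req) p''.sketch)) ∨
      (Late N ω p g ∧ ((tile N ω p, g) ∈ sketchEdges (sourceTile N ω p''.req) p''.sketch ∨
        (prevTile (tile N ω p) g, g) ∈ sketchEdges (sourceTile N ω p''.req) p''.sketch))) := by
    intro i hi
    obtain ⟨d, hd, hi⟩ := Finset.mem_biUnion.1 hi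
    rw [Finset.mem_range] at hd
    obtain ⟨p', hp', rfl⟩ := Finset.mem_image.1 hi
    obtain ⟨a1, a2, -, a4, -⟩ := mem_grantedAt.1 hp'
    obtain ⟨b1, b2, b3⟩ := hsame d hd p' hp'
    obtain ⟨p'', c1, c2, -, -⟩ := exists_later (T := T - d) (T' := T) (by omega) a1
    refine ⟨p'', c1, static_id c2, ?_⟩
    have hl := (legal_of_mem_mid hN horacle hfar a1).2.2.2
    have := ((hJ (T - d) (by omega)).onSketch p' a1 a2).origin hl
      (by rw [a4, hgo, other_other]; exact b3)
    rw [a4, b1, b2] at this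
    rw [static_req c2, static_sketch c2]
    exact this
  -- Which of the two pairs of budgets applies depends only on the quadrant of `p`. The resulting
  -- bound of less than `c^S / 2` contradicts `hUcard` and `cS_le_half`.
  have hfin : 4 * U.card < 2 * N.cS := by
    refine four_mul_card_lt (farAdmitted_mid hN horacle hfar σ T) (s := tile N ω p) (g := g)
      (tile N ω p, g) ?_
    by_cases hl : Late N ω p g
    · right
      intro i hi
      obtain ⟨p'', h1, h2, h3⟩ := hUmem i hi
      exact ⟨p'', h1, h2, by tauto⟩
    · left
      intro i hi
      obtain ⟨p'', h1, h2, h3⟩ := hUmem i hi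
      exact ⟨p'', h1, h2, by tauto⟩
  have := cS_le_half (N := N) h
  rw [← hgo] at this
  omega

theorem OnSketch.progress_eq {p : Packet N.n} (h : OnSketch N ω p) :
    ((tile N ω p).1 - (sourceTile N ω p.req).1) + ((tile N ω p).2 - (sourceTile N ω p.req).2) =
      (progress N ω p : ℤ) := by
  have h1 := count_forward_add_count_hold (p.sketch.take (progress N ω p))
  rw [List.length_take, min_eq_left h.le_length] at h1
  conv_lhs => rw [h.tile_eq]
  simp only [walk]
  omega

include hN horacle hfar in
/-- A packet leaves its tile along its sketch path. -/
theorem exit_along_sketch {T : ℕ} (hJ : ∀ T' ≤ T, RoutingInvariant N lightest ω σ T')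
    {p : Packet N.n} (hp : p ∈ (mid N lightest ω σ T).packets) (ha : ¬ p.Arrived) {m : Move}
    (hm : decideMove N ω (mid N lightest ω σ T).packets p = m)
    (hoff : offset N ω p m + 1 = side N m)
    (ht : tile N ω (p.extend m) = nextTile (tile N ω p) m) :
    ¬ InLastRow N ω p ∧ (∀ m', Late N ω p m') ∧ p.sketch[progress N ω p]? = some m := by
  have hS := (hJ T le_rfl).onSketch p hp ha
  have hl := (legal_of_mem_mid hN horacle hfar hp).2.2.2
  -- A move other than the goal is a straight one after a refusal, and such a move never leads out
  -- of the tile.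
  have hmg : m = goal N ω p := by
    by_contra hne
    have hmh : m = p.heading := by
      rcases decideMove_cases (mid N lightest ω σ T).packets p with h | h
      · exact absurd (hm.symm.trans h) hne
      · exact hm.symm.trans h
    refine not_exit_straight hN horacle hfar hJ hp ha (by rw [hm]; exact hne) ?_
    rw [← hmh]; exact hoff
  -- In the last row the move would be north, but the destination lies in this row and has not been
  -- passed.
  have hlast : ¬ InLastRow N ω p := by
    intro hlast
    rw [goal_lastRow hlast] at hmg
    subst hmg
    have h1 : (p.extend .forward).node ≤ p.req.dst := by
      rw [node_extend, if_pos rfl]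
      exact Nat.lt_of_le_of_ne hS.node_le ha
    have h2 := tileRow_mono N ω (show ((p.extend .forward).node : ℤ) ≤ (p.req.dst : ℕ) by
      exact_mod_cast h1)
    have h3 : (tile N ω (p.extend .forward)).1 ≤ tileRow N ω (p.req.dst : ℕ) := h2
    rw [ht, ← hlast] at h3
    simp [nextTile] at h3
  have hlm : Late N ω p m := by
    have := side_eq (N := N) m
    have := half_pos hN m
    unfold Late; omega
  -- In a mixed quadrant the goal would be the direction in which the packet is still early, and
  -- this is not `m`.
  have hlo : Late N ω p m.other := by
    by_contra hno
    have := goal_mixed hlast hno (by rw [other_other]; exact hlm)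
    rw [← hmg] at this
    exact other_ne m this.symm
  have hall : ∀ m', Late N ω p m' := by
    intro m'
    by_cases e : m' = m
    · rwa [e]
    · rwa [Move.eq_other_iff.2 e]
  refine ⟨hlast, hall, ?_⟩
  have hlt : progress N ω p < p.sketch.length :=
    lt_of_le_of_ne hS.le_length (mt (hS.lastRow_iff hl).2 hlast)
  rw [goal_northEast hlast (hall _) (hall _), List.getD_eq_getElem?_getD,
    List.getElem?_eq_getElem hlt] at hmg
  rw [List.getElem?_eq_getElem hlt, hmg]
  rfl

theorem progress_congr {p p' : Packet N.n} (hs : p'.static = p.static)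
    (ht : tile N ω p' = tile N ω p) : progress N ω p' = progress N ω p := by
  unfold progress; rw [ht, static_req hs]

theorem late_extend_of_ne (p : Packet N.n) {m m' : Move} (h : m' ≠ m) :
    Late N ω (p.extend m) m' ↔ Late N ω p m' := by
  unfold Late; rw [offset_extend_other p h]

include hN horacle hfar in
-- A tile is left only from its NE-quadrant and along the next sketch edge. Crossing in direction
-- `m` leads into the half that is early in `m` while the other coordinate stays late. Hence the
-- last sketch step explains every later visit to a mixed quadrant, and no SW-quadrant except that
-- of the source is ever visited.
theorem OnSketch.step {T : ℕ} (hJ : ∀ T' ≤ T, RoutingInvariant N lightest ω σ T')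
    {p : Packet N.n} (hp : p ∈ (mid N lightest ω σ T).packets) (ha : ¬ p.Arrived) {m : Move}
    (hm : decideMove N ω (mid N lightest ω σ T).packets p = m) : OnSketch N ω (p.extend m) := by
  have hS := (hJ T le_rfl).onSketch p hp ha
  have hl := (legal_of_mem_mid hN horacle hfar hp).2.2.2
  have hnode : (p.extend m).node ≤ p.req.dst := by
    rw [node_extend]
    have : p.node < p.req.dst := Nat.lt_of_le_of_ne hS.node_le ha
    split_ifs <;> omega
  have hsw : ¬ Late N ω p .forward → ¬ Late N ω p .hold → m = p.start := by
    intro h1 h2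
    have hlast : ¬ InLastRow N ω p := fun h => h2 (hS.lastRow h).2
    have h3 := decideMove_of_straight (ps := (mid N lightest ω σ T).packets)
      (goal_southWest hlast h1 h2)
    rw [hm] at h3
    rw [h3]
    unfold Packet.heading
    cases hml : p.moves.getLast? with
    | none => rfl
    | some m' => exact (hS.southWest h1 h2).2 m' (List.mem_of_getLast? hml)
  rcases extend_cases (ω := ω) hN p m with ⟨h1, h2, h3⟩ | ⟨h1, h2, h3⟩
  · have hpr : progress N ω (p.extend m) = progress N ω p := progress_congr rfl h2
    have hlate : ∀ m', Late N ω p m' → Late N ω (p.extend m) m' := by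
      intro m' h
      by_cases e : m' = m
      · subst e
        unfold Late at h ⊢; omega
      · exact (late_extend_of_ne p e).2 h
    refine ⟨by rw [hpr]; exact hS.le_length, by rw [hpr, h2]; exact hS.tile_eq, ?_, ?_, ?_, hnode⟩
    · intro h4 h5
      have h6 := mt (hlate _) h4
      have h7 := mt (hlate _) h5
      rw [hpr]
      refine ⟨(hS.southWest h6 h7).1, ?_⟩
      intro m' hm'
      rcases List.mem_append.1 hm' with hm' | hm'
      · exact (hS.southWest h6 h7).2 m' hm'
      · rw [List.mem_singleton.1 hm']; exact hsw h6 h7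
    · intro m' h4 _
      rw [hpr]
      have h6 := mt (hlate _) h4
      by_cases h7 : Late N ω p m'.other
      · exact hS.mixed m' h6 h7
      · left
        cases m'
        · exact (hS.southWest h6 h7).1
        · exact (hS.southWest h7 h6).1
    · intro hlast
      have hlast' : InLastRow N ω p := by
        unfold InLastRow at hlast ⊢; rw [h2] at hlast; exact hlast
      have h4 := hS.lastRow hlast'
      have h5 := decideMove_of_straight (ps := (mid N lightest ω σ T).packets)
        ((goal_lastRow hlast').trans h4.1.symm)
      rw [heading_extend]
      exact ⟨by rw [← hm, h5, h4.1], hlate _ h4.2⟩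
  · obtain ⟨h4, h5, h6⟩ := exit_along_sketch hN horacle hfar hJ hp ha hm h1 h2
    have hpr : progress N ω (p.extend m) = progress N ω p + 1 := by
      have h7 := hS.progress_eq
      unfold progress at h7 ⊢
      rw [h2]
      have h8 : (p.extend m).req = p.req := rfl
      rw [h8]
      cases m <;> simp only [nextTile] <;> omega
    have hnl : ¬ Late N ω (p.extend m) m := by
      unfold Late; rw [h3]; have := half_pos hN m; omega
    have hlo : ∀ m', m' ≠ m → Late N ω (p.extend m) m' := fun m' e =>
      (late_extend_of_ne p e).2 (h5 m')
    have hlt : progress N ω p < p.sketch.length := by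
      by_contra h
      rw [List.getElem?_eq_none (not_lt.1 h)] at h6
      cases h6
    refine ⟨?_, ?_, ?_, ?_, ?_, hnode⟩
    · rw [hpr]; exact hlt
    · rw [hpr, h2, hS.tile_eq]
      have : (p.extend m).sketch.take (progress N ω p + 1) =
          p.sketch.take (progress N ω p) ++ [m] := by
        change p.sketch.take _ = _
        rw [List.take_add_one, h6]; rfl
      rw [this, walk_append_singleton]; rfl
    · intro h7 h8
      cases m
      · exact absurd (hlo .hold (by simp)) h8
      · exact absurd (hlo .forward (by simp)) h7
    · intro m' h7 _
      right
      have : m' = m := by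
        by_contra e; exact h7 (hlo m' e)
      rw [hpr, this, Nat.add_sub_cancel]
      exact h6
    · intro hlast
      rw [heading_extend]
      cases m
      · exact ⟨rfl, hlo _ (by simp)⟩
      · exfalso
        apply h4
        unfold InLastRow at hlast ⊢
        rw [h2] at hlast
        exact hlast

include hN in
-- A packet that still wants to turn has just been refused, which gives the case `d = 1`; the
-- remaining cases are the previous invariant shifted by one time step. Upon entering a new tile the
-- offset is `0` and nothing is claimed.
theorem Blocked.step {T : ℕ} (hJ : ∀ T' ≤ T, RoutingInvariant N lightest ω σ T')
    {p : Packet N.n} (hp : p ∈ (mid N lightest ω σ T).packets) (ha : ¬ p.Arrived) {m : Move}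
    (hm : decideMove N ω (mid N lightest ω σ T).packets p = m) :
    Blocked N lightest ω σ (T + 1) (p.extend m) := by
  intro hgoal d hd hoff
  rw [heading_extend] at hgoal hoff ⊢
  have hhalf := half_pos hN m
  rcases extend_cases (ω := ω) hN p m with ⟨h1, h2, h3⟩ | ⟨h1, h2, h3⟩
  · have hlm : Late N ω p m := by unfold Late; omega
    have hgc : goal N ω (p.extend m) = goal N ω p := by
      refine goal_congr rfl h2 ?_ hlm
      intro m'
      by_cases e : m' = m
      · subst e; unfold Late; unfold Late at hlm; omega
      · exact late_extend_of_ne p e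
    rw [hgc] at hgoal ⊢
    have hmh : p.heading = m := by
      rcases decideMove_cases (mid N lightest ω σ T).packets p with h | h
      · exact absurd (h.symm.trans hm) hgoal
      · exact h.symm.trans hm
    rw [node_extend]
    rcases hd.eq_or_lt with rfl | hd1
    · refine ⟨by omega, ?_, ?_⟩
      · intro e; rw [if_pos e]; omega
      · rw [Nat.add_sub_cancel, Nat.add_sub_cancel]
        exact cap_le_card_grantedAt hp ha (by rw [hm]; exact hgoal.symm)
    · obtain ⟨a1, a2, a3⟩ := (hJ T le_rfl).blocked p hp ha (by rw [hmh]; exact hgoal) (d - 1)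
        (by omega) (by rw [hmh]; omega)
      rw [hmh] at a2 a3
      refine ⟨by omega, ?_, ?_⟩
      · intro e; rw [if_pos e]; have := a2 e; omega
      · have e1 : T + 1 - d = T - (d - 1) := by omega
        have e2 : (p.node + if m = .forward then 1 else 0) - (if m = .forward then d else 0) =
            p.node - if m = .forward then d - 1 else 0 := by
          split_ifs <;> omega
        rw [e1, e2]
        exact a3
  · omega

include hN horacle hfar in
/-- The invariants hold for a packet when it is injected. -/
theorem invariant_new {T : ℕ} {p : Packet N.n} (hp : p ∈ (mid N lightest ω σ T).packets)
    (hm : p.moves = []) : OnSketch N ω p ∧ Blocked N lightest ω σ T p ∧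
      ¬ Late N ω p .forward ∧ ¬ Late N ω p .hold := by
  have hl := legal_of_mem_mid hN horacle hfar hp
  have hst : p.static = p := by unfold Packet.static; rw [← hm]
  have ht : tile N ω p = sourceTile N ω p.req := by rw [← tile_static, hst]
  have hnode : p.node = p.req.src := by simp [Packet.node, hm, Request.nodeAfter]
  have hnow : p.now = p.req.time := by simp [Packet.now, hm]
  have h1 : ¬ Late N ω p .forward := by
    rw [← inSouth_iff, hnode]; exact hl.1.2.1
  have h2 : ¬ Late N ω p .hold := by
    rw [← inWest_iff, hnode, hnow]; exact hl.1.2.2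
  have hpr : progress N ω p = 0 := by unfold progress; rw [ht]; simp
  have hlast : ¬ InLastRow N ω p := by
    unfold InLastRow; rw [ht]; exact (sourceTile_row_lt hl.1.1).ne
  refine ⟨⟨by rw [hpr]; exact Nat.zero_le _, by rw [hpr, ht]; simp, ?_, ?_, fun h => absurd h hlast,
    by rw [hnode]; exact p.req.src_le_dst⟩, ?_, h1, h2⟩
  · intro _ _; exact ⟨hpr, by rw [hm]; simp⟩
  · intro m _ h
    cases m
    · exact absurd h h2
    · exact absurd h h1
  · intro h; exact absurd (goal_southWest hlast h1 h2) h

/-- All packets at the same vertex are in the same quadrant. -/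
theorem late_congr {T v : ℕ} {p p' : Packet N.n} (hp : p ∈ present N lightest ω σ T v)
    (hp' : p' ∈ present N lightest ω σ T v) (m : Move) :
    tile N ω p = tile N ω p' ∧ (Late N ω p m ↔ Late N ω p' m) := by
  obtain ⟨h1, h2, h3⟩ := mem_present.1 hp
  obtain ⟨h1', h2', h3'⟩ := mem_present.1 hp'
  have hc : coord N ω p = coord N ω p' := by
    funext m
    cases m <;> simp [coord, h3, h3', now_eq h1 h2, now_eq h1' h2']
  unfold Late offset tile
  rw [h3, h3', now_eq h1 h2, now_eq h1' h2', hc]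
  exact ⟨rfl, Iff.rfl⟩

include hN horacle hfar in
open Classical in
/-- In a SW-quadrant, the packets with the same heading at the same vertex are in different
planes. -/
theorem card_heading_southWest {T v : ℕ} (m : Move)
    (hS : ∀ p ∈ (mid N lightest ω σ T).packets, ¬ p.Arrived → OnSketch N ω p)
    (hsw : ∀ p ∈ present N lightest ω σ T v, ¬ Late N ω p .forward ∧ ¬ Late N ω p .hold) :
    ((present N lightest ω σ T v).filter fun p => p.heading = m).card ≤ N.cap m := by
  have hinfo : ∀ p ∈ (present N lightest ω σ T v).filter fun p => p.heading = m,
      p ∈ (mid N lightest ω σ T).packets ∧ p.node = v ∧ p.now = T ∧ m = planeDir N p.plane ∧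
      tile N ω p = sourceTile N ω p.req ∧ p.plane < N.B + N.c ∧ p.moves.count m.other = 0 := by
    intro p hp
    rw [Finset.mem_filter] at hp
    obtain ⟨hp, hhead⟩ := hp
    obtain ⟨h1, h2, h3⟩ := mem_present.1 hp
    have hl := legal_of_mem_mid hN horacle hfar h1
    have h4 := hS p h1 h2
    obtain ⟨h5, h6⟩ := h4.southWest (hsw p hp).1 (hsw p hp).2
    have hstart : m = p.start := by
      rw [← hhead]
      unfold Packet.heading
      cases hml : p.moves.getLast? with
      | none => rfl
      | some m' => exact h6 m' (List.mem_of_getLast? hml)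
    refine ⟨h1, h3, now_eq h1 h2, hstart.trans hl.2.1, ?_, hl.2.2.1, ?_⟩
    · rw [h4.tile_eq, h5]; simp
    · rw [List.count_eq_zero]
      intro h
      exact other_ne m ((h6 _ h).trans hstart.symm)
  -- Two packets of one plane that have come straight in direction `m` to the same vertex must have
  -- started in the same row or column, which the injection test forbids.
  have hinj : Set.InjOn Packet.plane
      (((present N lightest ω σ T v).filter fun p => p.heading = m : Finset (Packet N.n)) :
        Set (Packet N.n)) := by
    intro p hp p' hp' hpl
    obtain ⟨h1, h2, h3, h4, h5, -, h7⟩ := hinfo p hp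
    obtain ⟨h1', h2', h3', h4', h5', -, h7'⟩ := hinfo p' hp'
    by_contra hne
    -- Both orders are needed because the pairwise condition on the list only speaks about the order
    -- of injection.
    have hc : Conflict N ω p p' ∧ Conflict N ω p' p := by
      have ht := (late_congr (Finset.mem_filter.1 hp).1 (Finset.mem_filter.1 hp').1 m).1
      rw [h5, h5'] at ht
      have c1 := count_forward_add_count_hold p.moves
      have c2 := count_forward_add_count_hold p'.moves
      unfold Conflict
      rw [← h4, ← h4', ht, hpl]
      unfold Packet.now at h3 h3'
      unfold Packet.node Request.nodeAfter at h2 h2'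
      cases m
      · simp only [Move.other] at h7 h7'
        refine ⟨⟨rfl, rfl, ?_⟩, ⟨rfl, rfl, ?_⟩⟩ <;> dsimp only <;> omega
      · simp only [Move.other] at h7 h7'
        refine ⟨⟨rfl, rfl, ?_⟩, ⟨rfl, rfl, ?_⟩⟩ <;> dsimp only <;> apply Fin.ext <;> omega
    have hpw := (farAdmitted_mid hN horacle hfar σ T).conflict
    have := List.Pairwise.forall_of_forall_of_flip (R := fun p p' : Packet N.n =>
      ¬ (Conflict N ω p p' ∧ Conflict N ω p' p) ∨ p = p') (l := (mid N lightest ω σ T).packets)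
      (fun x _ => Or.inr rfl) (hpw.imp fun h => Or.inl fun h' => h h'.1)
      (hpw.imp fun h => Or.inl fun h' => h h'.2) h1 h1'
    rcases this with h | h
    · exact h hc
    · exact hne h
  -- There are `c` vertical planes, `B ≤ i < B + c`, and `B` horizontal ones.
  cases m
  · calc _ ≤ (Finset.Ico N.B (N.B + N.c)).card := by
          refine Finset.card_le_card_of_injOn Packet.plane ?_ hinj
          intro p hp
          obtain ⟨-, -, -, h4, -, h6, -⟩ := hinfo p hp
          unfold planeDir at h4
          split_ifs at h4 with h
          simp; omega
      _ = N.c := by simp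
  · calc _ ≤ (Finset.range N.B).card := by
          refine Finset.card_le_card_of_injOn Packet.plane ?_ hinj
          intro p hp
          obtain ⟨-, -, -, h4, -, h6, -⟩ := hinfo p hp
          unfold planeDir at h4
          split_ifs at h4 with h
          simp; omega
      _ = N.B := by simp

include hN horacle hfar in
-- Strong induction is needed since the turning argument looks back at all time steps that a packet
-- has spent in its quadrant. The bound on headings closes the loop: it is the hypothesis of the
-- conflict resolution, whose conclusion bounds the packets that arrive over each edge in the next
-- step.
theorem routingInvariant (T : ℕ) : RoutingInvariant N lightest ω σ T := by
  classical
  induction T using Nat.strong_induction_on with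
  | _ T ih =>
  have hJ : ∀ T0, T = T0 + 1 → ∀ T' ≤ T0, RoutingInvariant N lightest ω σ T' := by
    intro T0 h T' hT'; exact ih T' (by omega)
  -- an old packet in the network stems from a packet that moved in the previous step
  have hold : ∀ p ∈ (mid N lightest ω σ T).packets, ¬ p.Arrived → p.moves = [] ∨
      ∃ T0, T = T0 + 1 ∧ ∃ p0 ∈ (mid N lightest ω σ T0).packets, ¬ p0.Arrived ∧
        p = p0.extend (decideMove N ω (mid N lightest ω σ T0).packets p0) := by
    intro p hp ha
    rcases mem_mid hp with h | h
    · right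
      cases T with
      | zero => simp [run, State.init] at h
      | succ T0 =>
        obtain ⟨p0, hp0, rfl⟩ := mem_run_succ.1 h
        have ha0 : ¬ p0.Arrived := by
          intro h0; rw [advance_of_arrived h0] at ha; exact ha h0
        exact ⟨T0, rfl, p0, hp0, ha0, advance_eq_extend ha0⟩
    · exact Or.inl h.1
  have hS : ∀ p ∈ (mid N lightest ω σ T).packets, ¬ p.Arrived → OnSketch N ω p := by
    intro p hp ha
    rcases hold p hp ha with h | ⟨T0, hT, p0, hp0, ha0, rfl⟩
    · exact (invariant_new hN horacle hfar hp h).1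
    · exact OnSketch.step hN horacle hfar (hJ T0 hT) hp0 ha0 rfl
  refine ⟨hS, ?_, ?_⟩
  · intro p hp ha
    rcases hold p hp ha with h | ⟨T0, rfl, p0, hp0, ha0, rfl⟩
    · exact (invariant_new hN horacle hfar hp h).2.1
    · exact Blocked.step hN (hJ T0 rfl) hp0 ha0 rfl
  · intro v m
    -- All packets at one vertex are in the same quadrant. Outside the SW-quadrants none of them is
    -- new, so those with heading `m` have all just used one and the same edge.
    by_cases hsw : ∀ p ∈ present N lightest ω σ T v, ¬ Late N ω p .forward ∧ ¬ Late N ω p .hold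
    · exact card_heading_southWest hN horacle hfar m hS hsw
    push Not at hsw
    obtain ⟨p1, hp1, hp1l⟩ := hsw
    have hne : ∀ p ∈ present N lightest ω σ T v, p.moves ≠ [] := by
      intro p hp hm
      have h1 := (invariant_new hN horacle hfar (mem_present.1 hp).1 hm).2.2
      have h2 := fun m => (late_congr hp hp1 m).2
      rw [h2, h2] at h1
      exact h1.2 (hp1l h1.1)
    obtain ⟨T0, hT, -⟩ := (hold p1 (mem_present.1 hp1).1 (mem_present.1 hp1).2.1).resolve_left
      (hne p1 hp1)
    subst hT
    refine le_trans ?_ ((hJ T0 rfl T0 le_rfl).movers_le (v - if m = .forward then 1 else 0) m)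
    refine (Finset.card_le_card (t := (movers N ω (mid N lightest ω σ T0).packets
      (v - if m = .forward then 1 else 0) m).image fun p => p.extend m) ?_).trans
      Finset.card_image_le
    intro p hp
    rw [Finset.mem_filter] at hp
    obtain ⟨hp, hhead⟩ := hp
    obtain ⟨h1, h2, h3⟩ := mem_present.1 hp
    obtain ⟨T0', hT', p0, hp0, ha0, rfl⟩ := (hold p h1 h2).resolve_left (hne p hp)
    obtain rfl : T0 = T0' := by omega
    rw [heading_extend] at hhead
    rw [hhead] at h3 ⊢
    refine Finset.mem_image.2 ⟨p0, ?_, rfl⟩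
    simp only [movers, Finset.mem_filter, List.mem_toFinset]
    refine ⟨hp0, ha0, ?_, hhead⟩
    rw [node_extend] at h3
    omega

include hN horacle hfar in
/-- Every injected packet reaches its destination. -/
theorem far_delivered {T : ℕ} {p : Packet N.n} (hp : p ∈ (mid N lightest ω σ T).packets) :
    ∃ T', ∃ p' ∈ (run N lightest ω σ T').packets, p'.id = p.id ∧ p'.Arrived := by
  -- A packet makes fewer than `n` forward moves, and its column of tiles never exceeds that of the
  -- source by more than the length of the sketch path. This bounds the hold moves by the second
  -- summand.
  set K : ℕ := N.n + (side N .hold * ((sourceTile N ω p.req).2 + p.sketch.length + 1) -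
    coord N ω p.static .hold).toNat with hK
  obtain ⟨p', h1, h2, -, -⟩ := exists_later (T := T) (T' := T + K + 1) (by omega) hp
  have ha : p'.Arrived := by
    by_contra ha
    have hS := (routingInvariant hN horacle hfar _).onSketch p' h1 ha
    have hnow := now_eq h1 ha
    have htime := (mem_mid_time hp).2
    have hsum := count_forward_add_count_hold p'.moves
    have hnode := hS.node_le
    have hdst := p'.req.dst.2
    have hc := coord_eq (ω := ω) p' .hold
    have hidx : index N ω p' .hold = (tile N ω p').2 := rfl
    rw [hS.tile_eq] at hidx
    simp only [walk] at hidx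
    have hcnt : (p'.sketch.take (progress N ω p')).count .hold ≤ p'.sketch.length :=
      (List.take_sublist _ _).count_le _ |>.trans List.count_le_length
    have hpos : (0 : ℤ) < side N .hold := by
      have := half_pos hN .hold
      rw [side_eq]; omega
    have hlt : coord N ω p' .hold < side N .hold * (index N ω p' .hold + 1) := by
      have e1 := Int.emod_lt_of_pos (coord N ω p' .hold) hpos
      have e2 := Int.mul_ediv_add_emod (coord N ω p' .hold) (side N .hold)
      unfold index
      linarith
    have hle : (side N .hold : ℤ) * (index N ω p' .hold + 1) ≤
        side N .hold * ((sourceTile N ω p.req).2 + p.sketch.length + 1) := by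
      apply mul_le_mul_of_nonneg_left _ hpos.le
      rw [hidx, static_req h2, ← static_sketch h2]
      omega
    rw [h2] at hc
    unfold Packet.now at hnow
    unfold Packet.node Request.nodeAfter at hnode
    rw [static_req h2] at hnow
    omega
  refine ⟨T + K + 1 + 1, p', mem_run_succ.2 ⟨p', h1, advance_of_arrived ha⟩, static_id h2, ha⟩

end Detailed

/-! ### The class of near requests -/

section Near

variable {N : LineNetwork} {ω : Coins} {lightest : Oracle} {σ : List (Request N.n)}

/-- The column of the source vertex of a request. -/
def Request.column {n : ℕ} (q : Request n) : ℤ := (q.time : ℤ) - (q.src : ℕ)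

/-- The vertical path of the request uses the link that leaves `v`. -/
def Request.Spans {n : ℕ} (q : Request n) (v : Fin n) : Prop := q.src ≤ v ∧ v < q.dst

open Classical in
/-- The number of packets in column `x` that use the link that leaves `v`. -/
noncomputable def columnLoad {n : ℕ} (ps : List (Packet n)) (x : ℤ) (v : Fin n) : ℕ :=
  (ps.filter fun p => p.req.column = x ∧ p.req.src ≤ v ∧ v < p.req.dst).length

/-- The properties that the admission control guarantees for the class of near requests, when the
requests `pre` have been handled. -/
structure NearAdmitted (N : LineNetwork) (ω : Coins) (pre : List (Request N.n × ℕ))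
    (ps : List (Packet N.n)) : Prop where
  packet : ∀ p ∈ ps, IsNear N ω p.req ∧ p.start = .forward
  load : ∀ x v, columnLoad ps x v ≤ N.c
  complete : ∀ q ∈ pre, IsNear N ω q.1 → (∃ p ∈ ps, p.id = q.2) ∨
    ∃ v, q.1.Spans v ∧ N.c ≤ columnLoad ps q.1.column v

theorem columnLoad_movePackets (ps : List (Packet N.n)) (x : ℤ) (v : Fin N.n) :
    columnLoad (movePackets N ω ps) x v = columnLoad ps x v :=
  filter_movePackets _ (fun _ => rfl)

theorem columnLoad_append (ps : List (Packet N.n)) (p : Packet N.n) (x : ℤ) (v : Fin N.n) :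
    columnLoad ps x v ≤ columnLoad (ps ++ [p]) x v := by
  unfold columnLoad
  rw [List.filter_append, List.length_append]
  omega

theorem nearAdmitted (hnear : ω.far = false) (T : ℕ) :
    NearAdmitted N ω (handled σ (T + 1)) (mid N lightest ω σ T).packets := by
  classical
  refine (mid_induction (N := N) (ω := ω) (lightest := lightest) (σ := σ)
    (fun pre S => NearAdmitted N ω pre S.packets) ⟨by simp [State.init],
      by simp [State.init, columnLoad], by simp⟩ ?_ ?_ T).2
  · intro T pre q S _ _ h
    unfold handleRequest
    rw [if_neg (by simp [hnear])]
    unfold handleNear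
    split_ifs with hq
    · refine ⟨?_, ?_, ?_⟩
      · intro p hp
        rcases List.mem_append.1 hp with hp | hp
        · exact h.packet p hp
        · rw [List.mem_singleton.1 hp]; exact ⟨hq.1, rfl⟩
      · intro x v
        have h1 := h.load x v
        unfold columnLoad at h1 ⊢
        rw [List.filter_append, List.length_append, List.filter_singleton]
        by_cases hx : q.1.column = x ∧ q.1.src ≤ v ∧ v < q.1.dst
        · have h2 := hq.2 v hx.2.1 hx.2.2
          obtain ⟨rfl, h3⟩ := hx
          have h4 : (decide (q.1.column = q.1.column ∧ q.1.src ≤ v ∧ v < q.1.dst)) = true := by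
            simpa using h3
          rw [h4]
          exact h2
        · have h4 : (decide (q.1.column = x ∧ q.1.src ≤ v ∧ v < q.1.dst)) = false := by
            simpa using hx
          rw [h4]
          exact h1
      · intro q' hq' hn
        rcases List.mem_append.1 hq' with hq' | hq'
        · rcases h.complete q' hq' hn with ⟨p, hp, hid⟩ | ⟨v, hv, hc⟩
          · exact Or.inl ⟨p, List.mem_append_left _ hp, hid⟩
          · exact Or.inr ⟨v, hv, hc.trans (columnLoad_append _ _ _ _)⟩
        · rw [List.mem_singleton.1 hq']
          exact Or.inl ⟨_, List.mem_append_right _ (List.mem_singleton_self _), rfl⟩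
    · refine ⟨h.packet, h.load, ?_⟩
      intro q' hq' hn
      rcases List.mem_append.1 hq' with hq' | hq'
      · exact h.complete q' hq' hn
      · rw [List.mem_singleton] at hq'
        subst hq'
        right
        by_contra hno
        push Not at hno
        exact hq ⟨hn, fun v h1 h2 => hno v ⟨h1, h2⟩⟩
  · intro pre S h
    refine ⟨?_, ?_, ?_⟩
    · intro p hp
      obtain ⟨p', hp', rfl⟩ := List.mem_map.1 hp
      have hs := advance_static (ω := ω) S.packets p'
      have := h.packet p' hp'
      rw [← static_req hs, ← static_start hs] at this
      exact this
    · intro x v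
      dsimp only
      rw [columnLoad_movePackets]; exact h.load x v
    · intro q hq hn
      dsimp only
      rcases h.complete q hq hn with ⟨p, hp, hid⟩ | ⟨v, hv, hc⟩
      · exact Or.inl ⟨_, List.mem_map.2 ⟨p, hp, rfl⟩,
          (static_id (advance_static (ω := ω) S.packets p)).trans hid⟩
      · exact Or.inr ⟨v, hv, by rw [columnLoad_movePackets]; exact hc⟩

/-- A near packet always moves forward. -/
theorem near_forward (hnear : ω.far = false) {T : ℕ} {p : Packet N.n}
    (hp : p ∈ (mid N lightest ω σ T).packets) :
    p.node ≤ p.req.dst ∧ p.moves.count .hold = 0 ∧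
      decideMove N ω (mid N lightest ω σ T).packets p = .forward := by
  have key : ∀ T (p : Packet N.n), p ∈ (mid N lightest ω σ T).packets → p.node ≤ p.req.dst →
      p.moves.count .hold = 0 → decideMove N ω (mid N lightest ω σ T).packets p = .forward := by
    intro T p hp h1 h2
    have hpk := (nearAdmitted (lightest := lightest) (σ := σ) hnear T).packet p hp
    have hhead : p.heading = .forward := by
      unfold Packet.heading
      cases hml : p.moves.getLast? with
      | none => exact hpk.2
      | some m' =>
        cases m'
        · rfl
        · exact absurd (List.mem_of_getLast? hml) (List.count_eq_zero.1 h2)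
    -- Source and destination lie in the same row of tiles, so the packet is always in its last row.
    have hgoal : goal N ω p = .forward := by
      apply goal_lastRow
      have h3 : tileRow N ω p.node ≤ tileRow N ω (p.req.dst : ℕ) :=
        tileRow_mono N ω (by exact_mod_cast h1)
      have h4 : tileRow N ω (p.req.src : ℕ) ≤ tileRow N ω p.node :=
        tileRow_mono N ω (by unfold Packet.node Request.nodeAfter; push_cast; omega)
      have h5 : tileRow N ω (p.req.src : ℕ) = tileRow N ω (p.req.dst : ℕ) := hpk.1
      exact le_antisymm h3 (h5 ▸ h4)
    rw [decideMove_of_straight (hgoal.trans hhead.symm), hhead]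
  have hinv : p.node ≤ p.req.dst ∧ p.moves.count .hold = 0 := by
    have hnew : ∀ p : Packet N.n, p.moves = [] → p.node ≤ p.req.dst ∧ p.moves.count .hold = 0 := by
      intro p hm
      have := p.req.src_le_dst
      simp [Packet.node, Request.nodeAfter, hm]
      exact this
    induction T generalizing p with
    | zero =>
      rcases mem_mid hp with h | h
      · simp [run, State.init] at h
      · exact hnew p h.1
    | succ T ih =>
      rcases mem_mid hp with h | h
      · obtain ⟨p', hp', rfl⟩ := mem_run_succ.1 h
        have h1 := ih hp'
        by_cases ha : p'.Arrived
        · rw [advance_of_arrived ha]; exact h1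
        · rw [advance_eq_extend ha, key T p' hp' h1.1 h1.2]
          constructor
          · rw [node_extend, if_pos rfl]
            exact Nat.lt_of_le_of_ne h1.1 ha
          · simp [Packet.extend, h1.2]
      · exact hnew p h.1
  exact ⟨hinv.1, hinv.2, key T p hp hinv.1 hinv.2⟩

/-- Near packets never wait, so those crossing the link out of `v` at time `T` all started in the
column `T - v`, whose load the admission test bounds by `c`. -/
theorem near_movers_le (hnear : ω.far = false) (T v : ℕ) (m : Move) :
    (movers N ω (mid N lightest ω σ T).packets v m).card ≤ N.cap m := by
  classical
  rcases (movers N ω (mid N lightest ω σ T).packets v m).eq_empty_or_nonempty with he | ⟨p0, hp0⟩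
  · rw [he]; exact Nat.zero_le _
  have hinfo : ∀ p ∈ movers N ω (mid N lightest ω σ T).packets v m,
      p ∈ (mid N lightest ω σ T).packets ∧ m = .forward ∧ p.req.column = (T : ℤ) - v ∧
        p.req.src ≤ v ∧ v < p.req.dst := by
    intro p hp
    simp only [movers, Finset.mem_filter, List.mem_toFinset] at hp
    obtain ⟨h1, h2, h3, h4⟩ := hp
    obtain ⟨h5, h6, h7⟩ := near_forward hnear h1
    have hnow := now_eq h1 h2
    have hsum := count_forward_add_count_hold p.moves
    have hlt : p.node < p.req.dst := Nat.lt_of_le_of_ne h5 h2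
    refine ⟨h1, h4.symm.trans h7, ?_, ?_, h3 ▸ hlt⟩
    · unfold Packet.now at hnow
      unfold Packet.node Request.nodeAfter at h3
      unfold Request.column
      omega
    · unfold Packet.node Request.nodeAfter at h3
      omega
  have h0 := hinfo p0 hp0
  have hv : v < N.n := h0.2.2.2.2.trans p0.req.dst.2
  rw [h0.2.1]
  refine le_trans ?_ ((nearAdmitted (lightest := lightest) (σ := σ) hnear T).load (T - v) ⟨v, hv⟩)
  unfold columnLoad
  refine le_trans (Finset.card_le_card ?_) (List.toFinset_card_le _)
  intro p hp
  rw [← h0.2.1] at hp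
  have h1 := hinfo p hp
  simp only [List.mem_toFinset, List.mem_filter, decide_eq_true_eq]
  exact ⟨h1.1, h1.2.2⟩

theorem near_delivered (hnear : ω.far = false) {T : ℕ} {p : Packet N.n}
    (hp : p ∈ (mid N lightest ω σ T).packets) :
    ∃ T', ∃ p' ∈ (run N lightest ω σ T').packets, p'.id = p.id ∧ p'.Arrived := by
  obtain ⟨p', h1, h2, -, -⟩ := exists_later (T := T) (T' := T + N.n) (by omega) hp
  have ha : p'.Arrived := by
    by_contra ha
    have hnow := now_eq h1 ha
    have htime := (mem_mid_time hp).2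
    obtain ⟨h3, h4, -⟩ := near_forward hnear h1
    have hsum := count_forward_add_count_hold p'.moves
    have hdst := p'.req.dst.2
    unfold Packet.now at hnow
    unfold Packet.node Request.nodeAfter at h3
    rw [static_req h2] at hnow
    omega
  exact ⟨T + N.n + 1, p', mem_run_succ.2 ⟨p', h1, advance_of_arrived ha⟩, static_id h2, ha⟩

end Near

/-! ### Legality and delivery -/

section Legal

variable {N : LineNetwork} {lightest : Oracle}

theorem delivered_of_mem_mid (hN : N.Valid) (horacle : IsLightestPathOracle N lightest)
    (σ : List (Request N.n)) (ω : Coins) {T : ℕ} {p : Packet N.n}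
    (hp : p ∈ (mid N lightest ω σ T).packets) : p.id ∈ deliveredSet σ (alg N lightest ω σ) := by
  have key : ∃ T', ∃ p' ∈ (run N lightest ω σ T').packets, p'.id = p.id ∧ p'.Arrived := by
    cases hfar : ω.far
    · exact near_delivered hfar hp
    · exact far_delivered hN horacle hfar hp
  obtain ⟨T', p', hp', hid, ha⟩ := key
  rw [← hid]
  exact ⟨p'.req, T', p'.moves, (mem_run_time hp').1, alg_eq_some.2 ⟨p', hp', rfl, rfl⟩, ha⟩

theorem alg_legal (hN : N.Valid) (horacle : IsLightestPathOracle N lightest)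
    (σ : List (Request N.n)) (ω : Coins) :
    IsNonpreemptiveExecution N σ (alg N lightest ω σ) ∧
      ∀ T i, (alg N lightest ω σ T i).isSome → i ∈ deliveredSet σ (alg N lightest ω σ) := by
  constructor
  · apply isNonpreemptiveExecution
    cases hfar : ω.far
    · exact near_movers_le hfar
    · exact fun T => (routingInvariant hN horacle hfar T).movers_le
  · intro T i h
    obtain ⟨l, hl⟩ := Option.isSome_iff_exists.1 h
    obtain ⟨p, hp, rfl, -⟩ := alg_eq_some.1 hl
    exact delivered_of_mem_mid hN horacle σ ω (mem_mid_of_mem_run hp)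

theorem alg_online (σ σ' : List (Request N.n)) (ω : Coins) (T : ℕ)
    (h : ∀ (i : ℕ) (q : Request N.n), q.time < T → (σ[i]? = some q ↔ σ'[i]? = some q)) :
    ∀ T' ≤ T, alg N lightest ω σ T' = alg N lightest ω σ' T' := by
  intro T' hT'
  funext i
  unfold alg
  rw [run_congr N lightest ω h T' hT']

end Legal

/-! ### Optimal packings -/

section Optimum

variable {N : LineNetwork} {σ : List (Request N.n)}

/-- A packing that routes the requests in `O` along the paths `path`. -/
structure Packs (N : LineNetwork) (σ : List (Request N.n)) (O : Finset (Fin σ.length))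
    (path : Fin σ.length → List Move) : Prop where
  dst : ∀ i ∈ O, (σ.get i).nodeAfter (path i) = (σ.get i).dst
  cap : ∀ (m : Move) (v t : ℕ) (S : Finset (Fin σ.length)), S ⊆ O →
    (∀ i ∈ S, (σ.get i).Crosses (path i) m v t) → S.card ≤ N.cap m

theorem exists_optimal_packing (N : LineNetwork) (σ : List (Request N.n)) :
    ∃ O path, Packs N σ O path ∧ O.card = opt N σ := by
  classical
  have hlt : ∀ p, IsPacking N σ p → ∀ i l, p i = some l → i < σ.length := by
    intro p hp i l h
    obtain ⟨q, hq, -⟩ := hp.1 i l h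
    exact (List.getElem?_eq_some_iff.1 hq).1
  have hne : {k | ∃ p, IsPacking N σ p ∧ {i : ℕ | (p i).isSome}.ncard = k}.Nonempty := by
    refine ⟨_, fun _ => none, ⟨by simp, ?_⟩, rfl⟩
    intro m v t
    simp
  have hbdd : BddAbove {k | ∃ p, IsPacking N σ p ∧ {i : ℕ | (p i).isSome}.ncard = k} := by
    refine ⟨σ.length, ?_⟩
    rintro k ⟨p, hp, rfl⟩
    have : {i : ℕ | (p i).isSome} ⊆ (Finset.range σ.length : Set ℕ) := by
      intro i hi
      obtain ⟨l, hl⟩ := Option.isSome_iff_exists.1 hi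
      simpa using hlt p hp i l hl
    calc _ ≤ (Finset.range σ.length : Set ℕ).ncard :=
          Set.ncard_le_ncard this (Finset.finite_toSet _)
      _ = σ.length := by rw [Set.ncard_coe_finset, Finset.card_range]
  obtain ⟨p, hp, hk⟩ := Nat.sSup_mem hne hbdd
  change _ = opt N σ at hk
  refine ⟨Finset.univ.filter fun i => (p i).isSome, fun i => (p i).getD [], ⟨?_, ?_⟩, ?_⟩
  · intro i hi
    rw [Finset.mem_filter] at hi
    obtain ⟨l, hl⟩ := Option.isSome_iff_exists.1 hi.2
    obtain ⟨q, hq, h⟩ := hp.1 i l hl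
    rw [List.getElem?_eq_getElem i.2, Option.some.injEq] at hq
    subst hq
    rw [hl]; exact h
  · intro m v t S hS hcr
    refine le_trans ?_ (hp.2 m v t)
    rw [← Finset.card_image_of_injective S Fin.val_injective, ← Set.ncard_coe_finset]
    apply Set.ncard_le_ncard
    · intro j hj
      rw [Finset.coe_image] at hj
      obtain ⟨i, hi, rfl⟩ := hj
      have h1 := hS hi
      rw [Finset.mem_filter] at h1
      obtain ⟨l, hl⟩ := Option.isSome_iff_exists.1 h1.2
      have h2 := hcr i hi
      rw [hl] at h2
      exact ⟨σ.get i, l, by simp, hl, h2⟩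
    · refine (Finset.finite_toSet (Finset.range σ.length)).subset ?_
      rintro i ⟨q, l, hq, -, -⟩
      simpa using (List.getElem?_eq_some_iff.1 hq).1
  · rw [← hk, ← Finset.card_image_of_injective _ Fin.val_injective, ← Set.ncard_coe_finset]
    congr 1
    ext j
    simp only [Finset.coe_image, Set.mem_image, Finset.coe_filter, Finset.mem_univ, true_and,
      Set.mem_ofPred_eq]
    constructor
    · rintro ⟨i, hi, rfl⟩; exact hi
    · intro hj
      obtain ⟨l, hl⟩ := Option.isSome_iff_exists.1 hj
      exact ⟨⟨j, hlt p hp j l hl⟩, hj, rfl⟩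

theorem Packs.mono {O O' : Finset (Fin σ.length)} {path : Fin σ.length → List Move}
    (h : Packs N σ O path) (hO : O' ⊆ O) : Packs N σ O' path :=
  ⟨fun i hi => h.dst i (hO hi), fun m v t S hS => h.cap m v t S (hS.trans hO)⟩

/-- At most `B + c` requests with the same source vertex and a non-trivial path can be routed. -/
theorem Packs.card_source_le {O : Finset (Fin σ.length)} {path : Fin σ.length → List Move}
    (h : Packs N σ O path) {S : Finset (Fin σ.length)} (hS : S ⊆ O) {v t : ℕ}
    (hsrc : ∀ i ∈ S, (σ.get i).src = v ∧ (σ.get i).time = t ∧ (σ.get i).src < (σ.get i).dst) :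
    S.card ≤ N.B + N.c := by
  have hne : ∀ i ∈ S, ∃ m, (path i)[0]? = some m := by
    intro i hi
    cases hp : path i with
    | nil =>
      have h1 := h.dst i (hS hi)
      have h2 := (hsrc i hi).2.2
      rw [hp] at h1
      simp only [Request.nodeAfter, List.count_nil, add_zero] at h1
      rw [Fin.lt_def] at h2; omega
    | cons m l => exact ⟨m, by simp⟩
  have hcr : ∀ m, (S.filter fun i => (path i)[0]? = some m).card ≤ N.cap m := by
    intro m
    refine h.cap m v t _ ((Finset.filter_subset _ _).trans hS) ?_
    intro i hi
    rw [Finset.mem_filter] at hi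
    exact ⟨0, hi.2, by simpa [Request.nodeAfter] using (hsrc i hi.1).1,
      by simp [← (hsrc i hi.1).2.1]⟩
  have hsub : S ⊆ (S.filter fun i => (path i)[0]? = some .forward) ∪
      (S.filter fun i => (path i)[0]? = some .hold) := by
    intro i hi
    obtain ⟨m, hm⟩ := hne i hi
    rw [Finset.mem_union, Finset.mem_filter, Finset.mem_filter]
    cases m
    · exact Or.inl ⟨hi, hm⟩
    · exact Or.inr ⟨hi, hm⟩
  have h1 : (S.filter fun i => (path i)[0]? = some .forward).card ≤ N.c := hcr .forward
  have h2 : (S.filter fun i => (path i)[0]? = some .hold).card ≤ N.B := hcr .hold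
  have h3 := (Finset.card_le_card hsub).trans (Finset.card_union_le _ _)
  omega

theorem exists_horizon {n : ℕ} (σ : List (Request n)) : ∃ T, ∀ i (h : i < σ.length),
    σ[i].time ≤ T := by
  refine ⟨(σ.map Request.time).sum, fun i h => ?_⟩
  exact List.le_sum_of_mem (List.mem_map.2 ⟨_, List.getElem_mem h, rfl⟩)

open Classical in
/-- The requests that the algorithm delivers. -/
noncomputable def delivered (N : LineNetwork) (lightest : Oracle) (ω : Coins)
    (σ : List (Request N.n)) : Finset (Fin σ.length) :=
  Finset.univ.filter fun i => (i : ℕ) ∈ deliveredSet σ (alg N lightest ω σ)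

theorem ncard_deliveredSet (lightest : Oracle) (ω : Coins) :
    (deliveredSet σ (alg N lightest ω σ)).ncard = (delivered N lightest ω σ).card := by
  classical
  rw [← Finset.card_image_of_injective _ Fin.val_injective, ← Set.ncard_coe_finset]
  congr 1
  ext j
  simp only [delivered, Finset.coe_image, Set.mem_image, Finset.coe_filter, Finset.mem_univ,
    true_and, Set.mem_ofPred_eq]
  constructor
  · intro hj
    obtain ⟨q, T, l, hq, h⟩ := hj
    exact ⟨⟨j, (List.getElem?_eq_some_iff.1 hq).1⟩, ⟨q, T, l, hq, h⟩, rfl⟩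
  · rintro ⟨i, hi, rfl⟩; exact hi

variable {lightest : Oracle} {ω : Coins}

theorem mem_delivered_of_mid (hN : N.Valid) (horacle : IsLightestPathOracle N lightest) {T : ℕ}
    {p : Packet N.n} (hp : p ∈ (mid N lightest ω σ T).packets) (h : p.id < σ.length) :
    (⟨p.id, h⟩ : Fin σ.length) ∈ delivered N lightest ω σ := by
  classical
  simp only [delivered, Finset.mem_filter, Finset.mem_univ, true_and]
  exact delivered_of_mem_mid hN horacle σ ω hp

/-- The position of a node in its row of tiles. -/
noncomputable def rowOffset (N : LineNetwork) (ω : Coins) (v : ℤ) : ℕ :=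
  ((v - ω.phaseSpace) % N.Q).toNat

theorem rowOffset_lt (hN : N.Valid) (v : ℤ) : rowOffset N ω v < N.Q := by
  have hQ : (0 : ℤ) < N.Q := by exact_mod_cast hN.Q_pos
  have h1 := Int.emod_lt_of_pos (v - ω.phaseSpace) hQ
  unfold rowOffset
  omega

theorem rowOffset_inj (hN : N.Valid) {v v' : ℤ} (h : rowOffset N ω v = rowOffset N ω v')
    (hr : tileRow N ω v = tileRow N ω v') : v = v' := by
  have hQ : (0 : ℤ) < N.Q := by exact_mod_cast hN.Q_pos
  have h1 := Int.emod_nonneg (v - ω.phaseSpace) hQ.ne'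
  have h2 := Int.emod_nonneg (v' - ω.phaseSpace) hQ.ne'
  have h3 := Int.mul_ediv_add_emod (v - ω.phaseSpace) N.Q
  have h4 := Int.mul_ediv_add_emod (v' - ω.phaseSpace) N.Q
  unfold tileRow at hr
  unfold rowOffset at h
  rw [hr] at h3
  omega

/-- The throughput for near requests. -/
theorem near_competitive (hN : N.Valid) (horacle : IsLightestPathOracle N lightest)
    (hnear : ω.far = false) {O : Finset (Fin σ.length)} {path : Fin σ.length → List Move}
    (hO : Packs N σ O path) (hOn : ∀ i ∈ O, IsNear N ω (σ.get i)) :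
    (O.card : ℝ) ≤ 9 * N.log * (delivered N lightest ω σ).card := by
  classical
  obtain ⟨T, hT⟩ := exists_horizon σ
  have hA := nearAdmitted (N := N) (lightest := lightest) (σ := σ) hnear T
  set D := delivered N lightest ω σ
  -- Requests are charged to segments: a row of tiles together with a column. `K` collects the
  -- segments of the requests of the optimum that the algorithm misses.
  let κ : Fin σ.length → ℤ × ℤ := fun i =>
    (tileRow N ω ((σ.get i).src : ℕ), (σ.get i).column)
  let K := (O \ D).image κ
  have hblocked : ∀ i ∈ O \ D, ∃ v, (σ.get i).Spans v ∧
      N.c ≤ columnLoad (mid N lightest ω σ T).packets (σ.get i).column v := by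
    intro i hi
    rw [Finset.mem_sdiff] at hi
    have h1 : (σ.get i, (i : ℕ)) ∈ handled σ (T + 1) := by
      rw [mem_handled]
      exact ⟨by simp, Nat.lt_succ_of_le (hT i i.2)⟩
    rcases hA.complete _ h1 (hOn i hi.1) with ⟨p, hp, hid⟩ | h
    · exfalso
      apply hi.2
      have hlt : p.id < σ.length := by rw [hid]; exact i.2
      have := mem_delivered_of_mid hN horacle hp hlt
      have e : (⟨p.id, hlt⟩ : Fin σ.length) = i := Fin.ext hid
      rwa [e] at this
    · exact h
  -- A segment has `Q` vertices, and at most `B + c` routed requests start at each of them. That a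
  -- missed request spans a link ensures that its path is non-trivial, as `Packs.card_source_le`
  -- requires.
  have hup : (O \ D).card ≤ N.Q * (N.B + N.c) * K.card := by
    rw [mul_comm]
    have := Finset.card_le_mul_card_image (s := O \ D) (f := κ) (N.Q * (N.B + N.c)) ?_
    · rw [mul_comm]; exact this
    intro k _
    have h2 := Finset.card_le_mul_card_image_of_maps_to
      (s := (O \ D).filter fun i => κ i = k) (t := Finset.range N.Q)
      (f := fun i => rowOffset N ω ((σ.get i).src : ℕ))
      (fun i _ => Finset.mem_range.2 (rowOffset_lt hN _)) (N.B + N.c) ?_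
    · rw [Finset.card_range, mul_comm] at h2; exact h2
    intro b _
    set S := ((O \ D).filter fun i => κ i = k).filter
      fun i => rowOffset N ω ((σ.get i).src : ℕ) = b with hS
    rcases S.eq_empty_or_nonempty with he | ⟨i0, hi0⟩
    · rw [he]; exact Nat.zero_le _
    refine hO.card_source_le (S := S) (v := (σ.get i0).src) (t := (σ.get i0).time) ?_ ?_
    · intro i hi
      simp only [hS, Finset.mem_filter, Finset.mem_sdiff] at hi
      exact hi.1.1.1
    · intro i hi
      rw [hS, Finset.mem_filter, Finset.mem_filter] at hi hi0
      have e1 := congrArg Prod.fst (hi.1.2.trans hi0.1.2.symm)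
      have e2 := congrArg Prod.snd (hi.1.2.trans hi0.1.2.symm)
      have e3 := rowOffset_inj hN (hi.2.trans hi0.2.symm) e1
      have e4 : (σ.get i).column = (σ.get i0).column := e2
      unfold Request.column at e4
      obtain ⟨v, hv, -⟩ := hblocked i hi.1.1
      exact ⟨by omega, by omega, lt_of_le_of_lt hv.1 hv.2⟩
  -- The packets that saturate a link for a missed request are near and share its column. Both row
  -- intervals contain the link, so they belong to the same segment and are counted once.
  have hlow : N.c * K.card ≤ D.card := by
    have hsub : N.c * K.card ≤ (D.filter fun i => κ i ∈ K).card := by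
      apply Finset.mul_card_image_le_card_of_maps_to (f := κ) (t := K)
      · intro i hi; exact (Finset.mem_filter.1 hi).2
      · intro k hk
        obtain ⟨i, hi, rfl⟩ := Finset.mem_image.1 hk
        obtain ⟨v, hv, hc⟩ := hblocked i hi
        refine hc.trans ?_
        unfold columnLoad
        have hnd : (mid N lightest ω σ T).packets.Nodup :=
          List.Nodup.of_map _ (fromRequests T).2.nodup
        rw [← List.toFinset_card_of_nodup (hnd.filter _)]
        rw [← Finset.card_image_of_injective (Finset.filter _ (Finset.filter _ D))
            Fin.val_injective]
        rw [← Finset.card_image_of_injOn (f := Packet.id)]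
        · apply Finset.card_le_card
          intro j hj
          obtain ⟨p, hp, rfl⟩ := Finset.mem_image.1 hj
          simp only [List.mem_toFinset, List.mem_filter, decide_eq_true_eq] at hp
          obtain ⟨hp, hcol, h1, h2⟩ := hp
          have hreq := (mem_mid_time hp).1
          have hlt : p.id < σ.length := (List.getElem?_eq_some_iff.1 hreq).1
          have hget : σ.get ⟨p.id, hlt⟩ = p.req := (List.getElem?_eq_some_iff.1 hreq).2
          have hrow : ∀ q : Request N.n, IsNear N ω q → q.Spans v →
              tileRow N ω (q.src : ℕ) = tileRow N ω (v : ℕ) := by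
            intro q hq hs
            have a1 := tileRow_mono N ω (v := (q.src : ℕ)) (v' := (v : ℕ)) (by
              have := hs.1; rw [Fin.le_def] at this; exact_mod_cast this)
            have a2 := tileRow_mono N ω (v := (v : ℕ)) (v' := (q.dst : ℕ)) (by
              have := hs.2; rw [Fin.lt_def] at this; exact_mod_cast this.le)
            unfold IsNear at hq
            omega
          refine Finset.mem_image.2 ⟨⟨p.id, hlt⟩, ?_, rfl⟩
          have hκ : κ ⟨p.id, hlt⟩ = κ i := by
            have e1 := hrow p.req (hA.packet p hp).1 ⟨h1, h2⟩
            have e2 := hrow (σ.get i) (hOn i (Finset.mem_sdiff.1 hi).1) hv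
            simp only [κ, hget, e1, e2, hcol]
          rw [Finset.mem_filter, Finset.mem_filter]
          exact ⟨⟨mem_delivered_of_mid hN horacle hp hlt, by rw [hκ]; exact hk⟩, hκ⟩
        · intro p hp p' hp' hid
          simp only [List.coe_toFinset, List.mem_filter, Set.mem_ofPred_eq] at hp hp'
          exact mid_id_inj hp.1 hp'.1 hid
    exact hsub.trans (Finset.card_le_card (Finset.filter_subset _ _))
  have hsplit : O.card ≤ (O \ D).card + D.card := by
    have := Finset.card_sdiff_add_card O D
    have := Finset.card_le_card (Finset.subset_union_left (s₁ := O) (s₂ := D))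
    omega
  have hc0 : (0 : ℝ) < N.c := by exact_mod_cast hN.c_pos
  have h4 := hN.four_lt_log
  have hseg := hN.segment_le
  have hup' : ((O \ D).card : ℝ) ≤ (N.Q : ℝ) * (N.B + N.c) * K.card := by exact_mod_cast hup
  have hlow' : (N.c : ℝ) * K.card ≤ D.card := by exact_mod_cast hlow
  have hsplit' : (O.card : ℝ) ≤ (O \ D).card + D.card := by exact_mod_cast hsplit
  have h5 : (N.Q : ℝ) * (N.B + N.c) * K.card ≤ 8 * N.log * N.c * K.card :=
    mul_le_mul_of_nonneg_right hseg (Nat.cast_nonneg _)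
  have h6 : 8 * N.log * (N.c * K.card) ≤ 8 * N.log * D.card :=
    mul_le_mul_of_nonneg_left hlow' (by linarith)
  have h7 : (0 : ℝ) ≤ D.card := Nat.cast_nonneg _
  nlinarith

end Optimum

/-! ### Online path packing -/

theorem fresh_of_handled {n : ℕ} {σ : List (Request n)} {T : ℕ} {pre post : List (Request n × ℕ)}
    {q : Request n × ℕ} (h : handled σ T = pre ++ q :: post) (q' : Request n) :
    (q', q.2) ∉ pre := by
  intro hq'
  have h1 : (q', q.2) ∈ handled σ T := by rw [h]; exact List.mem_append_left _ hq'
  have h2 : q ∈ handled σ T := by rw [h]; simp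
  rw [mem_handled] at h1 h2
  have h3 : (q', q.2) = q := by
    refine Prod.ext ?_ rfl
    have := h1.1.symm.trans h2.1
    exact Option.some.inj this
  rw [h3] at hq'
  have := nodup_handled σ T
  rw [h, List.nodup_append] at this
  exact this.2.2 q hq' q (by simp) rfl

section PathPacking

variable (N : LineNetwork) (lightest : Oracle) (ω : Coins) (σ : List (Request N.n))

/-- The plane of a request. -/
noncomputable def planeOf (q : Request N.n × ℕ) : ℕ := rank N ω (arrivals σ q.1.time) q

/-- The request is passed to the online path packing algorithm. -/
def Considered (q : Request N.n × ℕ) : Prop := IsFarPlus N ω q.1 ∧ planeOf N ω σ q < N.B + N.c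

/-- The state of the online path packing algorithm: weights, accepted requests, and their paths. -/
structure PathPacking where
  weight : SketchEdge → ℝ
  accepted : Finset ℕ
  route : ℕ → List SketchEdge

/-- The path that the oracle suggests. -/
noncomputable def suggestion (x : SketchEdge → ℝ) (q : Request N.n) : List Move :=
  lightest x (sourceTile N ω q) (tileRow N ω (q.dst : ℕ))

open Classical in
/-- The treatment of one request by the online path packing algorithm. -/
noncomputable def packStep (g : PathPacking) (q : Request N.n × ℕ) : PathPacking :=
  if Considered N ω σ q ∧
      pathWeight g.weight (sourceTile N ω q.1) (suggestion N lightest ω g.weight q.1) < 1 then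
    { weight := updateWeight N g.weight
        (sketchEdges (sourceTile N ω q.1) (suggestion N lightest ω g.weight q.1))
      accepted := insert q.2 g.accepted
      route := Function.update g.route q.2
        (sketchEdges (sourceTile N ω q.1) (suggestion N lightest ω g.weight q.1)) }
  else g

/-- The online path packing algorithm. It does not depend on the coins of the requests. -/
noncomputable def packing (l : List (Request N.n × ℕ)) : PathPacking :=
  l.foldl (packStep N lightest ω σ) ⟨fun _ => 0, ∅, fun _ => []⟩

theorem packing_append (l : List (Request N.n × ℕ)) (q : Request N.n × ℕ) :
    packing N lightest ω σ (l ++ [q]) = packStep N lightest ω σ (packing N lightest ω σ l) q := by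
  unfold packing; rw [List.foldl_append]; rfl

/-- The accepted requests whose paths use the edge `e`. -/
def PathPacking.users (g : PathPacking) (e : SketchEdge) : Finset ℕ :=
  g.accepted.filter fun i => e ∈ g.route i

variable {N lightest ω σ}

theorem LineNetwork.Valid.rpow_sub_one_le (hN : N.Valid) :
    (2 : ℝ) ^ (1 / (N.cS : ℝ)) - 1 ≤ 1 / N.cS := by
  have h9 : (9 : ℝ) ≤ N.cS := by exact_mod_cast hN.nine_le_cS
  have h0 : 0 ≤ 1 / (N.cS : ℝ) := by positivity
  have h1 : 1 / (N.cS : ℝ) ≤ 1 := by rw [div_le_one (by linarith)]; linarith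
  have := rpow_one_add_le_one_add_mul_self (s := 1) (by norm_num) h0 h1
  norm_num at this ⊢
  linarith

theorem LineNetwork.one_le_rpow (N : LineNetwork) : 1 ≤ (2 : ℝ) ^ (1 / (N.cS : ℝ)) :=
  Real.one_le_rpow (by norm_num) (by positivity)

theorem LineNetwork.Valid.pmax_pos (hN : N.Valid) : (1 : ℝ) ≤ N.pmax := by
  have := hN.n_gt
  have : 1 ≤ N.pmax := by unfold LineNetwork.pmax; omega
  exact_mod_cast this

/-- The guarantees of the online path packing algorithm after the requests `pre`. -/
structure PackingInvariant (N : LineNetwork) (ω : Coins) (σ : List (Request N.n))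
    (pre : List (Request N.n × ℕ)) (g : PathPacking) : Prop where
  mem : ∀ i ∈ g.accepted, ∃ q w, (q, i) ∈ pre ∧ Considered N ω σ (q, i) ∧
    g.route i = sketchEdges (sourceTile N ω q) w ∧
    IsLegalSketchPath N (sourceTile N ω q) (tileRow N ω (q.dst : ℕ)) w
  weight_eq : ∀ e, g.weight e = ((2 : ℝ) ^ ((g.users e).card / (N.cS : ℝ)) - 1) / N.pmax
  users_le : ∀ e, ((g.users e).card : ℝ) ≤ N.cS * N.k
  potential : ∀ E : Finset SketchEdge, N.cS * ∑ e ∈ E, g.weight e ≤ 2 * g.accepted.card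
  rejected : ∀ q ∈ pre, Considered N ω σ q → q.2 ∉ g.accepted → ∀ w,
    IsLegalSketchPath N (sourceTile N ω q.1) (tileRow N ω (q.1.dst : ℕ)) w →
      1 ≤ pathWeight g.weight (sourceTile N ω q.1) w

theorem PackingInvariant.weight_nonneg {pre : List (Request N.n × ℕ)} {g : PathPacking}
    (h : PackingInvariant N ω σ pre g) (e : SketchEdge) : 0 ≤ g.weight e := by
  rw [h.weight_eq]
  apply div_nonneg _ (Nat.cast_nonneg _)
  have : (1 : ℝ) ≤ (2 : ℝ) ^ ((g.users e).card / (N.cS : ℝ)) :=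
    Real.one_le_rpow (by norm_num) (by positivity)
  linarith

/-- With `r = 2 ^ (1 / c^S)` the update multiplies `p_max * x_e + 1` by `r`, so the weight is an
explicit function of the number of users. An accepted path has weight below `1`, hence so has each
of its edges, and this caps the number of users. The update adds at most `(r - 1) (weight + length /
p_max) ≤ 2 / c^S` to the total weight. Weights never decrease, so past rejections stay justified. -/
theorem PackingInvariant.packStep (hN : N.Valid) (horacle : IsLightestPathOracle N lightest)
    {pre : List (Request N.n × ℕ)} {g : PathPacking} (h : PackingInvariant N ω σ pre g)
    {q : Request N.n × ℕ} (hfresh : ∀ q', (q', q.2) ∉ pre) :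
    PackingInvariant N ω σ (pre ++ [q]) (packStep N lightest ω σ g q) := by
  classical
  unfold PacketRouting.packStep
  split_ifs with hq
  · obtain ⟨hcons, hlight⟩ := hq
    set w := suggestion N lightest ω g.weight q.1 with hw
    set s := sourceTile N ω q.1 with hs
    have hlegal : IsLegalSketchPath N s (tileRow N ω (q.1.dst : ℕ)) w :=
      (horacle g.weight _ _ (exists_legalSketchPath hN hcons.1.1)).1
    have hnew : q.2 ∉ g.accepted := by
      intro hmem
      obtain ⟨q', -, h1, -⟩ := h.mem _ hmem
      exact hfresh q' h1
    have hnd := nodup_sketchEdges s w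
    have hr1 := N.one_le_rpow
    have hr2 := hN.rpow_sub_one_le
    have hp := hN.pmax_pos
    have h9 : (9 : ℝ) ≤ N.cS := by exact_mod_cast hN.nine_le_cS
    set r := (2 : ℝ) ^ (1 / (N.cS : ℝ)) with hr
    have hroute : ∀ i ∈ g.accepted, Function.update g.route q.2 (sketchEdges s w) i =
        g.route i := by
      intro i hi
      rw [Function.update_of_ne]
      rintro rfl; exact hnew hi
    have husers : ∀ e, ((insert q.2 g.accepted).filter fun i =>
        e ∈ Function.update g.route q.2 (sketchEdges s w) i).card =
        (g.users e).card + if e ∈ sketchEdges s w then 1 else 0 := by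
      intro e
      have hfe : (g.accepted.filter fun i => e ∈ Function.update g.route q.2 (sketchEdges s w) i) =
          g.users e := Finset.filter_congr fun i hi => by rw [hroute i hi]
      rw [Finset.filter_insert, hfe, Function.update_self]
      split_ifs
      · rw [Finset.card_insert_of_notMem]
        exact fun h' => hnew (Finset.mem_filter.1 h').1
      · rfl
    have hwle : ∀ e ∈ sketchEdges s w, g.weight e < 1 := by
      intro e he
      refine lt_of_le_of_lt ?_ hlight
      rw [pathWeight_eq_sum]
      exact Finset.single_le_sum (f := g.weight) (fun e _ => h.weight_nonneg e)
        (List.mem_toFinset.2 he)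
    refine ⟨?_, ?_, ?_, ?_, ?_⟩
    · intro i hi
      rcases Finset.mem_insert.1 hi with rfl | hi
      · exact ⟨q.1, w, by simp, hcons, Function.update_self .., hlegal⟩
      · obtain ⟨q', w', h1, h2, h3, h4⟩ := h.mem i hi
        exact ⟨q', w', List.mem_append_left _ h1, h2, (hroute i hi).trans h3, h4⟩
    · intro e
      simp only [PathPacking.users]
      rw [husers]
      unfold updateWeight
      by_cases he : e ∈ sketchEdges s w
      · rw [if_pos he, if_pos he, h.weight_eq]
        push_cast
        rw [add_div, Real.rpow_add (by norm_num), ← hr]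
        field_simp
        ring
      · rw [if_neg he, if_neg he, h.weight_eq, add_zero]
    · intro e
      simp only [PathPacking.users]
      rw [husers]
      split_ifs with he
      · have h1 := hwle e he
        rw [h.weight_eq, div_lt_one (by linarith)] at h1
        -- Before the update the power is less than `1 + p_max`, and `r ≤ 2`. The bound `2 + 2 p_max
        -- ≤ 1 + 3 p_max` explains the constant in the definition of `k`.
        have h2 : (2 : ℝ) ^ (((g.users e).card + 1 : ℝ) / (N.cS : ℝ)) ≤ 1 + 3 * N.pmax := by
          rw [add_div, Real.rpow_add (by norm_num), ← hr]
          have h3 : r ≤ 2 := by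
            have : 1 / (N.cS : ℝ) ≤ 1 := by rw [div_le_one (by linarith)]; linarith
            linarith
          have h4 : (0 : ℝ) ≤ (2 : ℝ) ^ (((g.users e).card : ℝ) / (N.cS : ℝ)) := by positivity
          nlinarith
        have h5 : ((g.users e).card + 1 : ℝ) / N.cS ≤ N.k := by
          refine le_trans ?_ (Nat.le_ceil _)
          rw [Real.le_logb_iff_rpow_le (by norm_num) (by linarith)]
          exact h2
        rw [div_le_iff₀ (by linarith)] at h5
        push_cast
        linarith
      · simpa using h.users_le e
    · intro E
      have h1 := h.potential E
      have h2 : ∑ e ∈ E, updateWeight N g.weight (sketchEdges s w) e ≤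
          ∑ e ∈ E, g.weight e + (r - 1) * (pathWeight g.weight s w + w.length / N.pmax) := by
        have h3 : ∀ e, updateWeight N g.weight (sketchEdges s w) e = g.weight e +
            (if e ∈ sketchEdges s w then (r - 1) * (g.weight e + 1 / N.pmax) else 0) := by
          intro e
          unfold updateWeight
          split_ifs
          · ring
          · ring
        rw [Finset.sum_congr rfl fun e _ => h3 e, Finset.sum_add_distrib]
        gcongr
        rw [← Finset.sum_filter]
        have hnn : ∀ e, 0 ≤ (r - 1) * (g.weight e + 1 / N.pmax) := by
          intro e
          have := h.weight_nonneg e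
          have : 0 ≤ 1 / (N.pmax : ℝ) := by positivity
          apply mul_nonneg <;> linarith
        calc ∑ e ∈ E.filter (fun e => e ∈ sketchEdges s w), (r - 1) * (g.weight e + 1 / N.pmax)
            ≤ ∑ e ∈ (sketchEdges s w).toFinset, (r - 1) * (g.weight e + 1 / N.pmax) := by
              apply Finset.sum_le_sum_of_subset_of_nonneg
              · intro e he
                exact List.mem_toFinset.2 (Finset.mem_filter.1 he).2
              · intro e _ _; exact hnn e
          _ = _ := by
              rw [← Finset.mul_sum, Finset.sum_add_distrib, pathWeight_eq_sum, Finset.sum_const,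
                List.toFinset_card_of_nodup hnd, length_sketchEdges, nsmul_eq_mul]
              ring
      have h4 : (w.length : ℝ) / N.pmax ≤ 1 := by
        rw [div_le_one (by linarith)]; exact_mod_cast hlegal.2.2
      -- Here `r - 1 ≤ 1 / c^S` by Bernoulli's inequality, and both the weight of the path and its
      -- relative length are at most `1`.
      have h5 : (r - 1) * (pathWeight g.weight s w + w.length / N.pmax) ≤ 1 / N.cS * 2 := by
        have h6 : 0 ≤ pathWeight g.weight s w := by
          rw [pathWeight_eq_sum]
          exact Finset.sum_nonneg fun e _ => h.weight_nonneg e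
        have h7 : (0 : ℝ) ≤ w.length / N.pmax := by positivity
        apply mul_le_mul hr2 _ (by linarith) (by positivity)
        linarith
      dsimp only
      rw [Finset.card_insert_of_notMem hnew]
      push_cast
      have h8 : N.cS * (1 / (N.cS : ℝ) * 2) = 2 := by field_simp
      nlinarith
    · intro q' hq' hc hna w' hw'
      dsimp only at hna
      rw [Finset.mem_insert, not_or] at hna
      rcases List.mem_append.1 hq' with hq' | hq'
      · refine (h.rejected q' hq' hc hna.2 w' hw').trans ?_
        rw [pathWeight_eq_sum, pathWeight_eq_sum]
        apply Finset.sum_le_sum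
        intro e _
        dsimp only
        unfold updateWeight
        split_ifs
        · have h1 := h.weight_nonneg e
          have h2 : 0 ≤ 1 / (N.pmax : ℝ) := by positivity
          rw [← hr]
          nlinarith
        · exact le_rfl
      · exact absurd (congrArg Prod.snd (List.mem_singleton.1 hq')) hna.1
  · refine ⟨?_, h.weight_eq, h.users_le, h.potential, ?_⟩
    · intro i hi
      obtain ⟨q', w', h1, h2⟩ := h.mem i hi
      exact ⟨q', w', List.mem_append_left _ h1, h2⟩
    · intro q' hq' hc hna w' hw'
      rcases List.mem_append.1 hq' with hq' | hq'
      · exact h.rejected q' hq' hc hna w' hw'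
      · rw [List.mem_singleton] at hq'
        subst hq'
        rw [not_and, not_lt] at hq
        exact (hq hc).trans ((horacle g.weight _ _ ⟨w', hw'⟩).2 w' hw')

theorem packingInvariant (hN : N.Valid) (horacle : IsLightestPathOracle N lightest) (T : ℕ) :
    PackingInvariant N ω σ (handled σ T) (packing N lightest ω σ (handled σ T)) := by
  unfold packing
  refine foldl_prefix_induction (fun pre g => PackingInvariant N ω σ pre g) _ _ _ ?_ ?_
  · exact ⟨by simp, by simp [PathPacking.users], by intro e; simp [PathPacking.users]; positivity,
      by simp, by simp⟩
  · intro pre q post g hl h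
    exact h.packStep hN horacle (fresh_of_handled hl)

end PathPacking

/-! ### Path packing and injection -/

section Injection

variable {N : LineNetwork} {lightest : Oracle} {ω : Coins} {σ : List (Request N.n)}

/-- Two requests compete for a row, respectively a column, of a plane of a SW-quadrant. -/
def Competes (N : LineNetwork) (ω : Coins) (i : ℕ) (q q' : Request N.n) : Prop :=
  sourceTile N ω q = sourceTile N ω q' ∧
    match planeDir N i with
    | .hold => q.src = q'.src
    | .forward => (q.time : ℤ) - (q.src : ℕ) = (q'.time : ℤ) - (q'.src : ℕ)

open Classical in
/-- If the request `q` is accepted by the path packing and kept by the sparsification, then it is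
injected, unless it competes with other such requests. -/
def Settled (N : LineNetwork) (ω : Coins) (σ : List (Request N.n)) (g : PathPacking)
    (ps : List (Packet N.n)) (q : Request N.n × ℕ) : Prop :=
  (∃ p ∈ ps, p.id = q.2) ∨
  (∃ e ∈ g.route q.2, N.cS ≤ 4 * ((((g.users e).erase q.2).filter fun i => ω.keep i = true).card +
      1)) ∨
  (∃ p ∈ ps, p.id ≠ q.2 ∧ p.plane = planeOf N ω σ q ∧ Competes N ω (planeOf N ω σ q) p.req q.1) ∨
  N.cS < 4 * ((ps.filter fun p => p.id ≠ q.2 ∧ sourceTile N ω p.req = sourceTile N ω q.1).length +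
      1)

theorem Settled.move {g : PathPacking} {ps : List (Packet N.n)} {q : Request N.n × ℕ}
    (h : Settled N ω σ g ps q) : Settled N ω σ g (movePackets N ω ps) q := by
  rcases h with ⟨p, hp, hid⟩ | h1 | ⟨p, hp, h1, h2, h3⟩ | h1
  · exact Or.inl ⟨_, List.mem_map.2 ⟨p, hp, rfl⟩,
      (static_id (advance_static (ω := ω) ps p)).trans hid⟩
  · exact Or.inr (Or.inl h1)
  · refine Or.inr (Or.inr (Or.inl ⟨_, List.mem_map.2 ⟨p, hp, rfl⟩, ?_⟩))
    have hs := advance_static (ω := ω) ps p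
    rw [← static_id hs] at h1
    rw [← static_plane hs] at h2
    rw [← static_req hs] at h3
    exact ⟨h1, h2, h3⟩
  · refine Or.inr (Or.inr (Or.inr ?_))
    rw [filter_movePackets _ (fun p => rfl)]
    exact h1

/-- All alternatives are monotone in the users and in the packets. A verdict reached when the
request is handled can therefore be read off the final state, which does not depend on the time of
handling. -/
theorem Settled.mono {g g' : PathPacking} {ps ps' : List (Packet N.n)} {q : Request N.n × ℕ}
    (h : Settled N ω σ g ps q) (hroute : g'.route q.2 = g.route q.2)
    (husers : ∀ e, g.users e ⊆ g'.users e) (hps : ps <+: ps') : Settled N ω σ g' ps' q := by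
  rcases h with ⟨p, hp, hid⟩ | ⟨e, he, h1⟩ | ⟨p, hp, h1⟩ | h1
  · exact Or.inl ⟨p, hps.subset hp, hid⟩
  · refine Or.inr (Or.inl ⟨e, by rw [hroute]; exact he, h1.trans ?_⟩)
    have := Finset.card_le_card (Finset.filter_subset_filter (fun i => ω.keep i = true)
      (Finset.erase_subset_erase q.2 (husers e)))
    omega
  · exact Or.inr (Or.inr (Or.inl ⟨p, hps.subset hp, h1⟩))
  · refine Or.inr (Or.inr (Or.inr (h1.trans_le ?_)))
    have := (hps.sublist.filter fun p => decide (p.id ≠ q.2 ∧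
      sourceTile N ω p.req = sourceTile N ω q.1)).length_le
    omega

/-- The relation between the state of the algorithm and that of the path packing algorithm, when the
requests `pre` have been handled. -/
structure Linked (N : LineNetwork) (ω : Coins) (σ : List (Request N.n))
    (pre : List (Request N.n × ℕ)) (g : PathPacking) (S : State N.n) : Prop where
  weight : S.weight = g.weight
  load : ∀ e, S.load e ≤ ((g.users e).filter fun i => ω.keep i = true).card
  packet : ∀ p ∈ S.packets, p.id ∈ g.accepted ∧ ω.keep p.id = true ∧
    p.plane = planeOf N ω σ (p.req, p.id)
  complete : ∀ q ∈ pre, q.2 ∈ g.accepted → ω.keep q.2 = true → Settled N ω σ g S.packets q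

theorem Linked.move {pre : List (Request N.n × ℕ)} {g : PathPacking} {S : State N.n}
    (h : Linked N ω σ pre g S) :
    Linked N ω σ pre g { S with packets := movePackets N ω S.packets } where
  weight := h.weight
  load := h.load
  packet p hp := by
    obtain ⟨p', hp', rfl⟩ := List.mem_map.1 hp
    have hs := advance_static (ω := ω) S.packets p'
    have := h.packet p' hp'
    rw [← static_req hs, ← static_id hs, ← static_plane hs] at this
    exact this
  complete q hq ha hk := (h.complete q hq ha hk).move

/-- Every rejection after the sparsification is translated into an alternative of `Settled`. The
alternatives that blame a rejection mention only requests other than `q`, so that later they concern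
coins independent of that of `q`. -/
theorem Linked.handleFar {T : ℕ} {pre : List (Request N.n × ℕ)} {g : PathPacking} {S : State N.n}
    (h : Linked N ω σ pre g S) (hg : PackingInvariant N ω σ pre g) {q : Request N.n × ℕ}
    (hq : q ∈ arrivals σ T) (hfresh : ∀ q', (q', q.2) ∉ pre) :
    Linked N ω σ (pre ++ [q]) (packStep N lightest ω σ g q)
      (handleFar N lightest ω (arrivals σ T) S q) := by
  classical
  have hplane : rank N ω (arrivals σ T) q = planeOf N ω σ q := by
    unfold planeOf; rw [((mem_arrivals σ).1 hq).2]
  have hnew : q.2 ∉ g.accepted := by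
    intro hmem
    obtain ⟨q', -, h1, -⟩ := hg.mem _ hmem
    exact hfresh q' h1
  have hne : ∀ p ∈ S.packets, p.id ≠ q.2 := fun p hp e => hnew (e ▸ (h.packet p hp).1)
  have hpreid : ∀ q' ∈ pre, q'.2 ≠ q.2 := fun q' hq' e => hfresh q'.1 (e ▸ hq')
  unfold packStep
  have hsug : lightest S.weight (sourceTile N ω q.1) (tileRow N ω (q.1.dst : ℕ)) =
      suggestion N lightest ω g.weight q.1 := by rw [h.weight]; rfl
  unfold PacketRouting.handleFar
  dsimp only
  rw [hplane, hsug, h.weight]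
  set w := suggestion N lightest ω g.weight q.1
  set s := sourceTile N ω q.1 with hs
  by_cases hc : Considered N ω σ q
  swap
  · rw [if_neg (fun h' => hc h'.1), if_pos (by
      by_contra h'; push Not at h'; exact hc h')]
    refine ⟨h.weight, h.load, h.packet, ?_⟩
    intro q' hq' ha hk
    rcases List.mem_append.1 hq' with hq' | hq'
    · exact h.complete q' hq' ha hk
    · rw [List.mem_singleton.1 hq'] at ha; exact absurd ha hnew
  have hc' : ¬ (¬ IsFarPlus N ω q.1 ∨ N.B + N.c ≤ planeOf N ω σ q) := by
    rw [not_or, not_not, not_le]; exact hc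
  rw [if_neg hc']
  by_cases hlight : pathWeight g.weight s w < 1
  swap
  · rw [if_neg (fun h' => hlight h'.2), if_pos (not_lt.1 hlight)]
    refine ⟨h.weight, h.load, h.packet, ?_⟩
    intro q' hq' ha hk
    rcases List.mem_append.1 hq' with hq' | hq'
    · exact h.complete q' hq' ha hk
    · rw [List.mem_singleton.1 hq'] at ha; exact absurd ha hnew
  rw [if_pos ⟨hc, hlight⟩, if_neg (not_le.2 hlight)]
  set g' : PathPacking := ⟨updateWeight N g.weight (sketchEdges s w), insert q.2 g.accepted,
    Function.update g.route q.2 (sketchEdges s w)⟩ with hg'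
  have hroute : ∀ i, i ≠ q.2 → g'.route i = g.route i := fun i hi => Function.update_of_ne hi _ _
  have hrouteq : g'.route q.2 = sketchEdges s w := Function.update_self ..
  have husers : ∀ e, g.users e ⊆ g'.users e := by
    intro e i hi
    simp only [PathPacking.users, Finset.mem_filter] at hi ⊢
    have : i ≠ q.2 := by rintro rfl; exact hnew hi.1
    exact ⟨Finset.mem_insert_of_mem hi.1, by rw [hroute i this]; exact hi.2⟩
  have hnotusers : ∀ e, q.2 ∉ g.users e := fun e he => hnew (Finset.mem_filter.1 he).1
  have hload : ∀ e, S.load e ≤ ((g'.users e).filter fun i => ω.keep i = true).card := fun e =>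
    (h.load e).trans (Finset.card_le_card (Finset.filter_subset_filter _ (husers e)))
  have hpacket : ∀ p ∈ S.packets, p.id ∈ g'.accepted ∧ ω.keep p.id = true ∧
      p.plane = planeOf N ω σ (p.req, p.id) := fun p hp =>
    ⟨Finset.mem_insert_of_mem (h.packet p hp).1, (h.packet p hp).2⟩
  have hcomplete : ∀ ps, S.packets <+: ps → (ω.keep q.2 = true → Settled N ω σ g' ps q) →
      ∀ q' ∈ pre ++ [q], q'.2 ∈ g'.accepted → ω.keep q'.2 = true → Settled N ω σ g' ps q' := by
    intro ps hps hset q' hq' ha hk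
    rcases List.mem_append.1 hq' with hq' | hq'
    · have hne' := hpreid q' hq'
      exact (h.complete q' hq' ((Finset.mem_insert.1 ha).resolve_left hne') hk).mono
        (hroute _ hne') husers hps
    · rw [List.mem_singleton] at hq'
      subst hq'
      exact hset hk
  by_cases hk : ω.keep q.2 = false
  · rw [if_pos hk]
    exact ⟨rfl, hload, hpacket, hcomplete _ List.prefix_rfl (fun h' => by simp [hk] at h')⟩
  rw [if_neg hk]
  rw [Bool.not_eq_false] at hk
  by_cases hlt : ∃ e ∈ sketchEdges s w, N.cS ≤ 4 * (S.load e + 1)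
  · rw [if_pos hlt]
    refine ⟨rfl, hload, hpacket, hcomplete _ List.prefix_rfl fun _ => ?_⟩
    obtain ⟨e, he, h1⟩ := hlt
    refine Or.inr (Or.inl ⟨e, by rw [hrouteq]; exact he, h1.trans ?_⟩)
    have h2 := h.load e
    -- The load test looks at the counter before `q` is added, so removing `q` from the new users
    -- loses nothing.
    have h3 : (g.users e).filter (fun i => ω.keep i = true) ⊆
        ((g'.users e).erase q.2).filter fun i => ω.keep i = true := by
      apply Finset.filter_subset_filter
      intro i hi
      rw [Finset.mem_erase]
      exact ⟨by rintro rfl; exact hnotusers e hi, husers e hi⟩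
    have h4 := Finset.card_le_card h3
    omega
  rw [if_neg hlt]
  have hload' : ∀ e, (if e ∈ sketchEdges s w then S.load e + 1 else S.load e) ≤
      ((g'.users e).filter fun i => ω.keep i = true).card := by
    intro e
    split_ifs with he
    · have h1 : insert q.2 ((g.users e).filter fun i => ω.keep i = true) ⊆
          (g'.users e).filter fun i => ω.keep i = true := by
        intro i hi
        rw [Finset.mem_filter]
        rcases Finset.mem_insert.1 hi with rfl | hi
        · refine ⟨?_, hk⟩
          simp only [PathPacking.users, Finset.mem_filter]
          exact ⟨Finset.mem_insert_self _ _, by rw [hrouteq]; exact he⟩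
        · rw [Finset.mem_filter] at hi
          exact ⟨husers e hi.1, hi.2⟩
      have h2 := Finset.card_le_card h1
      rw [Finset.card_insert_of_notMem (fun h' => hnotusers e (Finset.mem_filter.1 h').1)] at h2
      have h3 := h.load e
      omega
    · exact hload e
  by_cases hir : IRoutingFails N ω S q.1 (planeOf N ω σ q)
  · rw [if_pos hir]
    refine ⟨rfl, hload', hpacket, hcomplete _ List.prefix_rfl fun _ => ?_⟩
    rcases hir with ⟨p, hp, h1, h2, h3⟩ | h1
    · exact Or.inr (Or.inr (Or.inl ⟨p, hp, hne p hp, h2, h1, h3⟩))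
    · refine Or.inr (Or.inr (Or.inr (h1.trans_le ?_)))
      have : S.packets.filter (fun p => decide (sourceTile N ω p.req = sourceTile N ω q.1)) =
          S.packets.filter fun p => decide (p.id ≠ q.2 ∧
            sourceTile N ω p.req = sourceTile N ω q.1) := by
        apply List.filter_congr
        intro p hp
        simp [hne p hp]
      rw [this]
  · rw [if_neg hir]
    refine ⟨rfl, hload', ?_, hcomplete _ (List.prefix_append _ _) fun _ => ?_⟩
    · intro p hp
      rcases List.mem_append.1 hp with hp | hp
      · exact hpacket p hp
      · rw [List.mem_singleton.1 hp]
        exact ⟨Finset.mem_insert_self _ _, hk, rfl⟩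
    · exact Or.inl ⟨_, List.mem_append_right _ (List.mem_singleton_self _), rfl⟩

theorem linked (hN : N.Valid) (horacle : IsLightestPathOracle N lightest) (hfar : ω.far = true)
    (T : ℕ) : Linked N ω σ (handled σ (T + 1)) (packing N lightest ω σ (handled σ (T + 1)))
      (mid N lightest ω σ T) := by
  have := (mid_induction (N := N) (ω := ω) (lightest := lightest) (σ := σ)
    (fun pre S => PackingInvariant N ω σ pre (packing N lightest ω σ pre) ∧
      Linked N ω σ pre (packing N lightest ω σ pre) S)
    ⟨packingInvariant (σ := σ) hN horacle 0, rfl, fun _ => Nat.zero_le _, by simp [State.init],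
      by simp⟩ ?_ (fun _ _ h => ⟨h.1, h.2.move⟩) T).2
  · exact this.2
  · rintro T pre q S ⟨post, hpost⟩ hq ⟨h1, h2⟩
    have hf := fresh_of_handled hpost
    rw [packing_append]
    refine ⟨h1.packStep hN horacle hf, ?_⟩
    unfold handleRequest
    rw [if_pos hfar]
    exact h2.handleFar h1 hq hf

end Injection

/-! ### Grid paths with few horizontal edges

A vertex of the untilted grid is a pair of coordinates, like a tile, so that `sketchEdges P l` lists
the edges of the grid path that starts in `P` and makes the moves `l`, and `walk P l` is its end. -/

theorem sketchEdges_append (s : Tile) (u w : List Move) :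
    sketchEdges s (u ++ w) = sketchEdges s u ++ sketchEdges (walk s u) w := by
  induction u generalizing s with
  | nil => simp [sketchEdges]
  | cons m u ih => rw [List.cons_append, sketchEdges, sketchEdges, ih, walk_cons, List.cons_append]

theorem sketchEdges_subset_of_prefix {s : Tile} {u w : List Move} (h : u <+: w) :
    sketchEdges s u ⊆ sketchEdges s w := by
  obtain ⟨v, rfl⟩ := h
  rw [sketchEdges_append]
  exact List.subset_append_left _ _

theorem mem_sketchEdges_replicate {s P : Tile} {k : ℕ} {m m' : Move}
    (h : (P, m') ∈ sketchEdges s (List.replicate k m)) :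
    m' = m ∧ ∃ j < k, P = walk s (List.replicate j m) := by
  obtain ⟨j, a, h1, h2⟩ := mem_sketchEdges.1 h
  rw [List.getElem?_replicate] at h1
  split_ifs at h1 with hj
  rw [Option.some.injEq] at h1
  subst h1
  rw [Prod.mk.injEq] at h2
  refine ⟨h2.2, j, hj, ?_⟩
  rw [h2.1, List.take_replicate, min_eq_left hj.le]

/-- Cut a path after its `k`-th step in direction `m`. -/
theorem exists_prefix_count {w : List Move} {m : Move} {k : ℕ} (hk : k < w.count m) :
    ∃ u, u ++ [m] <+: w ∧ u.count m = k := by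
  induction w generalizing k with
  | nil => simp at hk
  | cons a w ih =>
    by_cases ha : a = m
    · subst ha
      rw [List.count_cons_self] at hk
      cases k with
      | zero => exact ⟨[], by simp, rfl⟩
      | succ k =>
        obtain ⟨u, h1, h2⟩ := ih (k := k) (by omega)
        exact ⟨a :: u, by simpa using h1, by simp [h2]⟩
    · rw [List.count_cons_of_ne ha] at hk
      obtain ⟨u, h1, h2⟩ := ih hk
      exact ⟨a :: u, by simpa using h1, by rw [List.count_cons_of_ne ha, h2]⟩

section Detour

variable {N : LineNetwork} {σ : List (Request N.n)}

/-- The source vertex of a request in the untilted grid. -/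
def Request.point {n : ℕ} (q : Request n) : Tile := ((q.src : ℕ), q.column)

theorem Packs.card_crossing_le {O : Finset (Fin σ.length)} {path : Fin σ.length → List Move}
    (h : Packs N σ O path) {S : Finset (Fin σ.length)} (hS : S ⊆ O) (e : SketchEdge)
    (he : ∀ i ∈ S, e ∈ sketchEdges (σ.get i).point (path i)) : S.card ≤ N.cap e.2 := by
  refine h.cap e.2 e.1.1.toNat (e.1.2 + e.1.1).toNat S hS ?_
  intro i hi
  obtain ⟨j, m, h1, h2⟩ := mem_sketchEdges.1 (he i hi)
  subst h2
  refine ⟨j, h1, ?_, ?_⟩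
  · simp only [walk, Request.point, Request.nodeAfter]; omega
  · have h3 := count_forward_add_count_hold ((path i).take j)
    have h4 : j < (path i).length := by
      by_contra h'
      rw [List.getElem?_eq_none (not_lt.1 h')] at h1
      cases h1
    rw [List.length_take, min_eq_left h4.le] at h3
    simp only [walk, Request.point, Request.column]
    omega

/-- Every packing may be changed such that the paths have few horizontal edges, if the load may
double. -/
theorem Packs.exists_short (hN : N.Valid) {O : Finset (Fin σ.length)}
    {path : Fin σ.length → List Move} (h : Packs N σ O path) :
    ∃ path' : Fin σ.length → List Move,
      (∀ i ∈ O, (σ.get i).nodeAfter (path' i) = (σ.get i).dst ∧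
        (path' i).count .hold ≤ 2 * N.window) ∧
      ∀ (e : SketchEdge) (S : Finset (Fin σ.length)), S ⊆ O →
        (∀ i ∈ S, e ∈ sketchEdges (σ.get i).point (path' i)) → S.card ≤ 2 * N.cap e.2 := by
  classical
  have hW : (0 : ℤ) < N.window := by exact_mod_cast Nat.succ_pos _
  -- the boundary of the window of the source
  let bd : Fin σ.length → ℤ := fun i => N.window * ((σ.get i).column / N.window + 1)
  have hbd : ∀ i, (σ.get i).column < bd i ∧ bd i ≤ (σ.get i).column + N.window := by
    intro i
    have h1 := Int.mul_ediv_add_emod (σ.get i).column N.window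
    have h2 := Int.emod_nonneg (σ.get i).column hW.ne'
    have h3 := Int.emod_lt_of_pos (σ.get i).column hW
    have h4 : bd i = N.window * ((σ.get i).column / N.window) + N.window := by simp only [bd]; ring
    rw [h4]
    omega
  -- A path is changed only if it reaches the end of the window of its source. It is followed up to
  -- that boundary, then waits for `w` steps, and finally goes straight north.
  let Long : Fin σ.length → Prop := fun i => bd i ≤ (σ.get i).column + (path i).count .hold
  have hcut : ∀ i, ∃ u, Long i → u ++ [Move.hold] <+: path i ∧
      (σ.get i).column + u.count .hold + 1 = bd i := by
    intro i
    by_cases hl : Long i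
    · have h1 := hbd i
      obtain ⟨u, h2, h3⟩ := exists_prefix_count (w := path i) (m := .hold)
        (k := (bd i - (σ.get i).column - 1).toNat) (by simp only [Long] at hl; omega)
      exact ⟨u, fun _ => ⟨h2, by omega⟩⟩
    · exact ⟨[], fun h => absurd h hl⟩
  choose u hu using hcut
  -- the node at which the detour starts
  let v : Fin σ.length → ℕ := fun i => (σ.get i).src + (u i).count .forward
  let G : ℕ → ℤ → Finset (Fin σ.length) := fun v' T => O.filter fun i => Long i ∧ v i = v' ∧
      bd i = T
  -- Long paths that reach the boundary `T` at node `v'` all use the same horizontal edge, the one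
  -- that leaves column `T - 1`.
  have hG : ∀ v' T, (G v' T).card ≤ N.B := by
    intro v' T
    refine h.card_crossing_le (Finset.filter_subset _ _) (((v' : ℤ), T - 1), .hold) ?_
    intro i hi
    obtain ⟨-, hl, rfl, rfl⟩ := Finset.mem_filter.1 hi
    apply sketchEdges_subset_of_prefix (hu i hl).1
    rw [sketchEdges_append, List.mem_append]
    right
    have := (hu i hl).2
    simp only [sketchEdges, List.mem_singleton, walk, Request.point, Prod.mk.injEq, and_true]
    constructor
    · simp only [v]; push_cast; rfl
    · omega
  -- `β` numbers the paths that cross the boundary by the same edge, from `0` to `B - 1`.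
  let β : Fin σ.length → ℕ := fun i => keyRank (G (v i) (bd i)) id i
  have hβ : ∀ i ∈ O, Long i → β i < N.B := by
    intro i hi hl
    refine lt_of_lt_of_le ?_ (hG (v i) (bd i))
    apply Finset.card_lt_card
    rw [Finset.ssubset_iff_of_subset (Finset.filter_subset _ _)]
    exact ⟨i, Finset.mem_filter.2 ⟨hi, hl, rfl, rfl⟩, by simp⟩
  let w : Fin σ.length → ℕ := fun i => (v i * N.B + β i) / N.c
  let path' : Fin σ.length → List Move := fun i =>
    if Long i then (u i ++ [.hold]) ++ (List.replicate (w i) .hold ++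
      List.replicate ((σ.get i).dst - v i) .forward)
    else path i
  have hv : ∀ i ∈ O, Long i → v i ≤ (σ.get i).dst := by
    intro i hi hl
    have h1 := h.dst i hi
    have h2 := (hu i hl).1.sublist.count_le .forward
    unfold Request.nodeAfter at h1
    simp only [List.count_append, List.count_singleton] at h2
    simp only [v]; omega
  have hw : ∀ i ∈ O, Long i → w i < N.window := by
    intro i hi hl
    unfold LineNetwork.window
    apply Nat.lt_succ_of_le
    apply Nat.div_le_div_right
    have h1 := hv i hi hl
    have h2 := (σ.get i).dst.2
    have h3 := hβ i hi hl
    calc v i * N.B + β i ≤ v i * N.B + N.B := by omega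
      _ = (v i + 1) * N.B := by ring
      _ ≤ N.n * N.B := Nat.mul_le_mul_right _ (by omega)
  have hwin : ∀ {a x : ℤ}, N.window * a ≤ x → x < N.window * a + N.window → a = x / N.window := by
    intro a x h1 h2
    have e : x = (x - N.window * a) + N.window * a := by ring
    rw [e, Int.add_mul_ediv_left _ _ hW.ne', Int.ediv_eq_zero_of_lt (by omega) (by omega), zero_add]
  refine ⟨path', ?_, ?_⟩
  · intro i hi
    simp only [path']
    split_ifs with hl
    · have h1 := hv i hi hl
      have h2 := hw i hi hl
      have h3 := (hu i hl).2
      have h4 := hbd i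
      constructor
      · simp only [Request.nodeAfter, List.count_append, List.count_replicate, List.count_singleton]
        simp only [v] at h1 ⊢
        simp
        simp at h1
        omega
      · simp only [List.count_append, List.count_replicate, List.count_singleton]
        simp
        omega
    · refine ⟨h.dst i hi, ?_⟩
      have := hbd i
      simp only [Long] at hl
      omega
  · rintro ⟨⟨y, x⟩, m⟩ S hS he
    -- A user of the edge uses it on its original path or on its detour. Each kind respects the
    -- capacity by itself, so the load at most doubles.
    have hsplit : ∀ i ∈ S, ((y, x), m) ∈ sketchEdges (σ.get i).point (path i) ∨
        (Long i ∧ ((m = .hold ∧ (v i : ℤ) = y ∧ bd i ≤ x ∧ x < bd i + w i) ∨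
          (m = .forward ∧ x = bd i + w i))) := by
      intro i hi
      have h1 := he i hi
      simp only [path'] at h1
      split_ifs at h1 with hl
      · rw [sketchEdges_append, List.mem_append] at h1
        have hwalk : walk (σ.get i).point (u i ++ [.hold]) = ((v i : ℤ), bd i) := by
          rw [← (hu i hl).2]
          simp [walk, Request.point, v, add_assoc]
        rw [hwalk, sketchEdges_append ((v i : ℤ), bd i), List.mem_append] at h1
        rcases h1 with h1 | h1 | h1
        · exact Or.inl (sketchEdges_subset_of_prefix (hu i hl).1 h1)
        · right
          obtain ⟨rfl, j, hj, h2⟩ := mem_sketchEdges_replicate h1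
          simp only [walk, List.count_replicate, Prod.mk.injEq] at h2
          refine ⟨hl, Or.inl ⟨rfl, ?_, ?_, ?_⟩⟩
          · rw [h2.1]; simp
          · rw [h2.2]; simp
          · rw [h2.2]; simpa using hj
        · right
          obtain ⟨rfl, j, hj, h2⟩ := mem_sketchEdges_replicate h1
          simp only [walk, List.count_replicate, Prod.mk.injEq] at h2
          refine ⟨hl, Or.inr ⟨rfl, ?_⟩⟩
          rw [h2.2]; simp
      · exact Or.inl h1
    set S1 := S.filter fun i => ((y, x), m) ∈ sketchEdges (σ.get i).point (path i) with hS1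
    set S2 := S.filter fun i => ¬ ((y, x), m) ∈ sketchEdges (σ.get i).point (path i) with hS2
    have hcard : S1.card + S2.card = S.card := Finset.card_filter_add_card_filter_not _
    have hc1 : S1.card ≤ N.cap m := h.card_crossing_le ((Finset.filter_subset _ _).trans hS)
      ((y, x), m) fun i hi => (Finset.mem_filter.1 hi).2
    have hc2 : S2.card ≤ N.cap m := by
      have hinfo : ∀ i ∈ S2, i ∈ O ∧ Long i ∧ ((m = .hold ∧ (v i : ℤ) = y ∧ bd i ≤ x ∧
          x < bd i + w i) ∨ (m = .forward ∧ x = bd i + w i)) := by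
        intro i hi
        obtain ⟨h1, h2⟩ := Finset.mem_filter.1 hi
        exact ⟨hS h1, (hsplit i h1).resolve_left h2⟩
      -- A detour stays in the window that begins at its boundary, so the column `x` determines the
      -- boundary.
      have hbdx : ∀ i ∈ S2, bd i = N.window * (x / N.window) := by
        intro i hi
        obtain ⟨h1, h2, h3⟩ := hinfo i hi
        have h4 := hw i h1 h2
        have := hwin (a := (σ.get i).column / N.window + 1) (x := x)
          (by change bd i ≤ x; omega) (by change x < bd i + _; omega)
        simp only [bd]; rw [this]
      cases m
      · -- the columns of the vertical parts of the detours
        have hval : ∀ i ∈ S2, N.c * (x - N.window * (x / N.window)).toNat ≤ v i * N.B + β i ∧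
            v i * N.B + β i < N.c * (x - N.window * (x / N.window)).toNat + N.c := by
          intro i hi
          obtain ⟨h1, h2, h3⟩ := hinfo i hi
          have h4 := hbdx i hi
          have h5 : (x - N.window * (x / N.window)).toNat = w i := by
            rcases h3 with h3 | h3
            · cases h3.1
            · omega
          rw [h5]
          have h6 := Nat.div_add_mod (v i * N.B + β i) N.c
          have h7 := Nat.mod_lt (v i * N.B + β i) (show N.c > 0 from hN.c_pos)
          simp only [w]
          omega
        -- The column leaves `c` possible values of `v * B + β`. Since `β < B`, such a value
        -- determines `v` and `β`, and these identify the request at a given boundary.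
        calc S2.card ≤ (Finset.Ico (N.c * (x - N.window * (x / N.window)).toNat)
              (N.c * (x - N.window * (x / N.window)).toNat + N.c)).card := by
              refine Finset.card_le_card_of_injOn (fun i => v i * N.B + β i) ?_ ?_
              · intro i hi
                simpa using hval i hi
              · intro i hi i' hi' heq
                dsimp only at heq
                obtain ⟨h1, h2, -⟩ := hinfo i hi
                obtain ⟨h1', h2', -⟩ := hinfo i' hi'
                have h3 := hβ i h1 h2
                have h3' := hβ i' h1' h2'
                have h4 : v i = v i' := by
                  have e1 : (v i * N.B + β i) / N.B = v i := by
                    rw [mul_comm, Nat.mul_add_div (by omega), Nat.div_eq_of_lt h3, add_zero]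
                  have e2 : (v i' * N.B + β i') / N.B = v i' := by
                    rw [mul_comm, Nat.mul_add_div (by omega), Nat.div_eq_of_lt h3', add_zero]
                  rw [← e1, ← e2, heq]
                have h5 : β i = β i' := by rw [h4] at heq; omega
                have h6 : bd i = bd i' := by rw [hbdx i hi, hbdx i' hi']
                refine keyRank_injOn (S := G (v i) (bd i)) (f := id) (Set.injOn_id _)
                  (Finset.mem_coe.2 (Finset.mem_filter.2 ⟨h1, h2, rfl, rfl⟩))
                  (Finset.mem_coe.2 (Finset.mem_filter.2 ⟨h1', h2', h4.symm, h6.symm⟩)) ?_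
                have h7 : β i' = keyRank (G (v i) (bd i)) id i' := by
                  simp only [β]; rw [h4, h6]
                rw [← h7]; exact h5
          _ = N.c := by simp
      · refine le_trans (Finset.card_le_card ?_) (hG y.toNat (N.window * (x / N.window)))
        intro i hi
        obtain ⟨h1, h2, h3⟩ := hinfo i hi
        refine Finset.mem_filter.2 ⟨h1, h2, ?_, hbdx i hi⟩
        rcases h3 with h3 | h3
        · omega
        · cases h3.1
    dsimp only
    omega

end Detour

/-! ### The sketch path of a grid path -/

section Coarsen

variable (N : LineNetwork) (ω : Coins)

/-- The tile of a vertex of the untilted grid. -/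
noncomputable def coarse (P : Tile) : Tile :=
  ((P.1 - ω.phaseSpace) / N.Q, (P.2 - ω.phaseTime) / N.tau)

/-- The sketch path that a grid path induces. -/
noncomputable def coarsen : Tile → List Move → List Move
  | _, [] => []
  | P, m :: l => if coarse N ω (nextTile P m) = coarse N ω P then coarsen (nextTile P m) l
      else m :: coarsen (nextTile P m) l

variable {N ω}

/-- The last coordinate of a tile in direction `m`. -/
noncomputable def border (N : LineNetwork) (ω : Coins) (s : Tile) : Move → ℤ
  | .forward => ω.phaseSpace + N.Q * s.1 + N.Q - 1
  | .hold => ω.phaseTime + N.tau * s.2 + N.tau - 1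

/-- The coordinate of a vertex in direction `m`. -/
def coordinate (P : Tile) : Move → ℤ
  | .forward => P.1
  | .hold => P.2

theorem coarse_nextTile (hN : N.Valid) (P : Tile) (m : Move) :
    coarse N ω (nextTile P m) = coarse N ω P ∨
      (coarse N ω (nextTile P m) = nextTile (coarse N ω P) m ∧
        coordinate P m = border N ω (coarse N ω P) m) := by
  have hQ : (0 : ℤ) < N.Q := by exact_mod_cast hN.Q_pos
  have hτ : (0 : ℤ) < N.tau := by exact_mod_cast hN.tau_pos
  cases m
  · have h0 := Int.mul_ediv_add_emod (P.1 - ω.phaseSpace) N.Q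
    have e : P.1 + 1 - ω.phaseSpace = P.1 - ω.phaseSpace + 1 := by ring
    rcases ediv_emod_add_one (a := P.1 - ω.phaseSpace) hQ with ⟨h1, h2, h3⟩ | ⟨h1, h2, h3⟩
    · left; simp only [coarse, nextTile, e, h2]
    · right
      simp only [coarse, nextTile, e, h2, coordinate, border, true_and]
      omega
  · have h0 := Int.mul_ediv_add_emod (P.2 - ω.phaseTime) N.tau
    have e : P.2 + 1 - ω.phaseTime = P.2 - ω.phaseTime + 1 := by ring
    rcases ediv_emod_add_one (a := P.2 - ω.phaseTime) hτ with ⟨h1, h2, h3⟩ | ⟨h1, h2, h3⟩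
    · left; simp only [coarse, nextTile, e, h2]
    · right
      simp only [coarse, nextTile, e, h2, coordinate, border, true_and]
      omega

theorem walk_coarsen (hN : N.Valid) (P : Tile) (l : List Move) :
    walk (coarse N ω P) (coarsen N ω P l) = coarse N ω (walk P l) := by
  induction l generalizing P with
  | nil => simp [coarsen]
  | cons m l ih =>
    rw [coarsen, walk_cons, ← ih]
    split_ifs with h
    · rw [h]
    · rw [walk_cons, ← ((coarse_nextTile hN P m).resolve_left h).1]

/-- A step of the coarsened path stems from a grid edge across the border of the tile, so the load
of a sketch edge is distributed over the grid edges of that border. -/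
theorem mem_sketchEdges_coarsen (hN : N.Valid) {P s : Tile} {l : List Move} {m : Move}
    (h : (s, m) ∈ sketchEdges (coarse N ω P) (coarsen N ω P l)) :
    ∃ P', (P', m) ∈ sketchEdges P l ∧ coarse N ω P' = s ∧ coordinate P' m = border N ω s m := by
  induction l generalizing P with
  | nil => simp [coarsen, sketchEdges] at h
  | cons a l ih =>
    rw [coarsen] at h
    rw [sketchEdges]
    split_ifs at h with h'
    · rw [← h'] at h
      obtain ⟨P', h1, h2⟩ := ih h
      exact ⟨P', List.mem_cons_of_mem _ h1, h2⟩
    · obtain ⟨h1, h2⟩ := (coarse_nextTile hN P a).resolve_left h'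
      rw [sketchEdges, ← h1, List.mem_cons] at h
      rcases h with h | h
      · rw [Prod.mk.injEq] at h
        obtain ⟨rfl, rfl⟩ := h
        exact ⟨P, List.mem_cons_self, rfl, h2⟩
      · obtain ⟨P', h1, h2⟩ := ih h
        exact ⟨P', List.mem_cons_of_mem _ h1, h2⟩

theorem coarse_point (q : Request N.n) : coarse N ω q.point = sourceTile N ω q := by
  simp [coarse, Request.point, Request.column, sourceTile, tileOf, tileRow, tileCol]

variable {σ : List (Request N.n)}

/-- If the load of grid edges is at most twice their capacity, then the load of sketch edges is at
most four times their capacity. -/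
theorem card_sketch_users_le (hN : N.Valid) {O : Finset (Fin σ.length)}
    {path : Fin σ.length → List Move}
    (hload : ∀ (e : SketchEdge) (S : Finset (Fin σ.length)), S ⊆ O →
      (∀ i ∈ S, e ∈ sketchEdges (σ.get i).point (path i)) → S.card ≤ 2 * N.cap e.2)
    (e : SketchEdge) {S : Finset (Fin σ.length)} (hS : S ⊆ O)
    (he : ∀ i ∈ S, e ∈ sketchEdges (sourceTile N ω (σ.get i))
      (coarsen N ω (σ.get i).point (path i))) : S.card ≤ 4 * N.cS := by
  classical
  obtain ⟨s, m⟩ := e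
  have hex : ∀ i : Fin σ.length, ∃ P' : Tile, i ∈ S → (P', m) ∈ sketchEdges (σ.get i).point
      (path i) ∧
      coarse N ω P' = s ∧ coordinate P' m = border N ω s m := by
    intro i
    by_cases hi : i ∈ S
    · have h1 := he i hi
      rw [← coarse_point] at h1
      obtain ⟨P', h2⟩ := mem_sketchEdges_coarsen hN h1
      exact ⟨P', fun _ => h2⟩
    · exact ⟨(0, 0), fun h => absurd h hi⟩
  choose P hP using hex
  have hQ : (0 : ℤ) < N.Q := by exact_mod_cast hN.Q_pos
  have hτ : (0 : ℤ) < N.tau := by exact_mod_cast hN.tau_pos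
  -- Each path is assigned the grid edge by which it crosses the border. There are `τ` or `Q`
  -- candidates with load at most twice their capacity, and `max_le_cS` contributes the other factor
  -- of two.
  have key : ∀ t : Finset Tile, (∀ i ∈ S, P i ∈ t) → S.card ≤ 2 * N.cap m * t.card := by
    intro t ht
    refine Finset.card_le_mul_card_image_of_maps_to ht _ ?_
    intro P' _
    refine hload (P', m) _ ((Finset.filter_subset _ _).trans hS) ?_
    intro i hi
    obtain ⟨h1, h2⟩ := Finset.mem_filter.1 hi
    rw [← h2]; exact (hP i h1).1
  have hin : ∀ i ∈ S, ω.phaseSpace + N.Q * s.1 ≤ (P i).1 ∧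
      (P i).1 < ω.phaseSpace + N.Q * s.1 + N.Q ∧ ω.phaseTime + N.tau * s.2 ≤ (P i).2 ∧
      (P i).2 < ω.phaseTime + N.tau * s.2 + N.tau := by
    intro i hi
    have h1 := (hP i hi).2.1
    have h2 := Int.mul_ediv_add_emod ((P i).1 - ω.phaseSpace) N.Q
    have h3 := Int.emod_nonneg ((P i).1 - ω.phaseSpace) hQ.ne'
    have h4 := Int.emod_lt_of_pos ((P i).1 - ω.phaseSpace) hQ
    have h5 := Int.mul_ediv_add_emod ((P i).2 - ω.phaseTime) N.tau
    have h6 := Int.emod_nonneg ((P i).2 - ω.phaseTime) hτ.ne'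
    have h7 := Int.emod_lt_of_pos ((P i).2 - ω.phaseTime) hτ
    have h8 := congrArg Prod.fst h1
    have h9 := congrArg Prod.snd h1
    simp only [coarse] at h8 h9
    rw [h8] at h2
    rw [h9] at h5
    refine ⟨?_, ?_, ?_, ?_⟩ <;> omega
  have hmax := hN.max_le_cS
  cases m
  · have h1 := key ({border N ω s .forward} ×ˢ
      Finset.Ico (ω.phaseTime + N.tau * s.2) (ω.phaseTime + N.tau * s.2 + N.tau)) ?_
    · rw [Finset.card_product, Finset.card_singleton, one_mul, Int.card_Ico] at h1
      have e1 : (ω.phaseTime + N.tau * s.2 + N.tau - (ω.phaseTime + N.tau * s.2)).toNat =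
          N.tau := by
        omega
      rw [e1] at h1
      calc S.card ≤ 2 * N.c * N.tau := h1
        _ = 2 * (N.tau * N.c) := by ring
        _ ≤ 4 * N.cS := by omega
    · intro i hi
      have h2 := hin i hi
      rw [Finset.mem_product, Finset.mem_singleton, Finset.mem_Ico]
      exact ⟨(hP i hi).2.2, h2.2.2.1, h2.2.2.2⟩
  · have h1 := key (Finset.Ico (ω.phaseSpace + N.Q * s.1) (ω.phaseSpace + N.Q * s.1 + N.Q) ×ˢ
      {border N ω s .hold}) ?_
    · rw [Finset.card_product, Finset.card_singleton, mul_one, Int.card_Ico] at h1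
      have e1 : (ω.phaseSpace + N.Q * s.1 + N.Q - (ω.phaseSpace + N.Q * s.1)).toNat = N.Q := by
        omega
      rw [e1] at h1
      calc S.card ≤ 2 * N.B * N.Q := h1
        _ = 2 * (N.Q * N.B) := by ring
        _ ≤ 4 * N.cS := by omega
    · intro i hi
      have h2 := hin i hi
      rw [Finset.mem_product, Finset.mem_singleton, Finset.mem_Ico]
      exact ⟨⟨h2.1, h2.2.1⟩, (hP i hi).2.2⟩

/-- A grid path with few horizontal edges induces legal sketch paths to the rows on its way. -/
theorem exists_legal_prefix (hN : N.Valid) (q : Request N.n) {l : List Move}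
    (hdst : q.nodeAfter l = q.dst) (hhold : l.count .hold ≤ 2 * N.window) {R : ℤ}
    (hR : (sourceTile N ω q).1 < R) (hR' : R ≤ tileRow N ω (q.dst : ℕ)) :
    ∃ w, IsLegalSketchPath N (sourceTile N ω q) R w ∧
      sketchEdges (sourceTile N ω q) w ⊆ sketchEdges (sourceTile N ω q)
        (coarsen N ω q.point l) := by
  have hτ : (0 : ℤ) < N.tau := by exact_mod_cast hN.tau_pos
  have hwalk := walk_coarsen (ω := ω) hN q.point l
  rw [coarse_point] at hwalk
  have h1 : (sourceTile N ω q).1 + ((coarsen N ω q.point l).count .forward : ℤ) =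
      tileRow N ω (q.dst : ℕ) := by
    have := congrArg Prod.fst hwalk
    simp only [walk, coarse] at this
    have hp : q.point.1 = ((q.src : ℕ) : ℤ) := rfl
    rw [this, tileRow, hp]
    unfold Request.nodeAfter at hdst
    congr 2
    omega
  have h2 : (sourceTile N ω q).2 + ((coarsen N ω q.point l).count .hold : ℤ) ≤
      (sourceTile N ω q).2 + (N.n + 1) := by
    have h3 := congrArg Prod.snd hwalk
    simp only [walk, coarse] at h3
    have hp : q.point.2 = q.column := rfl
    rw [h3, hp]
    have h4 := hN.window_le
    have h5 : (sourceTile N ω q).2 = (q.column - ω.phaseTime) / N.tau := rfl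
    rw [h5, ← Int.add_mul_ediv_left _ _ hτ.ne']
    apply Int.ediv_le_ediv hτ
    have h6 : ((l.count .hold : ℕ) : ℤ) ≤ N.tau * (N.n + 1) := by
      exact_mod_cast hhold.trans h4
    omega
  have h3 := tileRow_sub_le (ω := ω) hN (v := (q.src : ℕ)) (v' := (q.dst : ℕ))
    (by exact_mod_cast q.src_le_dst)
  have h4 : (sourceTile N ω q).1 = tileRow N ω (q.src : ℕ) := rfl
  have h5 := q.dst.2
  have h6 := count_forward_add_count_hold (coarsen N ω q.point l)
  obtain ⟨u, h7, h8⟩ := exists_prefix_count (w := coarsen N ω q.point l) (m := .forward)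
    (k := (R - (sourceTile N ω q).1 - 1).toNat) (by omega)
  refine ⟨u ++ [.forward], ⟨?_, ?_, ?_⟩, sketchEdges_subset_of_prefix h7⟩
  · rw [List.count_append, h8]
    simp
    omega
  · simp
  -- There are fewer than `n` vertical and at most `n + 1` horizontal steps, well below `4n`.
  · refine h7.length_le.trans ?_
    unfold LineNetwork.pmax
    have := hN.n_gt
    omega

end Coarsen

/-! ### Path packing against the optimum -/

section Dual

variable {N : LineNetwork} {lightest : Oracle} {ω : Coins} {σ : List (Request N.n)}

/-- The order of the requests by destination, and then by index. -/
def destinationKey (σ : List (Request N.n)) (i : Fin σ.length) : ℕ ×ₗ ℕ :=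
  toLex (((σ.get i).dst : ℕ), (i : ℕ))

theorem destinationKey_injective (σ : List (Request N.n)) :
    Function.Injective (destinationKey σ) := by
  intro i j h
  exact Fin.ext (congrArg (fun z => (ofLex z).2) h)

open Classical in
/-- The requests of `Far⁺` with the same source vertex as `i`. -/
noncomputable def farPlusAt (N : LineNetwork) (ω : Coins) (σ : List (Request N.n))
    (i : Fin σ.length) : Finset (Fin σ.length) :=
  Finset.univ.filter fun j => IsFarPlus N ω (σ.get j) ∧ (σ.get j).src = (σ.get i).src ∧
    (σ.get j).time = (σ.get i).time

/-- The rank computed from the batch becomes a rank in a finite set, to which the exchange argument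
applies. -/
theorem planeOf_eq_keyRank (i : Fin σ.length) :
    planeOf N ω σ (σ.get i, (i : ℕ)) = keyRank (farPlusAt N ω σ i) (destinationKey σ) i := by
  classical
  unfold planeOf rank keyRank
  rw [← List.toFinset_card_of_nodup ((nodup_arrivals σ _).filter _)]
  symm
  refine Finset.card_bij (fun j _ => (σ.get j, (j : ℕ))) ?_ ?_ ?_
  · intro j hj
    simp only [farPlusAt, Finset.mem_filter, Finset.mem_univ, true_and, destinationKey,
      Prod.Lex.toLex_lt_toLex] at hj
    simp only [List.mem_toFinset, List.mem_filter, mem_arrivals, decide_eq_true_eq]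
    obtain ⟨⟨h1, h2, h3⟩, h4⟩ := hj
    refine ⟨⟨by simp, h3⟩, h2, h1, ?_⟩
    rcases h4 with h4 | h4
    · exact Or.inl (Fin.lt_def.2 h4)
    · exact Or.inr ⟨Fin.ext h4.1, h4.2⟩
  · intro j _ j' _ h
    exact Fin.ext (congrArg Prod.snd h)
  · rintro ⟨q, j⟩ hq
    simp only [List.mem_toFinset, List.mem_filter, mem_arrivals, decide_eq_true_eq] at hq
    obtain ⟨⟨h1, h2⟩, h3, h4, h5⟩ := hq
    obtain ⟨hlt, hget⟩ := List.getElem?_eq_some_iff.1 h1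
    refine ⟨⟨j, hlt⟩, ?_, Prod.ext hget rfl⟩
    have hget' : σ.get ⟨j, hlt⟩ = q := hget
    simp only [farPlusAt, Finset.mem_filter, Finset.mem_univ, true_and, destinationKey,
      Prod.Lex.toLex_lt_toLex, hget']
    refine ⟨⟨h4, h3, h2⟩, ?_⟩
    rcases h5 with h5 | h5
    · exact Or.inl (Fin.lt_def.1 h5)
    · exact Or.inr ⟨congrArg Fin.val h5.1, h5.2⟩

/-- The optimal routing can be exchanged for one of the requests with the closest destinations. -/
theorem exists_exchange {O : Finset (Fin σ.length)} {path : Fin σ.length → List Move}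
    (hO : Packs N σ O path) (hfar : ∀ i ∈ O, IsFarPlus N ω (σ.get i)) :
    ∃ f : Fin σ.length → Fin σ.length, Set.InjOn f O ∧ ∀ i ∈ O,
      Considered N ω σ (σ.get (f i), (f i : ℕ)) ∧ (σ.get (f i)).src = (σ.get i).src ∧
      (σ.get (f i)).time = (σ.get i).time ∧ (σ.get (f i)).dst ≤ (σ.get i).dst := by
  classical
  -- The routed request of rank `r` at a vertex is exchanged for the request of rank `r` among all
  -- of `Far⁺` at that vertex. Its destination is not further away, and `r < B + c` because the
  -- optimum routes at most `B + c` requests from there.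
  let V : Fin σ.length → Finset (Fin σ.length) := fun i =>
    O.filter fun j => (σ.get j).src = (σ.get i).src ∧ (σ.get j).time = (σ.get i).time
  have hVS : ∀ i, V i ⊆ farPlusAt N ω σ i := by
    intro i j hj
    obtain ⟨h1, h2⟩ := Finset.mem_filter.1 hj
    simp only [farPlusAt, Finset.mem_filter, Finset.mem_univ, true_and]
    exact ⟨hfar j h1, h2⟩
  have hVi : ∀ i ∈ O, i ∈ V i := fun i hi => Finset.mem_filter.2 ⟨hi, rfl, rfl⟩
  have hex : ∀ i, ∃ j, i ∈ O → j ∈ farPlusAt N ω σ i ∧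
      keyRank (farPlusAt N ω σ i) (destinationKey σ) j = keyRank (V i) (destinationKey σ) i ∧
      destinationKey σ j ≤ destinationKey σ i := by
    intro i
    by_cases hi : i ∈ O
    · obtain ⟨j, h1, h2, h3⟩ := exists_keyRank_eq (S := farPlusAt N ω σ i) (f := destinationKey σ)
        (destinationKey_injective σ).injOn (hVS i (hVi i hi))
        (k := keyRank (V i) (destinationKey σ) i)
        (Finset.card_le_card (Finset.filter_subset_filter _ (hVS i)))
      exact ⟨j, fun _ => ⟨h1, h2, h3⟩⟩
    · exact ⟨i, fun h => absurd h hi⟩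
  choose f hf using hex
  have hsame : ∀ i ∈ O, IsFarPlus N ω (σ.get (f i)) ∧ (σ.get (f i)).src = (σ.get i).src ∧
      (σ.get (f i)).time = (σ.get i).time := by
    intro i hi
    have := (hf i hi).1
    simpa only [farPlusAt, Finset.mem_filter, Finset.mem_univ, true_and] using this
  refine ⟨f, ?_, ?_⟩
  · intro i hi i' hi' heq
    have h1 := hsame i hi
    have h2 := hsame i' hi'
    have hS : farPlusAt N ω σ i = farPlusAt N ω σ i' := by
      unfold farPlusAt
      rw [← h1.2.1, ← h1.2.2, ← h2.2.1, ← h2.2.2, heq]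
    have hV : V i = V i' := by
      simp only [V]
      rw [← h1.2.1, ← h1.2.2, ← h2.2.1, ← h2.2.2, heq]
    have h3 := (hf i hi).2.1
    have h4 := (hf i' hi').2.1
    rw [heq, hS, h4, hV] at h3
    exact (keyRank_injOn (destinationKey_injective σ).injOn (hVi i' hi')
      (by rw [← hV]; exact hVi i hi) h3).symm
  · intro i hi
    have h1 := hsame i hi
    obtain ⟨-, h3, h4⟩ := hf i hi
    refine ⟨⟨h1.1, ?_⟩, h1.2.1, h1.2.2, ?_⟩
    · rw [planeOf_eq_keyRank]
      have hS : farPlusAt N ω σ (f i) = farPlusAt N ω σ i := by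
        unfold farPlusAt
        rw [h1.2.1, h1.2.2]
      rw [hS, h3]
      refine lt_of_lt_of_le ?_ (hO.card_source_le (S := V i) (Finset.filter_subset _ _)
        (v := (σ.get i).src) (t := (σ.get i).time) ?_)
      · apply Finset.card_lt_card
        rw [Finset.ssubset_iff_of_subset (Finset.filter_subset _ _)]
        exact ⟨i, hVi i hi, by simp⟩
      · intro j hj
        obtain ⟨h5, h6, h7⟩ := Finset.mem_filter.1 hj
        refine ⟨by rw [h6], h7, ?_⟩
        rcases (σ.get j).src_le_dst.eq_or_lt with h8 | h8
        · exfalso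
          apply (hfar j h5).1
          unfold IsNear; rw [h8]
        · exact h8
    · unfold destinationKey at h4
      rw [Prod.Lex.toLex_le_toLex] at h4
      rw [Fin.le_def]
      rcases h4 with h4 | h4
      · exact h4.le
      · exact h4.1.le

/-- The online path packing accepts a constant fraction of the requests of `Far⁺` that can be
routed. -/
theorem packing_competitive (hN : N.Valid) (horacle : IsLightestPathOracle N lightest)
    {O : Finset (Fin σ.length)} {path : Fin σ.length → List Move}
    (hO : Packs N σ O path) (hfar : ∀ i ∈ O, IsFarPlus N ω (σ.get i)) {T : ℕ}
    (hT : ∀ i (h : i < σ.length), σ[i].time < T) :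
    (O.card : ℝ) ≤ 9 * (packing N lightest ω σ (handled σ T)).accepted.card := by
  classical
  set g := packing N lightest ω σ (handled σ T) with hg
  have hI : PackingInvariant N ω σ (handled σ T) g := packingInvariant hN horacle T
  obtain ⟨f, hfinj, hf⟩ := exists_exchange hO hfar
  obtain ⟨path', hp1, hp2⟩ := hO.exists_short hN
  -- The path of `i` passes the row of the closer destination of `f i`, so a prefix of its sketch
  -- path is legal for `f i`.
  have hex : ∀ i, ∃ w, i ∈ O →
      IsLegalSketchPath N (sourceTile N ω (σ.get i)) (tileRow N ω ((σ.get (f i)).dst : ℕ)) w ∧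
      sketchEdges (sourceTile N ω (σ.get i)) w ⊆
        sketchEdges (sourceTile N ω (σ.get i)) (coarsen N ω (σ.get i).point (path' i)) := by
    intro i
    by_cases hi : i ∈ O
    · obtain ⟨h1, h2, h3, h4⟩ := hf i hi
      have h5 := sourceTile_row_lt h1.1.1
      have h6 : sourceTile N ω (σ.get (f i)) = sourceTile N ω (σ.get i) := by
        unfold sourceTile; rw [h2, h3]
      rw [h6] at h5
      obtain ⟨w, hw⟩ := exists_legal_prefix (ω := ω) hN (σ.get i) (hp1 i hi).1 (hp1 i hi).2 h5
        (tileRow_mono N ω (by exact_mod_cast h4))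
      exact ⟨w, fun _ => hw⟩
    · exact ⟨[], fun h => absurd h hi⟩
  choose w hw using hex
  let es : Fin σ.length → Finset SketchEdge := fun i =>
    (sketchEdges (sourceTile N ω (σ.get i)) (w i)).toFinset
  let E : Finset SketchEdge := O.biUnion es
  set O1 := O.filter fun i => (f i : ℕ) ∈ g.accepted with hO1
  set O2 := O.filter fun i => ¬ (f i : ℕ) ∈ g.accepted with hO2
  have hsplit : O1.card + O2.card = O.card := Finset.card_filter_add_card_filter_not _
  have h1 : O1.card ≤ g.accepted.card := by
    refine Finset.card_le_card_of_injOn (fun i => (f i : ℕ)) ?_ ?_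
    · intro i hi; exact (Finset.mem_filter.1 hi).2
    · intro i hi i' hi' h
      exact hfinj (Finset.mem_filter.1 hi).1 (Finset.mem_filter.1 hi').1 (Fin.ext h)
  -- Weak duality: each rejected request has a path of weight at least `1`, these paths load an edge
  -- at most `4 c^S` times, and `c^S` times the total weight is at most twice the number of accepted
  -- requests.
  have h2 : (O2.card : ℝ) ≤ 8 * g.accepted.card := by
    have hone : ∀ i ∈ O2, 1 ≤ ∑ e ∈ es i, g.weight e := by
      intro i hi
      obtain ⟨hi, hna⟩ := Finset.mem_filter.1 hi
      obtain ⟨a1, a2, a3, a4⟩ := hf i hi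
      have a5 : sourceTile N ω (σ.get (f i)) = sourceTile N ω (σ.get i) := by
        unfold sourceTile; rw [a2, a3]
      have a6 : (σ.get (f i), (f i : ℕ)) ∈ handled σ T := by
        rw [mem_handled]
        exact ⟨by simp, hT (f i) (f i).2⟩
      have a7 := hI.rejected _ a6 a1 hna (w i)
      dsimp only at a7
      rw [a5] at a7
      rw [← pathWeight_eq_sum]
      exact a7 (hw i hi).1
    have huse : ∀ e, (O2.filter fun i => e ∈ es i).card ≤ 4 * N.cS := by
      intro e
      refine card_sketch_users_le (ω := ω) hN hp2 e
        ((Finset.filter_subset _ _).trans (Finset.filter_subset _ _)) ?_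
      intro i hi
      obtain ⟨b1, b2⟩ := Finset.mem_filter.1 hi
      exact (hw i (Finset.mem_filter.1 b1).1).2 (List.mem_toFinset.1 b2)
    calc (O2.card : ℝ) = ∑ i ∈ O2, 1 := by simp
      _ ≤ ∑ i ∈ O2, ∑ e ∈ es i, g.weight e := Finset.sum_le_sum hone
      _ = ∑ i ∈ O2, ∑ e ∈ E, if e ∈ es i then g.weight e else 0 := by
          apply Finset.sum_congr rfl
          intro i hi
          rw [← Finset.sum_filter]
          congr 1
          ext e
          rw [Finset.mem_filter]
          exact ⟨fun h => ⟨Finset.mem_biUnion.2 ⟨i, (Finset.mem_filter.1 hi).1, h⟩, h⟩,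
              fun h => h.2⟩
      _ = ∑ e ∈ E, ((O2.filter fun i => e ∈ es i).card : ℝ) * g.weight e := by
          rw [Finset.sum_comm]
          apply Finset.sum_congr rfl
          intro e _
          rw [← Finset.sum_filter, Finset.sum_const, nsmul_eq_mul]
      _ ≤ ∑ e ∈ E, (4 * N.cS : ℝ) * g.weight e := by
          apply Finset.sum_le_sum
          intro e _
          apply mul_le_mul_of_nonneg_right _ (hI.weight_nonneg e)
          exact_mod_cast huse e
      _ = 4 * (N.cS * ∑ e ∈ E, g.weight e) := by rw [← Finset.mul_sum]; ring
      _ ≤ 4 * (2 * g.accepted.card) := by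
          have := hI.potential E
          linarith
      _ = 8 * g.accepted.card := by ring
  have h1' : (O1.card : ℝ) ≤ g.accepted.card := by exact_mod_cast h1
  have hsplit' : (O1.card : ℝ) + O2.card = O.card := by exact_mod_cast hsplit
  linarith

end Dual

/-! ### Independent biased coins -/

section Bernoulli

variable {ι : Type*}

/-- The probability of the outcome `X` of independent coins that are `true` with probability `p`. -/
def bernoulliWeight [Fintype ι] (p : ℝ) (X : ι → Bool) : ℝ := ∏ i, if X i then p else 1 - p

theorem bernoulliWeight_nonneg [Fintype ι] {p : ℝ} (h0 : 0 ≤ p) (h1 : p ≤ 1) (X : ι → Bool) :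
    0 ≤ bernoulliWeight p X := by
  refine Finset.prod_nonneg fun i _ => ?_
  split_ifs <;> linarith

/-- The indicator of the event that all coins in `A` are `true`. -/
def allTrue (A : Finset ι) (X : ι → Bool) : ℝ := ∏ i ∈ A, if X i then 1 else 0

theorem allTrue_nonneg (A : Finset ι) (X : ι → Bool) : 0 ≤ allTrue A X := by
  refine Finset.prod_nonneg fun i _ => ?_
  split_ifs <;> norm_num

theorem allTrue_eq_one {A : Finset ι} {X : ι → Bool} (h : ∀ i ∈ A, X i = true) :
    allTrue A X = 1 :=
  Finset.prod_eq_one fun i hi => by simp [h i hi]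

variable [Fintype ι] [DecidableEq ι]

/-- The sum of products over all outcomes factors into a product over the coins, with factor `p` for
a coin in `A` and `1` for any other. -/
theorem sum_bernoulliWeight_mul_allTrue (p : ℝ) (A : Finset ι) :
    ∑ X, bernoulliWeight p X * allTrue A X = p ^ A.card := by
  have h1 : ∀ X : ι → Bool, bernoulliWeight p X * allTrue A X =
      ∏ i, ((if X i then p else 1 - p) * if i ∈ A then (if X i then 1 else 0) else 1) := by
    intro X
    rw [Finset.prod_mul_distrib, bernoulliWeight, allTrue, ← Finset.prod_filter]
    simp
  simp_rw [h1]
  have h2 := Finset.prod_univ_sum (fun _ : ι => (Finset.univ : Finset Bool))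
    (fun i x => (if x = true then p else 1 - p) *
      if i ∈ A then (if x = true then (1 : ℝ) else 0) else 1)
  rw [Fintype.piFinset_univ] at h2
  rw [← h2]
  have h3 : ∀ i : ι, ∑ x : Bool, ((if x = true then p else 1 - p) *
      if i ∈ A then (if x = true then (1 : ℝ) else 0) else 1) = if i ∈ A then p else 1 := by
    intro i
    by_cases h : i ∈ A <;> simp [h]
  simp_rw [h3]
  rw [← Finset.prod_filter]
  simp

theorem sum_bernoulliWeight (p : ℝ) : ∑ X : ι → Bool, bernoulliWeight p X = 1 := by
  have := sum_bernoulliWeight_mul_allTrue p (∅ : Finset ι)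
  simpa [allTrue] using this

/-- If the coin of `i` is `true`, then the event `D` holds, unless `M` coins of one of the sets
`U e`, or one coin of the set `C`, or `K` coins of the set `S` are `true`. -/
theorem le_sum_bernoulliWeight {ε : Type*} {p K : ℝ} (h0 : 0 ≤ p) (h1 : p ≤ 1) (hK : 0 < K)
    {i : ι} {D : (ι → Bool) → Prop} [DecidablePred D] {E : Finset ε} {U : ε → Finset ι}
    {C S : Finset ι} {M : ℕ} (hU : ∀ e ∈ E, i ∉ U e) (hC : i ∉ C) (hS : i ∉ S)
    (h : ∀ X, X i = true → D X ∨ (∃ e ∈ E, M ≤ ((U e).filter fun j => X j = true).card) ∨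
      (∃ j ∈ C, X j = true) ∨ K ≤ ((S.filter fun j => X j = true).card : ℝ)) :
    p * (1 - ∑ e ∈ E, ((U e).card.choose M : ℝ) * p ^ M - C.card * p - S.card * p / K) ≤
      ∑ X, bernoulliWeight p X * if D X then 1 else 0 := by
  -- A pointwise union bound: overload of `U e` is witnessed by an `M`-subset of `true` coins, and
  -- the last term is Markov's inequality in pointwise form.
  have hpoint : ∀ X : ι → Bool, allTrue {i} X -
      ∑ e ∈ E, ∑ A ∈ (U e).powersetCard M, allTrue (insert i A) X -
      ∑ j ∈ C, allTrue {i, j} X - (∑ j ∈ S, allTrue {i, j} X) / K ≤ if D X then 1 else 0 := by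
    intro X
    have n1 : 0 ≤ ∑ e ∈ E, ∑ A ∈ (U e).powersetCard M, allTrue (insert i A) X :=
      Finset.sum_nonneg fun _ _ => Finset.sum_nonneg fun _ _ => allTrue_nonneg _ _
    have n2 : 0 ≤ ∑ j ∈ C, allTrue {i, j} X := Finset.sum_nonneg fun _ _ => allTrue_nonneg _ _
    have n3 : 0 ≤ (∑ j ∈ S, allTrue {i, j} X) / K :=
      div_nonneg (Finset.sum_nonneg fun _ _ => allTrue_nonneg _ _) hK.le
    have n4 : (0 : ℝ) ≤ if D X then 1 else 0 := by split_ifs <;> norm_num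
    by_cases hX : X i = true
    · have e1 : allTrue {i} X = 1 := allTrue_eq_one (by simpa using hX)
      rcases h X hX with hD | ⟨e, he, hM⟩ | ⟨j, hj, hXj⟩ | hcard
      · rw [if_pos hD]; linarith
      · obtain ⟨A, hA, hAcard⟩ := Finset.exists_subset_card_eq hM
        have hAU : A ∈ (U e).powersetCard M :=
          Finset.mem_powersetCard.2 ⟨hA.trans (Finset.filter_subset _ _), hAcard⟩
        have e2 : allTrue (insert i A) X = 1 := by
          refine allTrue_eq_one fun j hj => ?_
          rcases Finset.mem_insert.1 hj with rfl | hj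
          · exact hX
          · exact (Finset.mem_filter.1 (hA hj)).2
        have e3 := Finset.single_le_sum (f := fun A => allTrue (insert i A) X)
          (fun _ _ => allTrue_nonneg _ _) hAU
        have e4 := Finset.single_le_sum
          (f := fun e => ∑ A ∈ (U e).powersetCard M, allTrue (insert i A) X)
          (fun _ _ => Finset.sum_nonneg fun _ _ => allTrue_nonneg _ _) he
        linarith
      · have e2 : allTrue {i, j} X = 1 := allTrue_eq_one (by simp [hX, hXj])
        have e3 := Finset.single_le_sum (f := fun j => allTrue {i, j} X)
          (fun _ _ => allTrue_nonneg _ _) hj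
        linarith
      · have e2 : ((S.filter fun j => X j = true).card : ℝ) ≤ ∑ j ∈ S, allTrue {i, j} X := by
          rw [Finset.card_filter]
          push_cast
          refine Finset.sum_le_sum fun j _ => ?_
          split_ifs with hXj
          · rw [allTrue_eq_one (by simp [hX, hXj])]
          · exact allTrue_nonneg _ _
        have e3 : 1 ≤ (∑ j ∈ S, allTrue {i, j} X) / K := by rw [le_div_iff₀ hK]; linarith
        linarith
    · have e1 : allTrue {i} X = 0 := by simp [allTrue, hX]
      linarith
  have hpair : ∀ j, j ≠ i → ∑ X, bernoulliWeight p X * allTrue {i, j} X = p ^ 2 := by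
    intro j hj
    rw [sum_bernoulliWeight_mul_allTrue, Finset.card_pair hj.symm]
  -- Taking expectations, the coin of `i` contributes an independent factor `p`, because `i` lies in
  -- none of the sets `U e`, `C`, `S`.
  refine le_trans (le_of_eq ?_) (Finset.sum_le_sum fun X _ =>
    mul_le_mul_of_nonneg_left (hpoint X) (bernoulliWeight_nonneg h0 h1 X))
  simp only [mul_sub, Finset.sum_sub_distrib, Finset.mul_sum, ← mul_div_assoc, Finset.sum_div]
  rw [sum_bernoulliWeight_mul_allTrue, Finset.card_singleton, Finset.sum_comm (t := E),
    Finset.sum_comm (t := C), Finset.sum_comm (t := S)]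
  congr 1
  · congr 1
    · congr 1
      · ring
      · refine Finset.sum_congr rfl fun e he => ?_
        rw [Finset.sum_comm]
        rw [Finset.sum_congr rfl (g := fun _ => p ^ (M + 1)), Finset.sum_const,
          Finset.card_powersetCard, nsmul_eq_mul]
        · ring
        · intro A hA
          obtain ⟨h2, h3⟩ := Finset.mem_powersetCard.1 hA
          rw [sum_bernoulliWeight_mul_allTrue,
            Finset.card_insert_of_notMem fun hi => hU e he (h2 hi), h3]
    · rw [Finset.sum_congr rfl fun j hj => hpair j (by rintro rfl; exact hC hj), Finset.sum_const,
        nsmul_eq_mul]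
      ring
  · simp_rw [← Finset.sum_div]
    rw [Finset.sum_congr rfl fun j hj => hpair j (by rintro rfl; exact hS hj), Finset.sum_const,
      nsmul_eq_mul]
    ring

end Bernoulli

/-! ### The probability that an edge is overloaded -/

/-- The terms decrease, as the ratio of successive ones is `2/25 * (1 + 1/(M+1)) ^ (M+1) ≤ 2e/25 <
1`. For `M = 2` the value is below `0.47`. -/
theorem pow_div_factorial_le (M : ℕ) (hM : 2 ≤ M) :
    16 * (2 / 25 * (M + 1 : ℝ)) ^ M / M.factorial ≤ 1 / 2 := by
  induction M, hM using Nat.le_induction with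
  | base => norm_num [Nat.factorial]
  | succ M hM ih =>
    refine le_trans ?_ ih
    have hM0 : (0 : ℝ) < M + 1 := by positivity
    have h1 : (1 + 1 / (M + 1 : ℝ)) ^ (M + 1) ≤ Real.exp 1 := by
      have h2 := Real.add_one_le_exp (1 / (M + 1 : ℝ))
      calc (1 + 1 / (M + 1 : ℝ)) ^ (M + 1) ≤ Real.exp (1 / (M + 1 : ℝ)) ^ (M + 1) :=
            pow_le_pow_left₀ (by positivity) (by linarith) _
        _ = Real.exp 1 := by
            rw [← Real.exp_nat_mul]
            congr 1
            push_cast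
            field_simp
    have h3 := Real.exp_one_lt_d9
    have h4 : (2 / 25 * (((M + 1 : ℕ) : ℝ) + 1)) ^ (M + 1) =
        (2 / 25 * (M + 1 : ℝ)) ^ M * (2 / 25 * (M + 1)) * (1 + 1 / (M + 1 : ℝ)) ^ (M + 1) := by
      rw [← pow_succ, ← mul_pow]
      congr 1
      push_cast
      field_simp
    rw [h4, Nat.factorial_succ]
    push_cast
    rw [div_le_div_iff₀ (by positivity) (by positivity)]
    have h5 : (0 : ℝ) ≤ 16 * (2 / 25 * (M + 1 : ℝ)) ^ M * M.factorial * (M + 1) := by positivity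
    nlinarith [mul_le_mul_of_nonneg_left
      (show 2 / 25 * (1 + 1 / (M + 1 : ℝ)) ^ (M + 1) ≤ 1 by linarith) h5]

section Overload

variable {N : LineNetwork}

/-- The threshold of the load test. -/
noncomputable def LineNetwork.threshold (N : LineNetwork) : ℕ := (N.cS - 1) / 4

theorem LineNetwork.Valid.lam_mul_k (hN : N.Valid) : N.lam * N.k = 1 / 200 := by
  have := hN.k_pos
  unfold LineNetwork.lam
  field_simp

theorem LineNetwork.Valid.lam_mul_log_le (hN : N.Valid) : N.lam * N.log ≤ 1 / 200 := by
  rw [← hN.lam_mul_k]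
  exact mul_le_mul_of_nonneg_left hN.log_le_k hN.lam_pos.le

theorem LineNetwork.Valid.one_le_lam_mul_log (hN : N.Valid) :
    1 / 600 ≤ N.lam * N.log := by
  have h1 := hN.lam_mul_k
  nlinarith [mul_le_mul_of_nonneg_left hN.k_le hN.lam_pos.le]

/-- A union bound over the edges of a sketch path is affordable because tiles are large: `2 log n ≤
c^S` gives `p_max ≤ 16 * 4 ^ M`. The expected number of kept users is at most `λ c^S k = c^S / 200 ≤
(M + 1) / 50`, so the factorial in `choose` outweighs the factor `4 ^ M`. -/
theorem LineNetwork.Valid.overload_le (hN : N.Valid) {u : ℕ} (hu : (u : ℝ) ≤ N.cS * N.k) :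
    N.pmax * ((u.choose N.threshold : ℝ) * N.lam ^ N.threshold) ≤ 1 / 2 := by
  have h9 := hN.nine_le_cS
  have hlog := hN.two_log_le_cS
  set M := N.threshold with hM
  have hM2 : 2 ≤ M := by rw [hM, LineNetwork.threshold]; omega
  have hcS : N.cS ≤ 4 * (M + 1) := by rw [hM, LineNetwork.threshold]; omega
  have hcS' : (N.cS : ℝ) ≤ 4 * (M + 1) := by exact_mod_cast hcS
  have hn : (N.n : ℝ) ≤ 4 ^ (M + 1) := by
    rw [← hN.rpow_log]
    calc (2 : ℝ) ^ N.log ≤ 2 ^ (2 * (M + 1) : ℝ) :=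
          Real.rpow_le_rpow_of_exponent_le (by norm_num) (by linarith)
      _ = 4 ^ (M + 1) := by
          have h4 : (2 : ℝ) ^ (2 : ℝ) = 4 := by norm_num
          rw [Real.rpow_mul (by norm_num), h4, ← Real.rpow_natCast]
          push_cast
          rfl
  have hp : (N.pmax : ℝ) ≤ 16 * 4 ^ M := by
    unfold LineNetwork.pmax
    push_cast
    rw [pow_succ] at hn
    linarith
  have hlam := hN.lam_pos
  have h1 : (u.choose M : ℝ) * N.lam ^ M ≤ ((M + 1 : ℝ) / 50) ^ M / M.factorial := by
    calc (u.choose M : ℝ) * N.lam ^ M ≤ (u : ℝ) ^ M / M.factorial * N.lam ^ M :=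
          mul_le_mul_of_nonneg_right (Nat.choose_le_pow_div M u) (by positivity)
      _ = (N.lam * u) ^ M / M.factorial := by rw [mul_pow]; ring
      _ ≤ ((M + 1 : ℝ) / 50) ^ M / M.factorial := by
          gcongr
          calc N.lam * u ≤ N.lam * (N.cS * N.k) := mul_le_mul_of_nonneg_left hu hlam.le
            _ = N.cS * (N.lam * N.k) := by ring
            _ ≤ (M + 1 : ℝ) / 50 := by rw [hN.lam_mul_k]; linarith
  calc N.pmax * ((u.choose M : ℝ) * N.lam ^ M)
      ≤ 16 * 4 ^ M * (((M + 1 : ℝ) / 50) ^ M / M.factorial) :=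
        mul_le_mul hp h1 (by positivity) (by positivity)
    _ = 16 * (2 / 25 * (M + 1 : ℝ)) ^ M / M.factorial := by
        rw [show 2 / 25 * (M + 1 : ℝ) = 4 * ((M + 1) / 50) by ring, mul_pow]; ring
    _ ≤ 1 / 2 := pow_div_factorial_le M hM2

end Overload

/-! ### The throughput for requests of `Far⁺` -/

section Survival

variable {N : LineNetwork} {lightest : Oracle} {ω : Coins} {σ : List (Request N.n)}

/-- The position of a column in its column of tiles. -/
noncomputable def colOffset (N : LineNetwork) (ω : Coins) (x : ℤ) : ℕ :=
  ((x - ω.phaseTime) % N.tau).toNat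

theorem IsFarPlus.rowOffset_lt (hN : N.Valid) {q : Request N.n} (h : IsFarPlus N ω q) :
    rowOffset N ω (q.src : ℕ) < N.halfQ := by
  have hQ : (0 : ℤ) < N.Q := by exact_mod_cast hN.Q_pos
  have h1 := h.2.1
  have h2 := Int.emod_nonneg (((q.src : ℕ) : ℤ) - ω.phaseSpace) hQ.ne'
  have h3 := N.Q_eq
  unfold InSouth at h1
  unfold rowOffset
  omega

theorem IsFarPlus.colOffset_lt (hN : N.Valid) {q : Request N.n} (h : IsFarPlus N ω q) :
    colOffset N ω q.column < N.halfTau := by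
  have hτ : (0 : ℤ) < N.tau := by exact_mod_cast hN.tau_pos
  have h1 := h.2.2
  have h2 := Int.emod_nonneg (((q.time : ℕ) : ℤ) - (q.src : ℕ) - ω.phaseTime) hτ.ne'
  have h3 := N.tau_eq
  unfold InWest at h1
  unfold colOffset Request.column
  omega

theorem colOffset_inj (hN : N.Valid) {q q' : Request N.n}
    (h : colOffset N ω q.column = colOffset N ω q'.column)
    (hs : sourceTile N ω q = sourceTile N ω q') : q.column = q'.column := by
  have hτ : (0 : ℤ) < N.tau := by exact_mod_cast hN.tau_pos
  have h0 : (q.column - ω.phaseTime) / N.tau = (q'.column - ω.phaseTime) / N.tau :=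
    congrArg Prod.snd hs
  have h1 := Int.emod_nonneg (q.column - ω.phaseTime) hτ.ne'
  have h2 := Int.emod_nonneg (q'.column - ω.phaseTime) hτ.ne'
  have h3 := Int.mul_ediv_add_emod (q.column - ω.phaseTime) N.tau
  have h4 := Int.mul_ediv_add_emod (q'.column - ω.phaseTime) N.tau
  unfold colOffset at h
  rw [h0] at h3
  omega

/-- The requests in a tile are determined by their positions and their planes. -/
theorem eq_of_position_eq (hN : N.Valid) {i j : Fin σ.length} (hi : IsFarPlus N ω (σ.get i))
    (hj : IsFarPlus N ω (σ.get j))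
    (hs : sourceTile N ω (σ.get i) = sourceTile N ω (σ.get j))
    (hrow : rowOffset N ω ((σ.get i).src : ℕ) = rowOffset N ω ((σ.get j).src : ℕ))
    (hcol : colOffset N ω (σ.get i).column = colOffset N ω (σ.get j).column)
    (hplane : planeOf N ω σ (σ.get i, (i : ℕ)) = planeOf N ω σ (σ.get j, (j : ℕ))) : i = j := by
  have h1 := rowOffset_inj hN hrow (congrArg Prod.fst hs)
  have h2 := colOffset_inj hN hcol hs
  have h3 : (σ.get i).src = (σ.get j).src := Fin.ext (by exact_mod_cast h1)
  have h4 : (σ.get i).time = (σ.get j).time := by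
    unfold Request.column at h2
    omega
  have h5 : farPlusAt N ω σ i = farPlusAt N ω σ j := by
    unfold farPlusAt
    rw [h3, h4]
  rw [planeOf_eq_keyRank, planeOf_eq_keyRank, h5] at hplane
  refine keyRank_injOn (destinationKey_injective σ).injOn ?_ ?_ hplane
  · simp only [Finset.mem_coe, farPlusAt, Finset.mem_filter, Finset.mem_univ, true_and]
    exact ⟨hi, h3, h4⟩
  · simp only [Finset.mem_coe, farPlusAt, Finset.mem_filter, Finset.mem_univ, true_and]
    exact ⟨hj, trivial⟩

theorem card_competing_le (hN : N.Valid) (i : Fin σ.length) {C : Finset (Fin σ.length)}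
    (hC : ∀ j ∈ C, IsFarPlus N ω (σ.get j) ∧
      planeOf N ω σ (σ.get j, (j : ℕ)) = planeOf N ω σ (σ.get i, (i : ℕ)) ∧
      Competes N ω (planeOf N ω σ (σ.get i, (i : ℕ))) (σ.get j) (σ.get i)) :
    (C.card : ℝ) ≤ 2 * N.log := by
  cases hd : planeDir N (planeOf N ω σ (σ.get i, (i : ℕ)))
  · refine le_trans ?_ hN.halfQ_le
    rw [← Finset.card_range N.halfQ]
    refine Nat.cast_le.2 (Finset.card_le_card_of_injOn
      (fun j => rowOffset N ω ((σ.get j).src : ℕ)) ?_ ?_)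
    · intro j hj
      exact Finset.mem_coe.2 (Finset.mem_range.2 ((hC j hj).1.rowOffset_lt hN))
    · intro j hj j' hj' h
      obtain ⟨a1, a2, a3, a4⟩ := hC j hj
      obtain ⟨b1, b2, b3, b4⟩ := hC j' hj'
      rw [hd] at a4 b4
      refine eq_of_position_eq hN a1 b1 (a3.trans b3.symm) h ?_ (a2.trans b2.symm)
      unfold Request.column
      dsimp only at a4 b4
      rw [a4, b4]
  · refine le_trans ?_ hN.halfTau_le
    rw [← Finset.card_range N.halfTau]
    refine Nat.cast_le.2 (Finset.card_le_card_of_injOn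
      (fun j => colOffset N ω (σ.get j).column) ?_ ?_)
    · intro j hj
      exact Finset.mem_coe.2 (Finset.mem_range.2 ((hC j hj).1.colOffset_lt hN))
    · intro j hj j' hj' h
      obtain ⟨a1, a2, a3, a4⟩ := hC j hj
      obtain ⟨b1, b2, b3, b4⟩ := hC j' hj'
      rw [hd] at a4 b4
      dsimp only at a4 b4
      exact eq_of_position_eq hN a1 b1 (a3.trans b3.symm) (by rw [a4, b4]) h (a2.trans b2.symm)

theorem card_sourceTile_le (hN : N.Valid) (s : Tile) {S : Finset (Fin σ.length)}
    (hS : ∀ j ∈ S, Considered N ω σ (σ.get j, (j : ℕ)) ∧ sourceTile N ω (σ.get j) = s) :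
    (S.card : ℝ) ≤ 4 * N.log * N.cS := by
  refine le_trans ?_ hN.quadrant_le
  have h : S.card ≤ (Finset.range N.halfQ ×ˢ Finset.range N.halfTau ×ˢ
      Finset.range (N.B + N.c)).card := by
    refine Finset.card_le_card_of_injOn (fun j => (rowOffset N ω ((σ.get j).src : ℕ),
      colOffset N ω (σ.get j).column, planeOf N ω σ (σ.get j, (j : ℕ)))) ?_ ?_
    · intro j hj
      obtain ⟨⟨h1, h2⟩, -⟩ := hS j hj
      simp only [Finset.coe_product, Set.mem_prod, Finset.coe_range, Set.mem_Iio]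
      exact ⟨h1.rowOffset_lt hN, h1.colOffset_lt hN, h2⟩
    · intro j hj j' hj' h
      obtain ⟨⟨a1, -⟩, a2⟩ := hS j hj
      obtain ⟨⟨b1, -⟩, b2⟩ := hS j' hj'
      simp only [Prod.mk.injEq] at h
      exact eq_of_position_eq hN a1 b1 (a2.trans b2.symm) h.1 h.2.1 h.2.2
  rw [Finset.card_product, Finset.card_product, Finset.card_range, Finset.card_range,
    Finset.card_range, ← mul_assoc] at h
  exact_mod_cast h

/-- The random choices `ω` with the coins `X` of the requests. -/
def Coins.withKeep {m : ℕ} (ω : Coins) (X : Fin m → Bool) : Coins :=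
  { ω with keep := fun i => if h : i < m then X ⟨i, h⟩ else false }

theorem keep_withKeep {m : ℕ} (X : Fin m → Bool) (i : Fin m) : (ω.withKeep X).keep i = X i := by
  simp [Coins.withKeep]

theorem packing_withKeep {m : ℕ} (X : Fin m → Bool) (l : List (Request N.n × ℕ)) :
    packing N lightest (ω.withKeep X) σ l = packing N lightest ω σ l := rfl

/-- Every request that the path packing accepts is delivered with probability at least `λ / 3`. -/
theorem le_probability_delivered (hN : N.Valid) (horacle : IsLightestPathOracle N lightest)
    (hfar : ω.far = true) {T : ℕ} (hT : ∀ i (h : i < σ.length), σ[i].time ≤ T) {i : Fin σ.length}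
    (hi : (i : ℕ) ∈ (packing N lightest ω σ (handled σ (T + 1))).accepted) :
    N.lam / 3 ≤ ∑ X : Fin σ.length → Bool, bernoulliWeight N.lam X *
      if i ∈ delivered N lightest (ω.withKeep X) σ then 1 else 0 := by
  classical
  set g := packing N lightest ω σ (handled σ (T + 1)) with hg
  have hI : PackingInvariant N ω σ (handled σ (T + 1)) g := packingInvariant hN horacle (T + 1)
  have hcon : ∀ j : Fin σ.length, (j : ℕ) ∈ g.accepted →
      Considered N ω σ (σ.get j, (j : ℕ)) := by
    intro j hj
    obtain ⟨q, w, h1, h2, -⟩ := hI.mem j hj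
    rw [mem_handled] at h1
    have h3 : σ.get j = q := by
      have := h1.1
      simp only [List.getElem?_eq_getElem j.2, Option.some.injEq] at this
      exact this
    rw [h3]; exact h2
  let E : Finset SketchEdge := (g.route i).toFinset
  let U : SketchEdge → Finset (Fin σ.length) := fun e =>
    Finset.univ.filter fun j => (j : ℕ) ∈ g.users e ∧ j ≠ i
  let A : Finset (Fin σ.length) := Finset.univ.filter fun j => (j : ℕ) ∈ g.accepted ∧ j ≠ i
  let C : Finset (Fin σ.length) := A.filter fun j =>
    planeOf N ω σ (σ.get j, (j : ℕ)) = planeOf N ω σ (σ.get i, (i : ℕ)) ∧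
      Competes N ω (planeOf N ω σ (σ.get i, (i : ℕ))) (σ.get j) (σ.get i)
  let S : Finset (Fin σ.length) := A.filter fun j =>
    sourceTile N ω (σ.get j) = sourceTile N ω (σ.get i)
  have h9 : (9 : ℝ) ≤ N.cS := by exact_mod_cast hN.nine_le_cS
  -- If the quadrant test fails, more than `c^S / 4 - 1` other requests of the quadrant are kept,
  -- and this is at least `5 c^S / 36` since `9 ≤ c^S`.
  have hmain := le_sum_bernoulliWeight (p := N.lam) (K := 5 * N.cS / 36) hN.lam_pos.le
    hN.lam_le_one (by linarith) (i := i) (D := fun X => i ∈ delivered N lightest (ω.withKeep X) σ)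
    (E := E) (U := U) (C := C) (S := S) (M := N.threshold) (by simp [U]) (by simp [C, A])
    (by simp [S, A]) ?_
  · refine le_trans ?_ hmain
    have hlam := hN.lam_pos
    have hlog := hN.lam_mul_log_le
    have b1 : ∑ e ∈ E, ((U e).card.choose N.threshold : ℝ) * N.lam ^ N.threshold ≤ 1 / 2 := by
      have hu : ∀ e ∈ E, (U e).card ≤ (g.users e).card := by
        intro e _
        refine Finset.card_le_card_of_injOn (fun j => (j : ℕ)) ?_ (Fin.val_injective.injOn)
        intro j hj
        exact (Finset.mem_filter.1 hj).2.1
      have hE : (E.card : ℝ) ≤ N.pmax := by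
        obtain ⟨q, w, -, -, h3, h4⟩ := hI.mem i hi
        have : E.card ≤ (g.route i).length := List.toFinset_card_le _
        rw [h3, length_sketchEdges] at this
        exact_mod_cast this.trans h4.2.2
      have hp := hN.pmax_pos
      calc ∑ e ∈ E, ((U e).card.choose N.threshold : ℝ) * N.lam ^ N.threshold
          ≤ ∑ e ∈ E, (1 / 2) / (N.pmax : ℝ) := by
            refine Finset.sum_le_sum fun e he => ?_
            rw [le_div_iff₀' (by linarith)]
            exact hN.overload_le ((Nat.cast_le.2 (hu e he)).trans (hI.users_le e))
        _ = E.card * ((1 / 2) / (N.pmax : ℝ)) := by rw [Finset.sum_const, nsmul_eq_mul]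
        _ ≤ N.pmax * ((1 / 2) / (N.pmax : ℝ)) := by gcongr
        _ = 1 / 2 := by field_simp
    have b2 : C.card * N.lam ≤ 1 / 100 := by
      have := card_competing_le (ω := ω) hN i (C := C) (by
        intro j hj
        obtain ⟨h1, h2⟩ := Finset.mem_filter.1 hj
        exact ⟨(hcon j (Finset.mem_filter.1 h1).2.1).1, h2⟩)
      nlinarith [mul_le_mul_of_nonneg_right this hlam.le]
    have b3 : S.card * N.lam / (5 * N.cS / 36) ≤ 18 / 125 := by
      have := card_sourceTile_le (ω := ω) hN (sourceTile N ω (σ.get i)) (S := S) (by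
        intro j hj
        obtain ⟨h1, h2⟩ := Finset.mem_filter.1 hj
        exact ⟨hcon j (Finset.mem_filter.1 h1).2.1, h2⟩)
      rw [div_le_iff₀ (by linarith)]
      nlinarith [mul_le_mul_of_nonneg_right this hlam.le,
        mul_le_mul_of_nonneg_right hlog (by linarith : (0 : ℝ) ≤ N.cS)]
    -- The failure probabilities sum to at most `1/2 + 1/100 + 18/125 < 2/3`.
    nlinarith
  · intro X hX
    -- The packing state `g` is the same for all outcomes `X`, so the sets `U`, `C`, `S` are fixed
    -- before the coins are tossed.
    have hlink := linked (ω := ω.withKeep X) (σ := σ) hN horacle hfar T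
    rw [packing_withKeep, ← hg] at hlink
    have hkeep : ∀ p ∈ (mid N lightest (ω.withKeep X) σ T).packets, ∃ j : Fin σ.length,
        (j : ℕ) = p.id ∧ (j : ℕ) ∈ g.accepted ∧ X j = true ∧ σ.get j = p.req ∧
        p.plane = planeOf N ω σ (σ.get j, (j : ℕ)) := by
      intro p hp
      obtain ⟨h1, h2, h3⟩ := hlink.packet p hp
      obtain ⟨h4, h5⟩ := List.getElem?_eq_some_iff.1 (mem_mid_time hp).1
      have h6 : σ.get ⟨p.id, h4⟩ = p.req := h5
      refine ⟨⟨p.id, h4⟩, rfl, h1, ?_, h5, ?_⟩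
      · rw [← keep_withKeep (ω := ω) X]; exact h2
      · rw [h6]; exact h3
    have hsettled := hlink.complete (σ.get i, (i : ℕ))
      ((mem_handled σ).2 ⟨by simp, Nat.lt_succ_of_le (hT i i.2)⟩) hi
      (by rw [keep_withKeep]; exact hX)
    rcases hsettled with ⟨p, hp, hid⟩ | ⟨e, he, hload⟩ | ⟨p, hp, hid, hplane, hcomp⟩ | hcard
    · left
      obtain ⟨j, h1, -⟩ := hkeep p hp
      have := mem_delivered_of_mid hN horacle hp (by rw [← h1]; exact j.2)
      have h2 : (⟨p.id, by rw [← h1]; exact j.2⟩ : Fin σ.length) = i := Fin.ext hid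
      rw [h2] at this
      exact this
    · refine Or.inr (Or.inl ⟨e, List.mem_toFinset.2 he, ?_⟩)
      have hle : (((g.users e).erase i).filter fun j => (ω.withKeep X).keep j = true).card ≤
          ((U e).filter fun j => X j = true).card := by
        rw [← Finset.card_image_of_injective ((U e).filter fun j => X j = true) Fin.val_injective]
        refine Finset.card_le_card fun j hj => ?_
        obtain ⟨h1, h2⟩ := Finset.mem_filter.1 hj
        obtain ⟨h3, h4⟩ := Finset.mem_erase.1 h1
        have hlt : j < σ.length := by
          by_contra hlt
          simp [Coins.withKeep, hlt] at h2
        refine Finset.mem_image.2 ⟨⟨j, hlt⟩, Finset.mem_filter.2 ⟨Finset.mem_filter.2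
          ⟨Finset.mem_univ _, h4, fun h => h3 (congrArg Fin.val h)⟩, ?_⟩, rfl⟩
        rw [← keep_withKeep (ω := ω) X]; exact h2
      refine le_trans ?_ hle
      dsimp only at hload
      unfold LineNetwork.threshold
      omega
    · refine Or.inr (Or.inr (Or.inl ?_))
      obtain ⟨j, h1, h2, h3, h4, h5⟩ := hkeep p hp
      refine ⟨j, Finset.mem_filter.2 ⟨Finset.mem_filter.2 ⟨Finset.mem_univ _, h2, ?_⟩, ?_, ?_⟩, h3⟩
      · rintro rfl; exact hid h1.symm
      · exact h5.symm.trans hplane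
      · rw [h4]; exact hcomp
    · refine Or.inr (Or.inr (Or.inr ?_))
      have hle : ((mid N lightest (ω.withKeep X) σ T).packets.filter fun p =>
          p.id ≠ (i : ℕ) ∧ sourceTile N (ω.withKeep X) p.req = sourceTile N (ω.withKeep X)
            (σ.get i)).length ≤
          (S.filter fun j => X j = true).card := by
        rw [← Finset.card_image_of_injective (S.filter fun j => X j = true) Fin.val_injective,
          ← List.length_map (f := Packet.id), ← List.toFinset_card_of_nodup]
        · refine Finset.card_le_card fun k hk => ?_
          obtain ⟨p, hp, rfl⟩ := List.mem_map.1 (List.mem_toFinset.1 hk)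
          obtain ⟨hp, h0⟩ := List.mem_filter.1 hp
          rw [decide_eq_true_eq] at h0
          obtain ⟨j, h1, h2, h3, h4, h5⟩ := hkeep p hp
          refine Finset.mem_image.2 ⟨j, Finset.mem_filter.2 ⟨Finset.mem_filter.2
            ⟨Finset.mem_filter.2 ⟨Finset.mem_univ _, h2, ?_⟩, ?_⟩, h3⟩, h1⟩
          · rintro rfl; exact h0.1 h1.symm
          · rw [h4]; exact h0.2
        · exact ((fromRequests T).2.nodup).sublist (List.filter_sublist.map _)
      have h1 : N.cS < 4 * ((S.filter fun j => X j = true).card + 1) :=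
        lt_of_lt_of_le hcard (Nat.mul_le_mul_left 4 (Nat.succ_le_succ hle))
      have h2 : (N.cS : ℝ) < 4 * ((S.filter fun j => X j = true).card + 1) := by exact_mod_cast h1
      have h3 : (N.cS : ℝ) + 1 ≤ 4 * ((S.filter fun j => X j = true).card + 1) := by
        exact_mod_cast h1
      linarith

/-- The expected throughput when the class `Far⁺` is selected. -/
theorem far_competitive (hN : N.Valid) (horacle : IsLightestPathOracle N lightest)
    (hfar : ω.far = true) {O : Finset (Fin σ.length)} {path : Fin σ.length → List Move}
    (hO : Packs N σ O path) (hOfar : ∀ i ∈ O, IsFarPlus N ω (σ.get i)) :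
    (O.card : ℝ) ≤ 16200 * N.log * ∑ X : Fin σ.length → Bool, bernoulliWeight N.lam X *
      (delivered N lightest (ω.withKeep X) σ).card := by
  classical
  obtain ⟨T, hT⟩ := exists_horizon σ
  have h1 := packing_competitive hN horacle hO hOfar (T := T + 1)
    fun i h => Nat.lt_succ_of_le (hT i h)
  set g := packing N lightest ω σ (handled σ (T + 1)) with hg
  let A : Finset (Fin σ.length) := Finset.univ.filter fun i => (i : ℕ) ∈ g.accepted
  have hA : g.accepted.card ≤ A.card := by
    rw [← Finset.card_image_of_injective A Fin.val_injective]
    refine Finset.card_le_card fun i hi => ?_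
    obtain ⟨q, w, h2, -⟩ := (packingInvariant (ω := ω) hN horacle (T + 1)).mem i hi
    have hlt := (List.getElem?_eq_some_iff.1 ((mem_handled σ).1 h2).1).1
    exact Finset.mem_image.2 ⟨⟨i, hlt⟩, Finset.mem_filter.2 ⟨Finset.mem_univ _, hi⟩, rfl⟩
  have h2 : A.card * (N.lam / 3) ≤ ∑ X : Fin σ.length → Bool, bernoulliWeight N.lam X *
      (delivered N lightest (ω.withKeep X) σ).card := by
    rw [← nsmul_eq_mul, ← Finset.sum_const]
    calc ∑ i ∈ A, N.lam / 3 ≤ ∑ i ∈ A, ∑ X : Fin σ.length → Bool, bernoulliWeight N.lam X *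
          (if i ∈ delivered N lightest (ω.withKeep X) σ then 1 else 0) :=
          Finset.sum_le_sum fun i hi =>
            le_probability_delivered hN horacle hfar hT (Finset.mem_filter.1 hi).2
      _ = ∑ X : Fin σ.length → Bool, bernoulliWeight N.lam X *
          ∑ i ∈ A, (if i ∈ delivered N lightest (ω.withKeep X) σ then 1 else 0) := by
          rw [Finset.sum_comm]
          simp only [Finset.mul_sum]
      _ ≤ _ := by
          refine Finset.sum_le_sum fun X _ => mul_le_mul_of_nonneg_left ?_
            (bernoulliWeight_nonneg hN.lam_pos.le hN.lam_le_one X)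
          rw [← Finset.sum_filter, Finset.sum_const, nsmul_eq_mul, mul_one]
          refine Nat.cast_le.2 (Finset.card_le_card fun i hi => (Finset.mem_filter.1 hi).2)
  have h3 : (g.accepted.card : ℝ) ≤ A.card := by exact_mod_cast hA
  have h4 := hN.one_le_lam_mul_log
  have h5 : (0 : ℝ) ≤ N.log := by linarith [hN.four_lt_log]
  have h6 : (0 : ℝ) ≤ A.card := Nat.cast_nonneg _
  -- The constant is `9 * 3 * 600`: path packing, survival with probability `λ / 3`, and `1 / 600 ≤
  -- λ log n`.
  nlinarith [mul_le_mul_of_nonneg_left h2 h5, mul_le_mul_of_nonneg_left h4 h6]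

end Survival

/-! ### Random phase shifts -/

/-- The phase that gives `v` the residue `r` is `v - r` modulo `Q`. The residues `r < H` thus yield
`H` different phases that put `v` into the lower half. -/
theorem le_card_phases {H Q : ℕ} (hQ : Q = 2 * H) (v : ℤ) :
    H ≤ (Finset.univ.filter fun b : Fin Q => 2 * ((v - (b : ℕ)) % Q) < (Q : ℤ)).card := by
  rcases Nat.eq_zero_or_pos H with rfl | hH
  · exact Nat.zero_le _
  have hQ0 : (0 : ℤ) < Q := by omega
  have hb : ∀ r : ℕ, 0 ≤ (v - r) % (Q : ℤ) ∧ (v - r) % (Q : ℤ) < Q := fun r =>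
    ⟨Int.emod_nonneg _ hQ0.ne', Int.emod_lt_of_pos _ hQ0⟩
  have hr : ∀ r < H, (v - (((v - r) % (Q : ℤ)).toNat : ℕ)) % (Q : ℤ) = r := by
    intro r hrH
    rw [Int.toNat_of_nonneg (hb r).1, Int.sub_emod, Int.emod_emod, ← Int.sub_emod, sub_sub_cancel]
    exact Int.emod_eq_of_lt (by omega) (by omega)
  conv_lhs => rw [← Finset.card_range H]
  refine Finset.card_le_card_of_injOn
    (fun r => (⟨((v - r) % (Q : ℤ)).toNat, by have := hb r; omega⟩ : Fin Q)) ?_ ?_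
  · intro r h
    have h1 := Finset.mem_range.1 (Finset.mem_coe.1 h)
    refine Finset.mem_coe.2 (Finset.mem_filter.2 ⟨Finset.mem_univ _, ?_⟩)
    dsimp only
    rw [hr r h1]
    omega
  · intro r h r' h' heq
    have h1 := hr r (Finset.mem_range.1 (Finset.mem_coe.1 h))
    have h2 := hr r' (Finset.mem_range.1 (Finset.mem_coe.1 h'))
    have h3 := congrArg Fin.val heq
    dsimp only at h3
    rw [h3, h2] at h1
    exact_mod_cast h1.symm

section Phases

variable {N : LineNetwork} {lightest : Oracle} {σ : List (Request N.n)}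

/-- The random choices with the given phase shifts and selected class. -/
def phaseCoins {N : LineNetwork} (a : Fin N.tau) (b : Fin N.Q) (far : Bool) : Coins :=
  ⟨(a : ℕ), (b : ℕ), far, fun _ => false⟩

open Classical in
/-- With probability at least `1 / 4` a request is near or in `Far⁺`. -/
theorem le_card_near_add_card_farPlus (q : Request N.n) :
    (N.tau * N.Q : ℝ) / 4 ≤ ∑ a : Fin N.tau, ∑ b : Fin N.Q,
      ((if IsNear N (phaseCoins a b false) q then 1 else 0) +
        if IsFarPlus N (phaseCoins a b true) q then 1 else 0) := by
  set W := Finset.univ.filter fun a : Fin N.tau =>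
    2 * ((((q.time : ℕ) : ℤ) - (q.src : ℕ) - (a : ℕ)) % N.tau) < (N.tau : ℤ) with hW
  set S := Finset.univ.filter fun b : Fin N.Q =>
    2 * ((((q.src : ℕ) : ℤ) - (b : ℕ)) % N.Q) < (N.Q : ℤ) with hS
  have h1 : (N.halfTau : ℝ) ≤ W.card := by exact_mod_cast le_card_phases N.tau_eq _
  have h2 : (N.halfQ : ℝ) ≤ S.card := by exact_mod_cast le_card_phases N.Q_eq _
  have h3 : (N.tau : ℝ) = 2 * N.halfTau := by exact_mod_cast N.tau_eq
  have h4 : (N.Q : ℝ) = 2 * N.halfQ := by exact_mod_cast N.Q_eq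
  calc (N.tau * N.Q : ℝ) / 4 = N.halfTau * N.halfQ := by rw [h3, h4]; ring
    _ ≤ W.card * S.card := mul_le_mul h1 h2 (Nat.cast_nonneg _) (Nat.cast_nonneg _)
    _ = ∑ a : Fin N.tau, ∑ b : Fin N.Q, if a ∈ W ∧ b ∈ S then 1 else 0 := by
        simp_rw [ite_and]
        simp [Finset.sum_ite_mem]
    _ ≤ _ := by
        refine Finset.sum_le_sum fun a _ => Finset.sum_le_sum fun b _ => ?_
        -- The source is in the SW-quadrant for at least a quarter of the pairs of phases, and then
        -- the request is near or in `Far⁺`.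
        by_cases hn : IsNear N (phaseCoins a b false) q
        · rw [if_pos hn]
          split_ifs <;> norm_num
        · by_cases hab : a ∈ W ∧ b ∈ S
          · have hf : IsFarPlus N (phaseCoins a b true) q :=
              ⟨hn, (Finset.mem_filter.1 hab.2).2, (Finset.mem_filter.1 hab.1).2⟩
            rw [if_pos hf, if_pos hab, if_neg hn]
            norm_num
          · rw [if_neg hab]
            split_ifs <;> norm_num

theorem expectation_eq (N : LineNetwork) (m : ℕ) (f : Coins → ℝ) :
    expectation N m f = 1 / (2 * N.tau * N.Q) * ∑ a : Fin N.tau, ∑ b : Fin N.Q,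
      ((∑ X : Fin m → Bool, bernoulliWeight N.lam X * f ((phaseCoins a b false).withKeep X)) +
        ∑ X : Fin m → Bool, bernoulliWeight N.lam X * f ((phaseCoins a b true).withKeep X)) := by
  unfold expectation
  simp only [Fintype.sum_bool, Finset.mul_sum, mul_add]
  refine Finset.sum_congr rfl fun a _ => Finset.sum_congr rfl fun b _ => ?_
  rw [add_comm]
  congr 1 <;>
  · refine Finset.sum_congr rfl fun X _ => ?_
    change _ = _ * (bernoulliWeight N.lam X * f _)
    unfold bernoulliWeight phaseCoins Coins.withKeep
    rw [← mul_assoc]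
    congr 2
    rw [one_div_mul_one_div, one_div_mul_one_div]
    congr 1
    ring

/-- The expected throughput of the algorithm. -/
theorem alg_competitive (hN : N.Valid) (horacle : IsLightestPathOracle N lightest)
    (σ : List (Request N.n)) :
    1 / (129600 * N.log) * (opt N σ : ℝ) ≤ expectation N σ.length fun ω =>
      ((deliveredSet σ (alg N lightest ω σ)).ncard : ℝ) := by
  classical
  obtain ⟨O, path, hO, hcard⟩ := exists_optimal_packing N σ
  have hlog : 0 < N.log := by linarith [hN.four_lt_log]
  have hτ : (0 : ℝ) < N.tau := by exact_mod_cast hN.tau_pos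
  have hQ : (0 : ℝ) < N.Q := by exact_mod_cast hN.Q_pos
  simp_rw [ncard_deliveredSet]
  rw [expectation_eq, ← hcard]
  set D : Fin N.tau → Fin N.Q → Bool → ℝ := fun a b far => ∑ X : Fin σ.length → Bool,
    bernoulliWeight N.lam X *
      ((delivered N lightest ((phaseCoins a b far).withKeep X) σ).card : ℝ) with hD
  have hD0 : ∀ a b far, 0 ≤ D a b far := fun a b far => Finset.sum_nonneg fun X _ =>
    mul_nonneg (bernoulliWeight_nonneg hN.lam_pos.le hN.lam_le_one X) (Nat.cast_nonneg _)
  have hnear : ∀ a b, ((O.filter fun i => IsNear N (phaseCoins a b false) (σ.get i)).card : ℝ) ≤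
      9 * N.log * D a b false := by
    intro a b
    -- The bound for near requests holds for every outcome of the sparsification coins, so it may be
    -- averaged with weights of sum `1`.
    rw [hD, Finset.mul_sum, ← mul_one ((O.filter _).card : ℝ),
      ← sum_bernoulliWeight (ι := Fin σ.length) N.lam, Finset.mul_sum]
    refine Finset.sum_le_sum fun X _ => ?_
    have := near_competitive (ω := (phaseCoins a b false).withKeep X) hN horacle rfl
      (hO.mono (Finset.filter_subset (fun i => IsNear N (phaseCoins a b false) (σ.get i)) O))
      fun i hi => (Finset.mem_filter.1 hi).2
    nlinarith [mul_le_mul_of_nonneg_left this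
      (bernoulliWeight_nonneg hN.lam_pos.le hN.lam_le_one X)]
  have hfar : ∀ a b, ((O.filter fun i => IsFarPlus N (phaseCoins a b true) (σ.get i)).card : ℝ) ≤
      16200 * N.log * D a b true := fun a b =>
    far_competitive hN horacle rfl
      (hO.mono (Finset.filter_subset (fun i => IsFarPlus N (phaseCoins a b true) (σ.get i)) O))
      fun i hi => (Finset.mem_filter.1 hi).2
  have hsum : O.card * ((N.tau * N.Q : ℝ) / 4) ≤
      16200 * N.log * ∑ a, ∑ b, (D a b false + D a b true) := by
    calc O.card * ((N.tau * N.Q : ℝ) / 4) = ∑ i ∈ O, (N.tau * N.Q : ℝ) / 4 := by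
          rw [Finset.sum_const, nsmul_eq_mul]
      _ ≤ ∑ i ∈ O, ∑ a : Fin N.tau, ∑ b : Fin N.Q,
          ((if IsNear N (phaseCoins a b false) (σ.get i) then 1 else 0) +
            if IsFarPlus N (phaseCoins a b true) (σ.get i) then (1 : ℝ) else 0) :=
          Finset.sum_le_sum fun i _ => le_card_near_add_card_farPlus (σ.get i)
      _ = ∑ a : Fin N.tau, ∑ b : Fin N.Q,
          (((O.filter fun i => IsNear N (phaseCoins a b false) (σ.get i)).card : ℝ) +
            (O.filter fun i => IsFarPlus N (phaseCoins a b true) (σ.get i)).card) := by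
          rw [Finset.sum_comm]
          refine Finset.sum_congr rfl fun a _ => ?_
          rw [Finset.sum_comm]
          refine Finset.sum_congr rfl fun b _ => ?_
          rw [Finset.sum_add_distrib, Finset.sum_boole, Finset.sum_boole]
      _ ≤ ∑ a, ∑ b, 16200 * N.log * (D a b false + D a b true) := by
          refine Finset.sum_le_sum fun a _ => Finset.sum_le_sum fun b _ => ?_
          have h1 := hnear a b
          have h2 := hfar a b
          have h3 := mul_nonneg hlog.le (hD0 a b false)
          linarith
      _ = _ := by simp only [Finset.mul_sum]
  have h1 : 0 < 2 * (N.tau : ℝ) * N.Q := by positivity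
  rw [one_div_mul_eq_div, one_div_mul_eq_div, div_le_div_iff₀ (by positivity) h1]
  linarith

end Phases

end PacketRouting

theorem mainTheorem1 :
    ∃ C : ℝ, 0 < C ∧ ∀ N : LineNetwork, 16 < N.n →
      1 ≤ N.B → (N.B : ℝ) ≤ Real.logb 2 N.n →
      1 ≤ N.c → (N.c : ℝ) ≤ Real.logb 2 N.n →
      ∀ oracle : Oracle, IsLightestPathOracle N oracle →
        -- for all random choices, the algorithm operates the network legally, never preempts a
        -- packet, and delivers every packet that it does not reject
        (∀ (σ : List (Request N.n)) (ω : Coins),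
          IsNonpreemptiveExecution N σ (alg N oracle ω σ) ∧
          ∀ T i, (alg N oracle ω σ T i).isSome → i ∈ deliveredSet σ (alg N oracle ω σ)) ∧
        -- it is online: what happens before time `T` depends only on the requests input before `T`
        (∀ (σ σ' : List (Request N.n)) (ω : Coins) (T : ℕ),
          (∀ (i : ℕ) (q : Request N.n), q.time < T → (σ[i]? = some q ↔ σ'[i]? = some q)) →
          ∀ T' ≤ T, alg N oracle ω σ T' = alg N oracle ω σ' T') ∧
        -- its expected throughput is at least `1 / (C log n)` times the optimal throughput
        ∀ σ : List (Request N.n),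
          1 / (C * Real.logb 2 N.n) * (opt N σ : ℝ) ≤
            expectation N σ.length fun ω =>
              ((deliveredSet σ (alg N oracle ω σ)).ncard : ℝ) := by
  -- The constant is `2 * 4 * 16200`: the fair coin, the random phases, and the bound for `Far⁺`,
  -- which dominates that for near requests.
  refine ⟨129600, by norm_num, fun N hn hB hB' hc hc' oracle horacle => ?_⟩
  have hN : N.Valid := ⟨hn, hB, hB', hc, hc'⟩
  exact ⟨fun σ ω => alg_legal hN horacle σ ω, fun σ σ' ω T h => alg_online σ σ' ω T h,
    fun σ => alg_competitive hN horacle σ⟩
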